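/- Let $k$ be a finite field, $\sigma$ an automorphism of $k$ of order $r$, $k^\sigma$ its fixed field and $q=\# k^\sigma$. Let $k[X,\sigma]$ be the ring of skew polynomials, with $Xa=\sigma(a)X$ for $a\in k$. For $P\in k[X,\sigma]$ let $D_P=k[X,\sigma]/k[X,\sigma]P$, and let $\varphi$ be the left multiplication by $X$ on $D_P$, so that $\varphi^r$ is $k$-linear; $P$ is étale if $\varphi$ is injective. *Type.* A table is a finite sequence $T=(a_1,\dots,a_m)$ of integers with $a_1\ge\dots\ge a_m\ge 1$. We say that $P$ has type $((W_1,T_1),\dots,(W_s,T_s))$, where each $T_l$ is a nonempty table and $W_1,\dots,W_s$ are pairwise distinct classes of irreducible spaces with an endomorphism over $k^\sigma$, given by distinct monic irreducible polynomials $N_1,\dots,N_s\in k^\sigma[Y]$ (the characteristic polynomials), if in some $k$-basis of $D_P$ the matrix of $\varphi^r$ has coefficients in $k^\sigma$ and is block diagonal with exactly one block $$\begin{pmatrix} A & I & & \\ & A & \ddots & \\ & & \ddots & I\\ & & & A\end{pmatrix}\qquad (a \text{ copies of } A)$$ for each $l$ and each entry $a$ of $T_l$, where $A$ is a matrix over $k^\sigma$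 (which may depend on the block) with characteristic polynomial $N_l$. Put $\delta_l=\dim W_l=\deg N_l$ and let $\tau_l$ be the sum of the entries of $T_l$. *Admissible paths.* Let $T=(a_1,\dots,a_m)$ be a table. For $1\le i\le m$ such that $i=m$ or $a_i>a_{i+1}$, there is one admissible path $\gamma$ starting at $T$; it ends at the table obtained by replacing $a_i$ by $a_i-1$ (and deleting this entry if it becomes $0$). Its weight, relative to $W_l$, is $w(\gamma)=\sum_{j\,:\,a_j=a_i} q^{\delta_l (j-1)}$. The weight $w(\Gamma)$ of a sequence $\Gamma$ of successive admissible paths is the product of the weights of its paths. **Statement.** Let $P\in k[X,\sigma]$ be monic and étale. Then $P$ has a type, and for every type $((W_1,T_1),\dots,(W_s,T_s))$ of $P$, the number of factorizations of $P$ as a product $P_1\cdots P_n$ of monic irreducible skew polynomials (ordered sequences $(P_1,\dots,P_n)$) is finite and equal to $$\frac{(\tau_1+\dots+\tau_s)!}{\tau_1!\cdots\tau_s!}\sum_{(\Gamma_1,\dots,\Gamma_s)} w(\Gamma_1)\cdots w(\Gamma_s),$$ where the sum is over all $s$-tuples in which $\Gamma_l$ is a sequence of admissible paths from $T_l$ to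 the empty table, with weights relative to $W_l$. -/

import Mathlib

noncomputable section

namespace SkewFactor

/-! ## Skew polynomials

The automorphism `σ` of `k` is registered, as Mathlib does, by an action of `Multiplicative ℕ` on
`k` by ring endomorphisms; the generator acts by `σ`.  For a finite field `k`, such actions
correspond exactly to the automorphisms `σ` of `k`. -/

section Skew

variable (k : Type*) [Field k] [MulSemiringAction (Multiplicative ℕ) k]

/-- The map `σ : k → k` of the skew polynomial ring `k[X, σ]`, in which `X a = σ(a) X`. -/
def sigma : k →+* k := MulSemiringAction.toRingHom (Multiplicative ℕ) k (Multiplicative.ofAdd 1)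

/-- The subfield `k^σ` of elements fixed by `σ`. -/
def fixedField : Subfield k := (sigma k).eqLocusField (RingHom.id k)

/-- The order `r` of `σ`. -/
def sigmaOrder : ℕ := orderOf (sigma k)

variable {k}

/-- A skew polynomial is monic if its leading coefficient is `1`. -/
def IsMonic (P : SkewPolynomial k) : Prop :=
  ∃ d : ℕ, P.coeff d = 1 ∧ ∀ n, d < n → P.coeff n = 0

/-- The `φ`-module `D_P = k[X, σ] / k[X, σ] P` (ideals are left ideals). -/
abbrev PhiModule (P : SkewPolynomial k) : Type _ :=
  SkewPolynomial k ⧸ (Ideal.span {P} : Ideal (SkewPolynomial k))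

theorem C_mul_eq_smul (a : k) (Q : SkewPolynomial k) : SkewPolynomial.C a * Q = a • Q := by
  have h : SkewPolynomial.C a = a • (1 : SkewPolynomial k) := by
    rw [← SkewPolynomial.monomial_zero_left, ← SkewPolynomial.monomial_zero_one,
      SkewPolynomial.smul_monomial, smul_eq_mul, mul_one]
  rw [h, smul_mul_assoc, one_mul]

theorem X_mul_smul (a : k) (Q : SkewPolynomial k) :
    SkewPolynomial.X * (a • Q) = sigma k a • (SkewPolynomial.X * Q) := by
  rw [← C_mul_eq_smul, ← C_mul_eq_smul, ← mul_assoc, ← mul_assoc,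
    ← SkewPolynomial.monomial_one_one_eq_X]
  congr 1
  rw [SkewPolynomial.monomial_mul_C, SkewPolynomial.C_mul_monomial]
  simp [sigma]

/-- The `σ`-semilinear map `φ : D_P → D_P`, left multiplication by `X`. -/
def phi (P : SkewPolynomial k) : PhiModule P →ₛₗ[sigma k] PhiModule P where
  toFun m := (SkewPolynomial.X : SkewPolynomial k) • m
  map_add' := smul_add _
  map_smul' a m := by
    obtain ⟨Q, rfl⟩ := Submodule.Quotient.mk_surjective _ m
    rw [← Submodule.Quotient.mk_smul, ← Submodule.Quotient.mk_smul, smul_eq_mul, X_mul_smul]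
    rfl

/-- `P` is étale if `φ` is injective on `D_P`. -/
def IsEtale (P : SkewPolynomial k) : Prop := Function.Injective (phi P)

theorem phi_iterate_smul (P : SkewPolynomial k) (n : ℕ) (a : k) (m : PhiModule P) :
    (phi P)^[n] (a • m) = ((sigma k) ^ n) a • (phi P)^[n] m := by
  induction n generalizing a m with
  | zero => simp
  | succ n ih =>
    rw [Function.iterate_succ_apply, map_smulₛₗ, ih, Function.iterate_succ_apply, pow_succ]
    rfl

/-- The `k`-linear endomorphism `φ^r` of `D_P`. -/
def phiPow (P : SkewPolynomial k) : PhiModule P →ₗ[k] PhiModule P where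
  toFun := (phi P)^[sigmaOrder k]
  map_add' := iterate_map_add (phi P) _
  map_smul' a m := by
    rw [phi_iterate_smul, sigmaOrder, pow_orderOf_eq_one]
    rfl

/-- The factorizations of `P` as a product of monic irreducible skew polynomials, i.e. the finite
sequences `(P_1, …, P_n)` of monic irreducible skew polynomials with `P = P_1 ⋯ P_n`. -/
def factorizations (P : SkewPolynomial k) : Set (List (SkewPolynomial k)) :=
  {L | (∀ Q ∈ L, IsMonic Q ∧ Irreducible Q) ∧ L.prod = P}

end Skew

/-! ## Tables, admissible paths and weights

A table is a list `[a_1, …, a_m]` with `a_1 ≥ ⋯ ≥ a_m ≥ 1`.  Its cells are numbered from `0`, and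
`Q ^ j` is written above the cell number `j`. -/

/-- `T` is the list of entries of a table. -/
def IsTable (T : List ℕ) : Prop := T.Pairwise (· ≥ ·) ∧ ∀ a ∈ T, 1 ≤ a

/-- The cells of `T` whose entry may be lowered: the last one, and those whose entry is larger than
the next entry. Admissible paths starting at `T` correspond to such cells. -/
def admissibleCells (T : List ℕ) : Finset ℕ :=
  (Finset.range T.length).filter fun i => i + 1 = T.length ∨ T.getD (i + 1) 0 < T.getD i 0

/-- The end of the path that lowers the entry of the cell `i` by `1`; a last cell with entry `1`
is removed. -/
def lower (T : List ℕ) (i : ℕ) : List ℕ :=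
  if i + 1 = T.length ∧ T.getD i 0 = 1 then T.dropLast else T.set i (T.getD i 0 - 1)

/-- The weight of the path from `T` that lowers the cell `i`: the sum of the coefficients `Q ^ j`
above all the cells that contain the same number as the cell `i`. -/
def pathWeight (Q : ℕ) (T : List ℕ) (i : ℕ) : ℕ :=
  ∑ j ∈ (Finset.range T.length).filter (fun j => T.getD j 0 = T.getD i 0), Q ^ j

/-- Sequences of `n` successive admissible paths from `T` to the empty table, each path being
recorded by the cell that it lowers. -/
def pathSeqsOfLength : ℕ → List ℕ → Finset (List ℕ)
  | 0, T => if T = [] then {[]} else ∅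
  | n + 1, T => (admissibleCells T).biUnion fun i =>
      (pathSeqsOfLength n (lower T i)).image fun Γ => i :: Γ

/-- All the sequences of admissible paths from `T` to the empty table. Every admissible path lowers
the sum of the entries by one, so their length is this sum. -/
def pathSeqs (T : List ℕ) : Finset (List ℕ) := pathSeqsOfLength T.sum T

/-- The weight of a sequence of paths starting at `T`: the product of the weights of its paths. -/
def seqWeight (Q : ℕ) : List ℕ → List ℕ → ℕ
  | _, [] => 1
  | T, i :: Γ => pathWeight Q T i * seqWeight Q (lower T i) Γ

/-! ## Types -/

/-- A type `((W_1, T_1), …, (W_s, T_s))` over a field `K`. The class `W_l` is given by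
the characteristic polynomial `N l` of the endomorphism on it. -/
structure JordanType (K : Type*) [Field K] where
  s : ℕ
  N : Fin s → Polynomial K
  T : Fin s → List ℕ
  monic : ∀ l, (N l).Monic
  irreducible : ∀ l, Irreducible (N l)
  injective : Function.Injective N
  isTable : ∀ l, IsTable (T l)
  ne_nil : ∀ l, T l ≠ []

namespace JordanType

variable {K : Type*} [Field K] (t : JordanType K)

/-- `τ_l`, the sum of the entries of the table `T_l`. -/
def tau (l : Fin t.s) : ℕ := (t.T l).sum

/-- `δ_l`, the dimension of `W_l`, i.e. the degree of its characteristic polynomial. -/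
def delta (l : Fin t.s) : ℕ := (t.N l).natDegree

/-- One Jordan block for each entry of each table. -/
abbrev Block : Type := Σ l : Fin t.s, Fin (t.T l).length

/-- The size of a Jordan block: the entry of the corresponding cell. -/
def size (i : t.Block) : ℕ := (t.T i.1).get i.2

end JordanType

/-- The Jordan block of size `a`, with `a` copies of `A` on the diagonal and identity matrices
just above it. -/
def jordanBlock {K : Type*} [Field K] {δ : ℕ} (A : Matrix (Fin δ) (Fin δ) K) (a : ℕ) :
    Matrix (Fin a × Fin δ) (Fin a × Fin δ) K :=
  fun x y =>
    if x.1 = y.1 then A x.2 y.2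
    else if (x.1 : ℕ) + 1 = y.1 then (1 : Matrix (Fin δ) (Fin δ) K) x.2 y.2
    else 0

/-- `P` has type `t` (the tables contain the sizes of the Jordan blocks): in some `k`-basis of
`D_P`, the matrix of `φ^r` has coefficients in `k^σ` and is in Jordan form, with, for each `l`
and each entry `a` of the table `T_l`, one Jordan block of size `a` whose diagonal matrix `A` has
characteristic polynomial `N_l`. -/
def HasType {k : Type*} [Field k] [MulSemiringAction (Multiplicative ℕ) k]
    (P : SkewPolynomial k) (t : JordanType (fixedField k)) : Prop :=
  ∃ A : ∀ i : t.Block, Matrix (Fin (t.delta i.1)) (Fin (t.delta i.1)) (fixedField k),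
    (∀ i, (A i).charpoly = t.N i.1) ∧
    ∃ b : Module.Basis (Σ i : t.Block, Fin (t.size i) × Fin (t.delta i.1)) k (PhiModule P),
      LinearMap.toMatrix b b (phiPow P) =
        (Matrix.blockDiagonal' fun i => jordanBlock (A i) (t.size i)).map (fixedField k).subtype

end SkewFactor

end

noncomputable section

namespace SkewFactor

open Polynomial

/-! ## The action of skew polynomials -/

section Action

variable {k : Type*} [Field k] [MulSemiringAction (Multiplicative ℕ) k]

/-! Splitting off the first factor of `P` amounts to choosing a simple submodule `S` of `D_P`: every
submodule is generated by the class of a unique monic right divisor `Q` of `P = P₁ Q`, it is simple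
exactly when `P₁` is irreducible, and `D_P / S ≅ D_Q`. The number of factorizations is therefore the
sum, over simple `S`, of the number for `D_P / S`. It remains to sort the simple submodules by the
shape of their quotient and to count each sort.

The centre contains `k^σ[X ^ r]`. By Schur, a simple `S` is killed by a monic irreducible `N` of
degree `δ`. Its endomorphism ring is a finite field, by Schur and Wedderburn. Galois descent
(`span_fixedVectors`, `natCard_fixedVectors`), applied to conjugation by `X` on the `k[X ^
r]`-linear maps, transfers this commutativity to those maps. So `S` is cyclic over `k[X ^ r]` with
annihilator `N`, has dimension `δ`, and admits `q ^ dim V` maps to any `V` killed by `N`. Sorting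
maps by their image, a submodule `U` killed by `N` contains `(q ^ dim U - 1) / (q ^ δ - 1)` simple
submodules (`natCard_simple_mul_add_one`).

The layer `ker N ∩ im N ^ a` has dimension `δ` times the number of table entries larger than `a`. A
simple submodule in layer `a` but not in layer `a + 1` lowers one entry `a + 1` in the quotient
(`HasTables.quotient`), and the difference of two layer counts is a geometric sum, the weight of the
path (`HasTables.natCard_simple`). The predicted number satisfies the same recursion
(`predicted_eq`), so induction on the sum of the tables concludes in `encard_factorizations`. A type
enters only through the dimensions of the kernels of `N_l(X ^ r) ^ j`, read off the Jordan blocks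
(`hasTables_of_hasType`).

For the existence of a type, one seeks `v ∈ k[X ^ r]` such that `v X` acts with `r`-th power the
identity. This says that the norm of `v` inverts `Y` modulo the annihilator of `D_P`. It is solved
modulo irreducible factors by means of simple submodules, then lifted to powers by Newton's method
and glued by the Chinese remainder theorem (`exists_twist`). The vectors fixed by `v X` are a
`k^σ`-form of `D_P` stable under `X ^ r`, and Jordan theory over the perfect field `k^σ` applies to
it. -/

theorem sigma_injective : Function.Injective (sigma k) := (sigma k).injective

theorem sigma_bijective [Finite k] : Function.Bijective (sigma k) :=
  Finite.injective_iff_bijective.1 sigma_injective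

/-- Rules out the value `0` that `orderOf` takes on elements of infinite order: two powers of `σ`
coincide, and injectivity cancels the smaller one. -/
theorem sigmaOrder_pos [Finite k] : 0 < sigmaOrder k := by
  have : Finite (k →+* k) := Finite.of_injective (fun f : k →+* k => (f : k → k))
    DFunLike.coe_injective
  obtain ⟨m, n, hmn, h⟩ := Finite.exists_ne_map_eq_of_infinite (fun n : ℕ => sigma k ^ n)
  wlog hlt : m < n generalizing m n
  · exact this n m hmn.symm h.symm (by omega)
  rw [sigmaOrder, orderOf_pos_iff, isOfFinOrder_iff_pow_eq_one]
  refine ⟨n - m, by omega, RingHom.ext fun a => (sigma k ^ m).injective ?_⟩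
  have h2 := congrArg (fun f : k →+* k => f a) h
  have h3 : sigma k ^ n = sigma k ^ m * sigma k ^ (n - m) := by rw [← pow_add]; congr 1; omega
  simp only [h3] at h2
  exact h2.symm

theorem sigma_pow_sigmaOrder (a : k) : (sigma k ^ sigmaOrder k) a = a := by
  rw [sigmaOrder, pow_orderOf_eq_one]; rfl

theorem mem_fixedField {a : k} : a ∈ fixedField k ↔ sigma k a = a := Iff.rfl

theorem X_mul_C (a : k) :
    (SkewPolynomial.X : SkewPolynomial k) * SkewPolynomial.C a =
      SkewPolynomial.C (sigma k a) * SkewPolynomial.X := by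
  have := X_mul_smul a (1 : SkewPolynomial k)
  rw [← C_mul_eq_smul, ← C_mul_eq_smul] at this
  simpa using this

theorem X_pow_mul_C (n : ℕ) (a : k) :
    (SkewPolynomial.X : SkewPolynomial k) ^ n * SkewPolynomial.C a =
      SkewPolynomial.C ((sigma k ^ n) a) * SkewPolynomial.X ^ n := by
  induction n generalizing a with
  | zero => simp
  | succ n ih =>
    rw [pow_succ, mul_assoc, X_mul_C, ← mul_assoc, ih, mul_assoc, pow_succ]
    rfl

/-- The subring `k[X ^ r]` of `k[X, σ]`. -/
def rho (k : Type*) [Field k] [MulSemiringAction (Multiplicative ℕ) k] :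
    k[X] →+* SkewPolynomial k :=
  -- Evaluation is multiplicative because `X ^ r` commutes with the constants, as `σ ^ r = 1`.
  Polynomial.eval₂RingHom' SkewPolynomial.CRingHom (SkewPolynomial.X ^ sigmaOrder k) fun a => by
    rw [SkewPolynomial.CRingHom_eq_C, commute_iff_eq, X_pow_mul_C, sigma_pow_sigmaOrder]

@[simp] theorem rho_C (a : k) : rho k (C a) = SkewPolynomial.C a := by
  simp [rho, eval₂RingHom', SkewPolynomial.CRingHom_eq_C]

@[simp] theorem rho_X : rho k X = SkewPolynomial.X ^ sigmaOrder k := by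
  simp [rho, eval₂RingHom']

theorem X_mul_rho (f : k[X]) :
    SkewPolynomial.X * rho k f = rho k (f.map (sigma k)) * SkewPolynomial.X := by
  induction f using Polynomial.induction_on' with
  | add p q hp hq => rw [map_add, mul_add, hp, hq, Polynomial.map_add, map_add, add_mul]
  | monomial n a =>
    rw [← C_mul_X_pow_eq_monomial, map_mul, rho_C, map_pow, rho_X, ← mul_assoc, X_mul_C,
      Polynomial.map_mul, map_mul, map_C, rho_C, Polynomial.map_pow, map_X, map_pow, rho_X,
      mul_assoc, mul_assoc]
    congr 1
    rw [← pow_mul, ← pow_succ', ← pow_succ]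

/-- The subring `k^σ[X ^ r]` of `k[X, σ]`, which is central. -/
def zeta (k : Type*) [Field k] [MulSemiringAction (Multiplicative ℕ) k] :
    (fixedField k)[X] →+* SkewPolynomial k :=
  (rho k).comp (mapRingHom (fixedField k).subtype)

theorem zeta_apply (f : (fixedField k)[X]) : zeta k f = rho k (f.map (fixedField k).subtype) := rfl

theorem map_sigma_map_subtype (f : (fixedField k)[X]) :
    (f.map (fixedField k).subtype).map (sigma k) = f.map (fixedField k).subtype := by
  ext n
  simpa using (mem_fixedField.1 (f.coeff n).2)

theorem skew_induction {motive : SkewPolynomial k → Prop} (Q : SkewPolynomial k)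
    (hC : ∀ a, motive (SkewPolynomial.C a)) (hX : motive SkewPolynomial.X)
    (hadd : ∀ p q, motive p → motive q → motive (p + q))
    (hmul : ∀ p q, motive p → motive q → motive (p * q)) : motive Q := by
  induction Q using SkewPolynomial.induction with
  | h0 => simpa [SkewPolynomial.C_0] using hC 0
  | ha n a q hn ha hq =>
    clear hn ha
    refine hadd _ _ ?_ hq
    rw [← SkewPolynomial.C_mul_X_pow_eq_monomial]
    refine hmul _ _ (hC a) ?_
    induction n with
    | zero => simpa [SkewPolynomial.C_1] using hC 1
    | succ n ih => rw [pow_succ]; exact hmul _ _ ih hX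

theorem rho_mul_C (f : k[X]) (a : k) :
    rho k f * SkewPolynomial.C a = SkewPolynomial.C a * rho k f := by
  rw [← rho_C, ← map_mul, ← map_mul, mul_comm]

theorem zeta_mul (f : (fixedField k)[X]) (Q : SkewPolynomial k) : zeta k f * Q = Q * zeta k f := by
  induction Q using skew_induction with
  | hC a => rw [zeta_apply, rho_mul_C]
  | hX => rw [zeta_apply, X_mul_rho, map_sigma_map_subtype]
  | hadd p q hp hq => rw [mul_add, hp, hq, add_mul]
  | hmul p q hp hq => rw [← mul_assoc, hp, mul_assoc, hq, mul_assoc]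

variable {D : Type*} [AddCommGroup D] [Module (SkewPolynomial k) D] [Module k D]
  [IsScalarTower k (SkewPolynomial k) D]

theorem C_smul (a : k) (d : D) : (SkewPolynomial.C a : SkewPolynomial k) • d = a • d := by
  have h := C_mul_eq_smul a (1 : SkewPolynomial k)
  rw [mul_one] at h
  rw [h, smul_assoc, one_smul]

theorem X_smul_smul (a : k) (d : D) :
    (SkewPolynomial.X : SkewPolynomial k) • a • d =
      sigma k a • (SkewPolynomial.X : SkewPolynomial k) • d := by
  rw [← C_smul, smul_smul, X_mul_C, mul_smul, C_smul]

theorem rho_smul_smul (f : k[X]) (a : k) (d : D) : rho k f • a • d = a • rho k f • d := by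
  rw [← C_smul, smul_smul, rho_mul_C, mul_smul, C_smul]

variable {E : Type*} [AddCommGroup E] [Module (SkewPolynomial k) E] [Module k E]
  [IsScalarTower k (SkewPolynomial k) E]

/-- A `k`-linear map that commutes with `X` is linear over skew polynomials. -/
def ofCommutes (f : D →ₗ[k] E)
    (h : ∀ d, f ((SkewPolynomial.X : SkewPolynomial k) • d) =
      (SkewPolynomial.X : SkewPolynomial k) • f d) : D →ₗ[SkewPolynomial k] E where
  toFun := f
  map_add' := f.map_add
  map_smul' Q d := by
    change f (Q • d) = Q • f d
    induction Q using skew_induction generalizing d with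
    | hC a => rw [C_smul, C_smul, map_smul]
    | hX => exact h d
    | hadd p q hp hq => rw [add_smul, map_add, hp, hq, add_smul]
    | hmul p q hp hq => rw [mul_smul, hp, hq, mul_smul]

variable (D) in
/-- Multiplication by `f(X ^ r)`, as a `k`-linear map. -/
def rhoEnd (f : k[X]) : Module.End k D where
  toFun d := rho k f • d
  map_add' := smul_add _
  map_smul' a d := rho_smul_smul f a d

@[simp] theorem rhoEnd_apply (f : k[X]) (d : D) : rhoEnd D f d = rho k f • d := rfl

/-- The bridge to linear algebra: minimal polynomials, semisimplicity and Jordan forms of the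
endomorphism `X ^ r` become statements about the action of `k[X ^ r]`. -/
theorem aeval_rhoEnd_X (f : k[X]) : aeval (rhoEnd D X) f = rhoEnd D f := by
  induction f using Polynomial.induction_on' with
  | add p q hp hq => rw [map_add, hp, hq]; ext; simp [add_smul]
  | monomial n a =>
    ext d
    rw [← C_mul_X_pow_eq_monomial, map_mul, aeval_C, map_pow, aeval_X, rhoEnd_apply, map_mul,
      mul_smul, rho_C, C_smul, Module.End.mul_apply, Module.algebraMap_end_apply]
    congr 1
    induction n with
    | zero => simp
    | succ n ih => rw [pow_succ', Module.End.mul_apply, ih, rhoEnd_apply, pow_succ', map_mul, mul_smul]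

end Action

/-! ### Multiplication by central elements -/

section Central

variable {k : Type*} [Field k] [MulSemiringAction (Multiplicative ℕ) k]
variable {D : Type*} [AddCommGroup D] [Module (SkewPolynomial k) D]

variable (D) in
/-- Multiplication by the central element `f(X ^ r)`, for `f` with coefficients in `k^σ`. -/
def zetaEnd (f : (fixedField k)[X]) : D →ₗ[SkewPolynomial k] D where
  toFun d := zeta k f • d
  map_add' := smul_add _
  map_smul' a d := by rw [smul_smul, zeta_mul, mul_smul]; rfl

@[simp] theorem zetaEnd_apply (f : (fixedField k)[X]) (d : D) : zetaEnd D f d = zeta k f • d := rfl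

end Central

/-! ## Galois descent for semilinear maps -/

section Descent

variable {k : Type*} [Field k] [MulSemiringAction (Multiplicative ℕ) k]

/-- Dedekind's independence of characters: the powers `σ ^ i` with `i < r` are distinct. -/
theorem eq_zero_of_sum_sigma_pow_mul_eq_zero {c : ℕ → k}
    (h : ∀ a, ∑ i ∈ Finset.range (sigmaOrder k), (sigma k ^ i) a * c i = 0) {i : ℕ}
    (hi : i < sigmaOrder k) : c i = 0 := by
  have hinj : Function.Injective fun i : Fin (sigmaOrder k) =>
      ((sigma k ^ (i : ℕ) : k →+* k) : k →* k) := by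
    intro i j hij
    refine Fin.ext (pow_injOn_Iio_orderOf i.2 j.2 (RingHom.ext fun a => ?_))
    exact congrArg (fun f : k →* k => f a) hij
  have h2 := (linearIndependent_monoidHom k k).comp _ hinj
  rw [Fintype.linearIndependent_iff] at h2
  refine h2 (fun i => c i) ?_ ⟨i, hi⟩
  ext a
  rw [Pi.zero_apply, ← h a, Finset.sum_range, Finset.sum_apply]
  exact Finset.sum_congr rfl fun i _ => mul_comm _ _

/-- Applying `f` permutes the terms of the orbit sum cyclically. -/
theorem sum_iterate_fixed {M : Type*} [AddCommGroup M] (f : M →+ M) {n : ℕ}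
    (h : ∀ m, f^[n] m = m) (m : M) :
    f (∑ i ∈ Finset.range n, f^[i] m) = ∑ i ∈ Finset.range n, f^[i] m := by
  rw [map_sum]
  simp_rw [← Function.iterate_succ_apply' f]
  have h1 := Finset.sum_range_succ' (fun i => f^[i] m) n
  rw [Finset.sum_range_succ, h m] at h1
  exact (add_right_cancel h1).symm

theorem exists_trace_ne_zero [Finite k] {c : k} (hc : c ≠ 0) :
    ∃ a, ∑ i ∈ Finset.range (sigmaOrder k), (sigma k ^ i) (a * c) ≠ 0 := by
  by_contra! h
  refine hc (eq_zero_of_sum_sigma_pow_mul_eq_zero (c := fun i => (sigma k ^ i) c)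
    (fun a => ?_) sigmaOrder_pos)
  simpa using h a

theorem trace_mem_fixedField (a : k) :
    ∑ i ∈ Finset.range (sigmaOrder k), (sigma k ^ i) a ∈ fixedField k := by
  rw [mem_fixedField]
  have := sum_iterate_fixed (sigma k : k →+ k) (n := sigmaOrder k) (fun m => ?_) a
  · simpa [RingHom.coe_pow] using this
  · simpa [RingHom.coe_pow] using sigma_pow_sigmaOrder m

theorem exists_trace_eq_one [Finite k] :
    ∃ a : k, ∑ i ∈ Finset.range (sigmaOrder k), (sigma k ^ i) a = 1 := by
  obtain ⟨a, ha⟩ := exists_trace_ne_zero (one_ne_zero (α := k))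
  rw [mul_one] at ha
  set t := ∑ i ∈ Finset.range (sigmaOrder k), (sigma k ^ i) a with ht
  have hfix : ∀ i, (sigma k ^ i) t⁻¹ = t⁻¹ := by
    have h1 : sigma k t⁻¹ = t⁻¹ := by
      rw [map_inv₀, mem_fixedField.1 (trace_mem_fixedField a)]
    intro i
    rw [RingHom.coe_pow]
    exact Function.iterate_fixed h1 i
  refine ⟨t⁻¹ * a, ?_⟩
  simp_rw [map_mul, hfix]
  rw [← Finset.mul_sum, ← ht, inv_mul_cancel₀ ha]

variable {M : Type*} [AddCommGroup M] [Module k M] (ψ : M →ₛₗ[sigma k] M)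

theorem iterate_semilinear_smul (n : ℕ) (a : k) (m : M) :
    ψ^[n] (a • m) = (sigma k ^ n) a • ψ^[n] m := by
  induction n generalizing a m with
  | zero => simp
  | succ n ih =>
    rw [Function.iterate_succ_apply, map_smulₛₗ, ih, Function.iterate_succ_apply, pow_succ]
    rfl

/-- The vectors fixed by a semilinear map. -/
def fixedVectors : Submodule (fixedField k) M where
  carrier := {m | ψ m = m}
  add_mem' {a b} ha hb := by
    change ψ (a + b) = a + b
    rw [map_add, show ψ a = a from ha, show ψ b = b from hb]
  zero_mem' := map_zero ψ
  smul_mem' a m hm := by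
    change ψ ((a : k) • m) = (a : k) • m
    rw [map_smulₛₗ, show ψ m = m from hm, mem_fixedField.1 a.2]

theorem mem_fixedVectors {m : M} : m ∈ fixedVectors ψ ↔ ψ m = m := Iff.rfl

variable {ψ}

theorem trace_mem_fixedVectors (h : ∀ m, ψ^[sigmaOrder k] m = m) (m : M) :
    ∑ i ∈ Finset.range (sigmaOrder k), ψ^[i] m ∈ fixedVectors ψ :=
  sum_iterate_fixed (ψ : M →+ M) h m

/-- A linear form `f` that vanishes on fixed vectors vanishes on the trace of `a • m` for every `a`.
Independence of characters then kills each `f (ψ^[i] m)`, and `i = 0` gives `f m = 0`. -/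
theorem span_fixedVectors [Finite k] (h : ∀ m, ψ^[sigmaOrder k] m = m) :
    Submodule.span k (fixedVectors ψ : Set M) = ⊤ := by
  by_contra hne
  obtain ⟨f, hf, hle⟩ := Submodule.exists_le_ker_of_lt_top _ (lt_top_iff_ne_top.2 hne)
  refine hf (LinearMap.ext fun m => ?_)
  refine eq_zero_of_sum_sigma_pow_mul_eq_zero (c := fun i => f (ψ^[i] m)) (fun a => ?_)
    sigmaOrder_pos
  have := hle (Submodule.subset_span (trace_mem_fixedVectors h (a • m)))
  rw [LinearMap.mem_ker, map_sum] at this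
  rw [← this]
  refine Finset.sum_congr rfl fun i _ => ?_
  rw [iterate_semilinear_smul, map_smul, smul_eq_mul]

/-- Scale a relation so that a chosen nonzero coefficient acquires a nonzero trace. Summing its
images under the iterates of `ψ` replaces coefficients by their traces, which gives a relation over
the fixed field. -/
theorem linearIndependent_fixedVectors [Finite k] {ι : Type*} [Fintype ι]
    {v : ι → fixedVectors ψ} (hv : LinearIndependent (fixedField k) v) :
    LinearIndependent k fun i => (v i : M) := by
  rw [Fintype.linearIndependent_iff] at hv ⊢
  intro c hc i
  by_contra hi
  obtain ⟨a, ha⟩ := exists_trace_ne_zero hi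
  refine ha ?_
  have key := hv (fun i => ⟨_, trace_mem_fixedField (a * c i)⟩) ?_ i
  · exact congrArg Subtype.val key
  · have hfix : ∀ (j : ℕ) (i : ι), ψ^[j] (v i : M) = v i := fun j i =>
      Function.iterate_fixed (v i).2 j
    refine Subtype.ext ?_
    rw [AddSubmonoidClass.coe_finsetSum]
    change ∑ i, (∑ j ∈ Finset.range (sigmaOrder k), (sigma k ^ j) (a * c i)) • (v i : M) = 0
    simp_rw [Finset.sum_smul]
    rw [Finset.sum_comm]
    refine Finset.sum_eq_zero fun j _ => ?_
    have h2 := congrArg (fun m => (ψ ^[j]) (a • m)) hc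
    simp only [smul_zero, iterate_map_zero, Finset.smul_sum] at h2
    rw [← h2]
    have h3 : ∀ s : Finset ι, ∀ g : ι → M, ψ^[j] (∑ i ∈ s, g i) = ∑ i ∈ s, ψ^[j] (g i) :=
      fun s g => map_sum (⟨⟨ψ^[j], iterate_map_zero ψ j⟩, iterate_map_add ψ j⟩ : M →+ M) g s
    rw [h3]
    refine Finset.sum_congr rfl fun i _ => ?_
    rw [smul_smul, iterate_semilinear_smul, hfix]

theorem natCard_fixedVectors [Finite k] [Module.Finite k M]
    (h : ∀ m, ψ^[sigmaOrder k] m = m) :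
    Nat.card (fixedVectors ψ) = Nat.card (fixedField k) ^ Module.finrank k M := by
  have : Finite M := Module.finite_of_finite k
  have : Module.Finite (fixedField k) (fixedVectors ψ) := Module.Finite.of_finite
  let b := Module.finBasis (fixedField k) (fixedVectors ψ)
  have hb : Module.finrank k M = Module.finrank (fixedField k) (fixedVectors ψ) := by
    refine (Module.finrank_eq_card_basis (Module.Basis.mk
      (linearIndependent_fixedVectors b.linearIndependent) ?_)).trans (Fintype.card_fin _)
    rw [← span_fixedVectors h, Submodule.span_le]
    intro m hm
    rw [SetLike.mem_coe]
    have hs := b.sum_repr ⟨m, hm⟩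
    have hs' := congrArg Subtype.val hs
    rw [AddSubmonoidClass.coe_finsetSum] at hs'
    rw [show m = _ from hs'.symm]
    refine Submodule.sum_mem _ fun i _ => ?_
    exact Submodule.smul_mem _ ((b.repr ⟨m, hm⟩ i : fixedField k) : k)
      (Submodule.subset_span ⟨i, rfl⟩)
  rw [hb, Module.natCard_eq_pow_finrank (K := fixedField k)]

end Descent

/-! ## Descent for homomorphisms -/

section Hom

variable {k : Type*} [Field k] [MulSemiringAction (Multiplicative ℕ) k]

/-- `X` acts injectively on `D`. -/
def XInjective (k : Type*) [Field k] [MulSemiringAction (Multiplicative ℕ) k]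
    (D : Type*) [AddCommGroup D] [Module (SkewPolynomial k) D] : Prop :=
  Function.Injective fun d : D => (SkewPolynomial.X : SkewPolynomial k) • d

section

variable {D : Type*} [AddCommGroup D] [Module (SkewPolynomial k) D]

theorem XInjective.bijective [Finite D] (h : XInjective k D) :
    Function.Bijective fun d : D => (SkewPolynomial.X : SkewPolynomial k) • d :=
  Finite.injective_iff_bijective.1 h

theorem XInjective.pow_bijective [Finite D] (h : XInjective k D) (n : ℕ) :
    Function.Bijective fun d : D => (SkewPolynomial.X : SkewPolynomial k) ^ n • d := by
  induction n with
  | zero => simpa using! Function.bijective_id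
  | succ n ih =>
    have : (fun d : D => (SkewPolynomial.X : SkewPolynomial k) ^ (n + 1) • d) =
        (fun d : D => (SkewPolynomial.X : SkewPolynomial k) ^ n • d) ∘
          (fun d : D => (SkewPolynomial.X : SkewPolynomial k) • d) := by
      ext d; simp [pow_succ, mul_smul]
    rw [this]
    exact ih.comp h.bijective

theorem XInjective.submodule (h : XInjective k D) (U : Submodule (SkewPolynomial k) D) :
    XInjective k U := fun _ _ hab => Subtype.ext (h (congrArg Subtype.val hab))

/-- Surjectivity is what passes to quotients; finiteness converts it to and from injectivity. -/
theorem XInjective.quotient [Finite D] (h : XInjective k D)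
    (U : Submodule (SkewPolynomial k) D) : XInjective k (D ⧸ U) := by
  have : Finite (D ⧸ U) := Finite.of_surjective _ (Submodule.mkQ_surjective U)
  refine (Finite.injective_iff_surjective (α := D ⧸ U)).2 fun b => ?_
  obtain ⟨b, rfl⟩ := Submodule.mkQ_surjective U b
  obtain ⟨a, rfl⟩ := h.bijective.2 b
  exact ⟨U.mkQ a, (map_smul _ _ _).symm⟩

end

variable {S : Type*} [AddCommGroup S] [Module (SkewPolynomial k) S] [Module k S]
  [IsScalarTower k (SkewPolynomial k) S]
variable {V : Type*} [AddCommGroup V] [Module (SkewPolynomial k) V] [Module k V]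
  [IsScalarTower k (SkewPolynomial k) V]

variable (k S V) in
/-- The `k`-linear maps that commute with `X ^ r`. -/
def XHom : Submodule k (S →ₗ[k] V) where
  carrier := {f | ∀ s, f (rho k X • s) = rho k X • f s}
  add_mem' {f g} hf hg s := by
    rw [LinearMap.add_apply, hf, hg, LinearMap.add_apply, smul_add]
  zero_mem' s := by simp
  smul_mem' a f hf s := by
    rw [LinearMap.smul_apply, hf, LinearMap.smul_apply, rho_smul_smul]

theorem XHom.map_rho_smul (f : XHom k S V) (g : k[X]) (s : S) :
    (f : S →ₗ[k] V) (rho k g • s) = rho k g • (f : S →ₗ[k] V) s := by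
  induction g using Polynomial.induction_on' with
  | add p q hp hq => rw [map_add, add_smul, map_add, hp, hq, add_smul]
  | monomial n a =>
    rw [← C_mul_X_pow_eq_monomial, map_mul, mul_smul, mul_smul, rho_C, C_smul, C_smul, map_smul]
    congr 1
    induction n with
    | zero => simp
    | succ n ih => rw [pow_succ', map_mul, mul_smul, mul_smul, f.2, ih]

theorem projection_mem_XHom {U W : Submodule k S} (h : IsCompl U W)
    (hU : ∀ u ∈ U, rho k X • u ∈ U) (hW : ∀ w ∈ W, rho k X • w ∈ W) :
    U.projection W h ∈ XHom k S S := by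
  intro s
  have h1 := Submodule.projection_add_projection_eq_self h s
  have h2 : rho k X • U.projection W h s ∈ U := hU _ (Submodule.projection_apply_mem h s)
  have h3 : rho k X • W.projection _ h.symm s ∈ W :=
    hW _ (Submodule.projection_apply_mem h.symm s)
  conv_lhs => rw [← h1, smul_add, map_add, Submodule.projection_apply_of_mem_left h h2,
    (Submodule.projection_apply_eq_zero_iff h).2 h3, add_zero]

variable [Finite k] [Finite S]

/-- The semilinear conjugation `f ↦ X f X⁻¹`. -/
def conjX (hS : XInjective k S) : XHom k S V →ₛₗ[sigma k] XHom k S V where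
  toFun f := ⟨
    { toFun s := (SkewPolynomial.X : SkewPolynomial k) •
        (f : S →ₗ[k] V) ((Equiv.ofBijective _ hS.bijective).symm s)
      map_add' s t := by
        obtain ⟨s, rfl⟩ := (Equiv.ofBijective _ hS.bijective).surjective s
        obtain ⟨t, rfl⟩ := (Equiv.ofBijective _ hS.bijective).surjective t
        have key : (Equiv.ofBijective _ hS.bijective).symm
            ((Equiv.ofBijective _ hS.bijective) s + (Equiv.ofBijective _ hS.bijective) t) =
            s + t := (Equiv.symm_apply_eq _).2 (smul_add _ _ _).symm
        rw [key, Equiv.symm_apply_apply, Equiv.symm_apply_apply, map_add, smul_add]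
      map_smul' a s := by
        obtain ⟨s, rfl⟩ := (Equiv.ofBijective _ hS.bijective).surjective s
        obtain ⟨a, rfl⟩ := sigma_bijective.2 a
        have key : (Equiv.ofBijective _ hS.bijective).symm
            (sigma k a • (Equiv.ofBijective _ hS.bijective) s) = a • s :=
          (Equiv.symm_apply_eq _).2 (X_smul_smul _ _).symm
        rw [key, Equiv.symm_apply_apply, RingHom.id_apply, map_smul, X_smul_smul] },
    fun s => by
      obtain ⟨s, rfl⟩ := (Equiv.ofBijective _ hS.bijective).surjective s
      change (SkewPolynomial.X : SkewPolynomial k) • (f : S →ₗ[k] V) _ =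
        rho k X • (SkewPolynomial.X : SkewPolynomial k) • (f : S →ₗ[k] V) _
      have hX : rho k X * (SkewPolynomial.X : SkewPolynomial k) = SkewPolynomial.X * rho k X := by
        rw [X_mul_rho, map_X]
      rw [Equiv.symm_apply_apply, smul_smul, hX, mul_smul, ← f.2]
      congr 2
      rw [Equiv.symm_apply_eq, Equiv.ofBijective_apply, Equiv.ofBijective_apply, smul_smul, hX,
        mul_smul]⟩
  map_add' f g := by
    refine Subtype.ext (LinearMap.ext fun s => ?_)
    exact smul_add _ _ _
  map_smul' a f := by
    refine Subtype.ext (LinearMap.ext fun s => ?_)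
    exact X_smul_smul _ _

theorem conjX_apply (hS : XInjective k S) (f : XHom k S V) (s : S) :
    (conjX hS f : S →ₗ[k] V) ((SkewPolynomial.X : SkewPolynomial k) • s) =
      (SkewPolynomial.X : SkewPolynomial k) • (f : S →ₗ[k] V) s := by
  change (SkewPolynomial.X : SkewPolynomial k) • (f : S →ₗ[k] V) _ = _
  congr 2
  exact (Equiv.ofBijective _ hS.bijective).symm_apply_apply s

theorem conjX_iterate_apply (hS : XInjective k S) (f : XHom k S V) (n : ℕ) (s : S) :
    ((conjX hS)^[n] f : S →ₗ[k] V) ((SkewPolynomial.X : SkewPolynomial k) ^ n • s) =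
      (SkewPolynomial.X : SkewPolynomial k) ^ n • (f : S →ₗ[k] V) s := by
  induction n with
  | zero => simp
  | succ n ih =>
    rw [pow_succ', mul_smul, Function.iterate_succ_apply', conjX_apply, ih, mul_smul]

/-- Conjugating `r` times is conjugating by `X ^ r`, with which `f` commutes. This is the hypothesis
that descent requires. -/
theorem conjX_iterate_sigmaOrder (hS : XInjective k S) (f : XHom k S V) :
    (conjX hS)^[sigmaOrder k] f = f := by
  refine Subtype.ext (LinearMap.ext fun s => ?_)
  obtain ⟨s, rfl⟩ := (hS.pow_bijective (sigmaOrder k)).2 s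
  rw [conjX_iterate_apply, ← rho_X, XHom.map_rho_smul]

/-- The maps fixed by conjugation are the linear maps over skew polynomials. -/
def fixedConjXEquiv (hS : XInjective k S) :
    fixedVectors (conjX (V := V) hS) ≃ (S →ₗ[SkewPolynomial k] V) where
  toFun f := ofCommutes ((f : XHom k S V) : S →ₗ[k] V) fun s => by
    rw [← conjX_apply hS, (mem_fixedVectors _).1 f.2]
  invFun f := ⟨⟨f.restrictScalars k, fun s => f.map_smul _ _⟩, by
    rw [mem_fixedVectors]
    refine Subtype.ext (LinearMap.ext fun s => ?_)
    obtain ⟨s, rfl⟩ := hS.bijective.2 s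
    simp only
    rw [conjX_apply]
    exact (f.map_smul _ _).symm⟩
  left_inv f := rfl
  right_inv f := rfl

theorem natCard_linearMap [Finite V] (hS : XInjective k S) :
    Nat.card (S →ₗ[SkewPolynomial k] V) =
      Nat.card (fixedField k) ^ Module.finrank k (XHom k S V) := by
  rw [← natCard_fixedVectors (conjX_iterate_sigmaOrder (V := V) hS),
    Nat.card_congr (fixedConjXEquiv hS)]

end Hom

/-! ## Cyclic modules over `k[X ^ r]` -/

section Cyclic

variable {k : Type*} [Field k] [MulSemiringAction (Multiplicative ℕ) k]

variable {S : Type*} [AddCommGroup S] [Module (SkewPolynomial k) S] [Module k S]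
  [IsScalarTower k (SkewPolynomial k) S]
variable {V : Type*} [AddCommGroup V] [Module (SkewPolynomial k) V] [Module k V]
  [IsScalarTower k (SkewPolynomial k) V]

variable (k) in
/-- The map `f ↦ f(X ^ r) s`. -/
def cyc (s : S) : k[X] →ₗ[k] S where
  toFun f := rho k f • s
  map_add' f g := by rw [map_add, add_smul]
  map_smul' a f := by
    rw [smul_eq_C_mul, map_mul, mul_smul, rho_C, C_smul, RingHom.id_apply]

@[simp] theorem cyc_apply (s : S) (f : k[X]) : cyc k s f = rho k f • s := rfl

theorem rho_smul_mem_range_cyc (s : S) (f : k[X]) {t : S} (ht : t ∈ LinearMap.range (cyc k s)) :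
    rho k f • t ∈ LinearMap.range (cyc k s) := by
  obtain ⟨g, rfl⟩ := ht
  exact ⟨f * g, by rw [cyc_apply, cyc_apply, map_mul, mul_smul]⟩

theorem self_mem_range_cyc (s : S) : s ∈ LinearMap.range (cyc k s) :=
  ⟨1, by rw [cyc_apply, map_one, one_smul]⟩

/-- `s` generates `S` over `k[X ^ r]`, with annihilator generated by `f`. -/
def IsCyclicVector (s : S) (f : k[X]) : Prop :=
  (∀ t, ∃ g, rho k g • s = t) ∧ ∀ g, rho k g • s = 0 ↔ f ∣ g

theorem finrank_eq_natDegree_of_ker_eq {F M : Type*} [Field F] [AddCommGroup M] [Module F M]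
    {φ : F[X] →ₗ[F] M} (hφ : Function.Surjective φ) {f : F[X]} (h : ∀ g, φ g = 0 ↔ f ∣ g) :
    Module.finrank F M = f.natDegree := by
  rw [← finrank_quotient_span_eq_natDegree, ← (φ.quotKerEquivOfSurjective hφ).finrank_eq]
  have : LinearMap.ker φ = (Ideal.span {f}).restrictScalars F := by
    ext g
    rw [LinearMap.mem_ker, h, Submodule.restrictScalars_mem, Ideal.mem_span_singleton]
  rw [this]
  exact (Submodule.Quotient.restrictScalarsEquiv F (Ideal.span {f})).finrank_eq

theorem IsCyclicVector.finrank_eq {s : S} {f : k[X]} (h : IsCyclicVector s f) :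
    Module.finrank k S = f.natDegree :=
  finrank_eq_natDegree_of_ker_eq (φ := cyc k s) h.1 h.2

/-- A map `φ` that factors through the surjection `π`. -/
theorem exists_linearMap_comp_eq {F A B C : Type*} [Field F] [AddCommGroup A] [Module F A]
    [AddCommGroup B] [Module F B] [AddCommGroup C] [Module F C] {π : A →ₗ[F] B}
    (hπ : Function.Surjective π) {φ : A →ₗ[F] C} (h : ∀ a, π a = 0 → φ a = 0) :
    ∃ g : B →ₗ[F] C, ∀ a, g (π a) = φ a := by
  refine ⟨(LinearMap.ker π).liftQ φ h ∘ₗ (π.quotKerEquivOfSurjective hπ).symm, fun a => ?_⟩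
  have : (π.quotKerEquivOfSurjective hπ).symm (π a) = (LinearMap.ker π).mkQ a := by
    rw [LinearEquiv.symm_apply_eq]; rfl
  rw [LinearMap.comp_apply, LinearEquiv.coe_coe, this]
  rfl

/-- A map out of a cyclic module is determined by the image of the generator, which may be any
vector killed by `f`. -/
theorem IsCyclicVector.finrank_XHom {s : S} {f : k[X]} (h : IsCyclicVector s f) :
    Module.finrank k (XHom k S V) = Module.finrank k (LinearMap.ker (rhoEnd V f)) := by
  let ev : XHom k S V →ₗ[k] LinearMap.ker (rhoEnd V f) :=
    { toFun g := ⟨(g : S →ₗ[k] V) s, by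
        rw [LinearMap.mem_ker, rhoEnd_apply, ← XHom.map_rho_smul, (h.2 f).2 dvd_rfl, map_zero]⟩
      map_add' g g' := rfl
      map_smul' a g := rfl }
  refine (LinearEquiv.ofBijective ev ⟨?_, ?_⟩).finrank_eq
  · intro g g' hg
    refine Subtype.ext (LinearMap.ext fun t => ?_)
    obtain ⟨p, rfl⟩ := h.1 t
    rw [XHom.map_rho_smul, XHom.map_rho_smul, show (g : S →ₗ[k] V) s = (g' : S →ₗ[k] V) s from
      congrArg Subtype.val hg]
  · rintro ⟨v, hv⟩
    obtain ⟨g, hg⟩ := exists_linearMap_comp_eq (π := cyc k s) (φ := cyc k v) h.1 fun p hp => by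
      obtain ⟨p, rfl⟩ := (h.2 p).1 hp
      rw [cyc_apply, mul_comm, map_mul, mul_smul, show rho k f • v = 0 from hv, smul_zero]
    refine ⟨⟨g, fun t => ?_⟩, Subtype.ext ?_⟩
    · obtain ⟨p, rfl⟩ := h.1 t
      have h1 := hg (X * p)
      rw [cyc_apply, map_mul, mul_smul] at h1
      have h2 := hg p
      rw [cyc_apply] at h2
      rw [h1, h2, cyc_apply, cyc_apply, map_mul, mul_smul]
    · change g s = v
      have := hg 1
      simpa using this

/-- If the endomorphisms commute, a semisimple module over `k[X ^ r]` is cyclic. -/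
theorem exists_cyclic_of_commute [Finite S] [Finite k] (hss : (rhoEnd S (X : k[X])).IsSemisimple)
    (hcomm : ∀ f g : XHom k S S, ∀ s, (f : S →ₗ[k] S) ((g : S →ₗ[k] S) s) =
      (g : S →ₗ[k] S) ((f : S →ₗ[k] S) s)) :
    ∃ s : S, ∀ t, ∃ g, rho k g • s = t := by
  -- Take `s` generating a cyclic submodule of largest dimension; a nonzero vector in an invariant
  -- complement will enlarge it.
  obtain ⟨s, hs⟩ := Finite.exists_max fun s : S =>
    Module.finrank k (LinearMap.range (cyc k s))
  have hinv : ∀ s : S, ∃ q : Submodule k S, (∀ w ∈ q, rho k X • w ∈ q) ∧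
      IsCompl (LinearMap.range (cyc k s)) q := by
    intro s
    obtain ⟨q, hq, hc⟩ := Module.End.isSemisimple_iff.1 hss (LinearMap.range (cyc k s))
      (fun t ht => rho_smul_mem_range_cyc s X ht)
    exact ⟨q, fun w hw => hq hw, hc⟩
  -- An endomorphism commutes with the projection onto a cyclic submodule along an invariant
  -- complement, so it preserves that submodule.
  have hstable : ∀ s t : S, ∀ c : XHom k S S, t ∈ LinearMap.range (cyc k s) →
      (c : S →ₗ[k] S) t ∈ LinearMap.range (cyc k s) := by
    intro s t c ht
    obtain ⟨q, hq, hc⟩ := hinv s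
    have h1 := hcomm c
      ⟨_, projection_mem_XHom hc (fun u hu => rho_smul_mem_range_cyc s X hu) hq⟩ t
    simp only at h1
    rw [Submodule.projection_apply_of_mem_left hc ht] at h1
    rw [h1]
    exact Submodule.projection_apply_mem hc _
  refine ⟨s, fun t => ?_⟩
  obtain ⟨q, hq, hc⟩ := hinv s
  by_cases hbot : q = ⊥
  · rw [hbot] at hc
    have : t ∈ LinearMap.range (cyc k s) := by rw [eq_top_of_isCompl_bot hc]; trivial
    exact this
  exfalso
  obtain ⟨u, hu, hu0⟩ := Submodule.exists_mem_ne_zero_of_ne_bot hbot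
  -- The submodule generated by `s + u` is stable under the projection that sends `s + u` to `s`; it
  -- contains `s`, hence also `u`.
  have h1 : s ∈ LinearMap.range (cyc k (s + u)) := by
    have := hstable (s + u) (s + u)
      ⟨_, projection_mem_XHom hc (fun u hu => rho_smul_mem_range_cyc s X hu) hq⟩
      (self_mem_range_cyc _)
    simp only at this
    rwa [map_add, Submodule.projection_apply_of_mem_left hc (self_mem_range_cyc s),
      (Submodule.projection_apply_eq_zero_iff hc).2 hu, add_zero] at this
  have h2 : u ∈ LinearMap.range (cyc k (s + u)) := by
    have := Submodule.sub_mem _ (self_mem_range_cyc (k := k) (s + u)) h1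
    rwa [add_sub_cancel_left] at this
  have h3 : LinearMap.range (cyc k s) < LinearMap.range (cyc k (s + u)) := by
    refine lt_of_le_not_ge ?_ fun hle => ?_
    · rintro _ ⟨f, rfl⟩
      exact rho_smul_mem_range_cyc _ f h1
    · exact hu0 (Submodule.disjoint_def.1 hc.disjoint u (hle h2) hu)
  exact absurd (hs (s + u)) (not_le.2 (Submodule.finrank_lt_finrank_of_lt h3))

end Cyclic

/-! ## Simple modules -/

section Simple

variable {k : Type*} [Field k] [MulSemiringAction (Multiplicative ℕ) k]

variable {S : Type*} [AddCommGroup S] [Module (SkewPolynomial k) S] [Module k S]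
  [IsScalarTower k (SkewPolynomial k) S] [Finite S]

/-- A polynomial equal to its conjugate has coefficients in the fixed field. -/
theorem exists_map_eq_of_map_sigma_eq {g : k[X]} (hg : g.Monic) (h : g.map (sigma k) = g) :
    ∃ G : (fixedField k)[X], G.map (fixedField k).subtype = g ∧ G.Monic := by
  obtain ⟨G, h1, -, h2⟩ := lifts_and_natDegree_eq_and_monic (f := (fixedField k).subtype) (p := g)
    ((lifts_iff_coeff_lifts _).2 fun n => ⟨⟨g.coeff n, by
      rw [mem_fixedField, ← coeff_map, h]⟩, rfl⟩) hg
  exact ⟨G, h1, h2⟩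

/-- A module which is cyclic over `k[X ^ r]` is cyclic with an annihilator generated by a
polynomial over the fixed field. -/
theorem exists_isCyclicVector_map (hS : XInjective k S) {s : S} (h : ∀ t, ∃ g, rho k g • s = t) :
    ∃ G : (fixedField k)[X], G.Monic ∧ IsCyclicVector s (G.map (fixedField k).subtype) := by
  have hzero : ∀ g : k[X], rho k g • s = 0 ↔ minpoly k (rhoEnd S (X : k[X])) ∣ g := by
    intro g
    rw [minpoly.dvd_iff, aeval_rhoEnd_X]
    refine ⟨fun hg => LinearMap.ext fun t => ?_, fun hg => LinearMap.congr_fun hg s⟩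
    obtain ⟨p, rfl⟩ := h t
    rw [rhoEnd_apply, smul_smul, ← map_mul, mul_comm, map_mul, mul_smul, hg, smul_zero]; rfl
  have hint : IsIntegral k (rhoEnd S (X : k[X])) := Algebra.IsIntegral.isIntegral _
  -- Moving `X` across the minimal polynomial conjugates its coefficients, so the conjugate kills `X
  -- • S = S`. It has the same degree and is monic, hence equals the minimal polynomial.
  obtain ⟨G, h1, h2⟩ := exists_map_eq_of_map_sigma_eq (minpoly.monic hint) (by
    refine eq_of_monic_of_dvd_of_natDegree_le (minpoly.monic hint) ((minpoly.monic hint).map _)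
      ?_ (natDegree_map _).le
    rw [← hzero]
    obtain ⟨s, rfl⟩ := hS.bijective.2 s
    change _ • SkewPolynomial.X • s = 0
    obtain ⟨p, hp⟩ := h s
    rw [smul_smul, ← X_mul_rho, mul_smul, ← rhoEnd_apply (D := S), ← aeval_rhoEnd_X, minpoly.aeval,
      LinearMap.zero_apply, smul_zero])
  exact ⟨G, h2, h, by rwa [h1]⟩

variable [Finite k]

/-- By Schur and Wedderburn the skew-linear endomorphisms form a finite field. They are the fixed
vectors of conjugation, so they span `XHom k S S` over `k`, and commutation extends bilinearly. -/
theorem commute_of_isSimpleModule [IsSimpleModule (SkewPolynomial k) S] (hS : XInjective k S)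
    (f g : XHom k S S) (s : S) :
    (f : S →ₗ[k] S) ((g : S →ₗ[k] S) s) = (g : S →ₗ[k] S) ((f : S →ₗ[k] S) s) := by
  classical
  have hfin : Finite (Module.End (SkewPolynomial k) S) :=
    Finite.of_injective (fun f => (f : S → S)) DFunLike.coe_injective
  have hfield : IsField (Module.End (SkewPolynomial k) S) := Finite.isDomain_to_isField _
  have hspan : ∀ f : XHom k S S, f ∈ Submodule.span k
      (fixedVectors (conjX (V := S) hS) : Set (XHom k S S)) := fun f => by
    rw [span_fixedVectors (conjX_iterate_sigmaOrder hS)]; trivial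
  induction hspan f using Submodule.span_induction generalizing s with
  | mem f hf =>
    induction hspan g using Submodule.span_induction generalizing s with
    | mem g hg =>
      exact congrArg (fun h : Module.End (SkewPolynomial k) S => h s)
        (hfield.mul_comm (fixedConjXEquiv hS ⟨f, hf⟩) (fixedConjXEquiv hS ⟨g, hg⟩))
    | zero => simp
    | add a b _ _ ha hb => simp [ha, hb]
    | smul c a _ ha => simp [ha]
  | zero => simp
  | add a b _ _ ha hb => simp [ha, hb]
  | smul c a _ ha => simp [ha]

theorem separable_map_of_irreducible {N : (fixedField k)[X]} (hN : Irreducible N) :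
    (N.map (fixedField k).subtype).Separable :=
  (PerfectField.separable_of_irreducible hN).map

/-- `N` is separable, so it stays squarefree over `k` and `X ^ r` acts semisimply; commuting
endomorphisms then make `S` cyclic. The annihilator descends to a divisor of `N`, which is not a
unit since `S ≠ 0`. -/
theorem exists_isCyclicVector_of_isSimpleModule [IsSimpleModule (SkewPolynomial k) S]
    (hS : XInjective k S) {N : (fixedField k)[X]} (hmonic : N.Monic) (hN : Irreducible N)
    (h : ∀ s : S, zeta k N • s = 0) :
    ∃ s : S, IsCyclicVector s (N.map (fixedField k).subtype) := by
  have hss : (rhoEnd S (X : k[X])).IsSemisimple := by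
    refine Module.End.isSemisimple_of_squarefree_aeval_eq_zero
      (separable_map_of_irreducible hN).squarefree ?_
    rw [aeval_rhoEnd_X]
    exact LinearMap.ext h
  obtain ⟨s, hs⟩ := exists_cyclic_of_commute hss (commute_of_isSimpleModule hS)
  obtain ⟨G, hG, hc⟩ := exists_isCyclicVector_map hS hs
  have hdvd : G ∣ N := by
    rw [← map_dvd_map' (fixedField k).subtype, ← hc.2]
    exact h s
  refine ⟨s, ?_⟩
  rcases hN.dvd_iff.1 hdvd with hu | ha
  · exfalso
    have : Nontrivial S := IsSimpleModule.nontrivial (SkewPolynomial k) S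
    obtain ⟨t, ht⟩ := exists_ne (0 : S)
    obtain ⟨p, rfl⟩ := hs t
    exact ht ((hc.2 p).2 ((hu.map (mapRingHom (fixedField k).subtype)).dvd))
  · rwa [eq_of_monic_of_associated hmonic hG ha]

variable {V : Type*} [AddCommGroup V] [Module (SkewPolynomial k) V] [Module k V]
  [IsScalarTower k (SkewPolynomial k) V] [Finite V]

theorem finrank_of_isSimpleModule [IsSimpleModule (SkewPolynomial k) S]
    (hS : XInjective k S) {N : (fixedField k)[X]} (hmonic : N.Monic) (hN : Irreducible N)
    (h : ∀ s : S, zeta k N • s = 0) : Module.finrank k S = N.natDegree := by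
  obtain ⟨s, hs⟩ := exists_isCyclicVector_of_isSimpleModule hS hmonic hN h
  rw [hs.finrank_eq, natDegree_map]

theorem natCard_linearMap_of_isSimpleModule [IsSimpleModule (SkewPolynomial k) S]
    (hS : XInjective k S) {N : (fixedField k)[X]} (hmonic : N.Monic) (hN : Irreducible N)
    (h : ∀ s : S, zeta k N • s = 0) (hV : ∀ v : V, zeta k N • v = 0) :
    Nat.card (S →ₗ[SkewPolynomial k] V) = Nat.card (fixedField k) ^ Module.finrank k V := by
  obtain ⟨s, hs⟩ := exists_isCyclicVector_of_isSimpleModule hS hmonic hN h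
  rw [natCard_linearMap hS, hs.finrank_XHom]
  have : LinearMap.ker (rhoEnd V (N.map (fixedField k).subtype)) = ⊤ := by
    rw [LinearMap.ker_eq_top]; exact LinearMap.ext hV
  rw [this, finrank_top]

end Simple

/-! ## Counting simple submodules -/

/-- Nonzero maps from a simple module to `U`, sorted by their range. -/
def fiberRangeEquiv {R D : Type*} [Ring R] [AddCommGroup D] [Module R D] {S : Type*}
    [AddCommGroup S] [Module R S] [IsSimpleModule R S] (U W : Submodule R D)
    [IsSimpleModule R W] (hW : W ≤ U) :
    {f : S →ₗ[R] U // f ≠ 0 ∧ LinearMap.range (U.subtype ∘ₗ f) = W} ≃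
      {g : S →ₗ[R] W // g ≠ 0} where
  toFun f := ⟨(U.subtype ∘ₗ f.1).codRestrict W fun s => by
      exact f.2.2.le ⟨s, rfl⟩, fun h0 => f.2.1 (LinearMap.ext fun s => Subtype.ext
        (congrArg (fun x : W => (x : D)) (LinearMap.congr_fun h0 s)))⟩
  invFun g := ⟨Submodule.inclusion hW ∘ₗ g.1, fun h0 => g.2 (LinearMap.ext fun s => Subtype.ext
        (congrArg (fun x : U => (x : D)) (LinearMap.congr_fun h0 s))), by
      have hs := LinearMap.surjective_of_ne_zero g.2
      ext d
      constructor
      · rintro ⟨s, rfl⟩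
        exact (g.1 s).2
      · intro hd
        obtain ⟨s, hs⟩ := hs ⟨d, hd⟩
        exact ⟨s, congrArg Subtype.val hs⟩⟩
  left_inv f := rfl
  right_inv g := rfl

theorem natCard_ne_zero_add_one {A : Type*} [Zero A] [Finite A] :
    Nat.card {a : A // a ≠ 0} + 1 = Nat.card A := by
  classical
  have := Fintype.ofFinite A
  rw [Nat.card_eq_fintype_card, Nat.card_eq_fintype_card, Fintype.card_subtype_compl,
    Fintype.card_subtype_eq]
  have : 0 < Fintype.card A := Fintype.card_pos_iff.2 ⟨0⟩
  omega

theorem isSimpleModule_range {R S D : Type*} [Ring R] [AddCommGroup D] [Module R D]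
    [AddCommGroup S] [Module R S] [IsSimpleModule R S] {f : S →ₗ[R] D} (hf : f ≠ 0) :
    IsSimpleModule R (LinearMap.range f) :=
  IsSimpleModule.congr (LinearEquiv.ofInjective f (LinearMap.injective_of_ne_zero hf)).symm

theorem finrank_comap {F A B : Type*} [Field F] [AddCommGroup A] [Module F A]
    [AddCommGroup B] [Module F B] [Module.Finite F A] (f : A →ₗ[F] B) (W : Submodule F B) :
    Module.finrank F (W.comap f) =
      Module.finrank F (LinearMap.ker f) + Module.finrank F (W ⊓ LinearMap.range f : Submodule F B) := by
  rw [← LinearMap.finrank_range_add_finrank_ker (f.domRestrict (W.comap f)), add_comm]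
  congr 1
  · rw [LinearMap.ker_domRestrict]
    refine (Submodule.comapSubtypeEquivOfLe ?_).finrank_eq
    intro a ha
    rw [Submodule.mem_comap, LinearMap.mem_ker.1 ha]
    exact W.zero_mem
  · rw [LinearMap.range_domRestrict, Submodule.map_comap_eq, inf_comm]

section Count

variable {k : Type*} [Field k] [MulSemiringAction (Multiplicative ℕ) k]

variable {D : Type*} [AddCommGroup D] [Module (SkewPolynomial k) D] [Finite D]

variable [Module k D] [IsScalarTower k (SkewPolynomial k) D]

/-! ## Kernels of central elements -/

/-- The part of `N(X ^ r) ^ a D` killed by `N(X ^ r)`. -/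
def layer (D : Type*) [AddCommGroup D] [Module (SkewPolynomial k) D]
    (N : (fixedField k)[X]) (a : ℕ) : Submodule (SkewPolynomial k) D :=
  LinearMap.ker (zetaEnd D N) ⊓ LinearMap.range (zetaEnd D (N ^ a))

/-- Multiplication by `N ^ a` maps the kernel of `N ^ (a + 1)` onto the layer, with kernel that of
`N ^ a`. -/
theorem finrank_layer (N : (fixedField k)[X]) (a : ℕ) :
    Module.finrank k (LinearMap.ker (zetaEnd D (N ^ (a + 1)))) =
      Module.finrank k (LinearMap.ker (zetaEnd D (N ^ a))) + Module.finrank k (layer D N a) := by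
  have h := finrank_comap ((zetaEnd D (N ^ a)).restrictScalars k)
    ((LinearMap.ker (zetaEnd D N)).restrictScalars k)
  have : ((LinearMap.ker (zetaEnd D N)).restrictScalars k).comap
      ((zetaEnd D (N ^ a)).restrictScalars k) =
      (LinearMap.ker (zetaEnd D (N ^ (a + 1)))).restrictScalars k := by
    ext d
    change zeta k N • zeta k (N ^ a) • d = 0 ↔ zeta k (N ^ (a + 1)) • d = 0
    rw [smul_smul, ← map_mul, pow_succ']
  rw [this] at h
  exact h

/-- Both sides compute the dimension of `{d | f d ∈ S}`, seen as a preimage under the quotient map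
and as a preimage under `f`. -/
theorem finrank_ker_quotient (S : Submodule (SkewPolynomial k) D) (f : (fixedField k)[X]) :
    Module.finrank k (LinearMap.ker (zetaEnd (D ⧸ S) f)) + Module.finrank k S =
      Module.finrank k (LinearMap.ker (zetaEnd D f)) +
        Module.finrank k (S ⊓ LinearMap.range (zetaEnd D f) : Submodule (SkewPolynomial k) D) := by
  have h := finrank_comap ((zetaEnd D f).restrictScalars k) (S.restrictScalars k)
  refine Eq.trans ?_ h
  have h2 := finrank_comap (S.mkQ.restrictScalars k)
    ((LinearMap.ker (zetaEnd (D ⧸ S) f)).restrictScalars k)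
  have h3 : ((LinearMap.ker (zetaEnd (D ⧸ S) f)).restrictScalars k).comap (S.mkQ.restrictScalars k)
      = (S.restrictScalars k).comap ((zetaEnd D f).restrictScalars k) := by
    ext d
    change zeta k f • S.mkQ d = 0 ↔ zeta k f • d ∈ S
    rw [← map_smul, Submodule.mkQ_apply, Submodule.Quotient.mk_eq_zero]
  have h4 : LinearMap.range (S.mkQ.restrictScalars k) = ⊤ :=
    LinearMap.range_eq_top.2 S.mkQ_surjective
  have h5 : LinearMap.ker (S.mkQ.restrictScalars k) = S.restrictScalars k := by
    ext d
    change S.mkQ d = 0 ↔ d ∈ S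
    rw [Submodule.mkQ_apply, Submodule.Quotient.mk_eq_zero]
  rw [h3, h4, h5, inf_top_eq] at h2
  rw [h2, add_comm]
  rfl

variable [Finite k]

/-- Fix one simple `S` in `U` and sort the nonzero maps `S → U` by their image. Each simple `W` in
`U` has dimension `deg N`, hence receives the same number of nonzero maps. The division-free form
also covers `U = ⊥`. -/
theorem natCard_simple_mul_add_one (hD : XInjective k D) {N : (fixedField k)[X]}
    (hmonic : N.Monic) (hN : Irreducible N) (U : Submodule (SkewPolynomial k) D)
    (hU : ∀ u ∈ U, zeta k N • u = 0) :
    Nat.card {W : Submodule (SkewPolynomial k) D // IsSimpleModule (SkewPolynomial k) W ∧ W ≤ U} *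
      (Nat.card (fixedField k) ^ N.natDegree - 1) + 1 =
      Nat.card (fixedField k) ^ Module.finrank k U := by
  classical
  have : Finite (Submodule (SkewPolynomial k) D) :=
    Finite.of_injective (fun W => (W : Set D)) SetLike.coe_injective
  by_cases hne : Nonempty {W : Submodule (SkewPolynomial k) D //
    IsSimpleModule (SkewPolynomial k) W ∧ W ≤ U}
  swap
  · have hbot : U = ⊥ := by
      by_contra hbot
      obtain ⟨W, hW, hle⟩ := (IsAtomic.eq_bot_or_exists_atom_le U).resolve_left hbot
      exact hne ⟨W, isSimpleModule_iff_isAtom.2 hW, hle⟩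
    have := not_nonempty_iff.1 hne
    rw [Nat.card_of_isEmpty, hbot, Module.finrank_eq_zero_of_subsingleton]
    simp
  obtain ⟨S, hS, hSU⟩ := hne
  have hUz : ∀ u : U, zeta k N • u = 0 := fun u => Subtype.ext (hU u u.2)
  have hSz : ∀ s : S, zeta k N • s = 0 := fun s => Subtype.ext (hU s (hSU s.2))
  have hfin : ∀ W : Submodule (SkewPolynomial k) D, Finite (S →ₗ[SkewPolynomial k] W) := fun W =>
    Finite.of_injective (fun f => (f : S → W)) DFunLike.coe_injective
  have hcard : ∀ W : Submodule (SkewPolynomial k) D, W ≤ U →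
      Nat.card {f : S →ₗ[SkewPolynomial k] W // f ≠ 0} + 1 =
        Nat.card (fixedField k) ^ Module.finrank k W := fun W hW => by
    have := hfin W
    rw [natCard_ne_zero_add_one, natCard_linearMap_of_isSimpleModule (hD.submodule S) hmonic hN hSz
      fun w => Subtype.ext (hU w (hW w.2))]
  rw [← hcard U le_rfl]
  congr 1
  let F : {f : S →ₗ[SkewPolynomial k] U // f ≠ 0} → {W : Submodule (SkewPolynomial k) D //
      IsSimpleModule (SkewPolynomial k) W ∧ W ≤ U} := fun f =>
    ⟨LinearMap.range (U.subtype ∘ₗ f.1), isSimpleModule_range fun h0 => f.2 (LinearMap.ext fun s =>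
      Subtype.ext (LinearMap.congr_fun h0 s)), by
      rintro _ ⟨s, rfl⟩
      exact (f.1 s).2⟩
  have := hfin U
  rw [← Nat.card_congr (Equiv.sigmaFiberEquiv F)]
  have := Fintype.ofFinite {W : Submodule (SkewPolynomial k) D //
      IsSimpleModule (SkewPolynomial k) W ∧ W ≤ U}
  rw [Nat.card_sigma, Finset.sum_const_nat (m := Nat.card (fixedField k) ^ N.natDegree - 1),
    Finset.card_univ, Nat.card_eq_fintype_card]
  rintro ⟨W, hW, hWU⟩ -
  rw [← finrank_of_isSimpleModule (hD.submodule W) hmonic hN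
    fun w => Subtype.ext (hU w (hWU w.2)), ← hcard W hWU, Nat.add_sub_cancel,
    ← Nat.card_congr (fiberRangeEquiv (S := S) U W hWU)]
  exact Nat.card_congr
    { toFun f := ⟨f.1.1, f.1.2, congrArg Subtype.val f.2⟩
      invFun f := ⟨⟨f.1, f.2.1⟩, Subtype.ext f.2.2⟩
      left_inv f := rfl
      right_inv f := rfl }

end Count

/-! ## Tables and paths -/

section Tables

/-- In a decreasing list the entries `≥ v` form an initial segment. The default `0` beyond the end
never counts, as `v ≥ 1`. -/
theorem le_getD_iff {T : List ℕ} (hT : T.Pairwise (· ≥ ·)) {v : ℕ} (hv : 1 ≤ v) (j : ℕ) :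
    v ≤ T.getD j 0 ↔ j < T.countP (v ≤ ·) := by
  induction T generalizing j with
  | nil => simp; omega
  | cons a T ih =>
    rw [List.pairwise_cons] at hT
    by_cases hva : v ≤ a
    · cases j with
      | zero => simp [hva]
      | succ j => simpa [hva] using ih hT.2 j
    · have h0 : T.countP (v ≤ ·) = 0 := by
        rw [List.countP_eq_zero]
        intro b hb
        have := hT.1 b hb
        simp; omega
      cases j with
      | zero => simp [hva, h0]
      | succ j =>
        have := ih hT.2 j
        rw [h0] at this
        simpa [hva, h0] using this

theorem lt_length_of_getD_pos {T : List ℕ} {j : ℕ} (h : 1 ≤ T.getD j 0) : j < T.length := by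
  by_contra hj
  rw [List.getD_eq_default _ _ (not_lt.1 hj)] at h
  omega

theorem IsTable.getD_pos {T : List ℕ} (hT : IsTable T) {j : ℕ} (hj : j < T.length) :
    1 ≤ T.getD j 0 := by
  rw [List.getD_eq_getElem _ _ hj]
  exact hT.2 _ (List.getElem_mem hj)

/-- Admissible cells are the last ones of their constant runs, so a cell is determined by its entry.
-/
theorem IsTable.mem_admissibleCells {T : List ℕ} (hT : IsTable T) {i : ℕ} :
    i ∈ admissibleCells T ↔ 1 ≤ T.getD i 0 ∧ i + 1 = T.countP (T.getD i 0 ≤ ·) := by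
  rw [admissibleCells, Finset.mem_filter, Finset.mem_range]
  constructor
  · rintro ⟨hi, h⟩
    have hpos := hT.getD_pos hi
    refine ⟨hpos, le_antisymm ((le_getD_iff hT.1 hpos i).1 le_rfl) ?_⟩
    rw [← not_lt, ← le_getD_iff hT.1 hpos]
    rcases h with h | h
    · rw [List.getD_eq_default _ _ h.ge]; omega
    · omega
  · rintro ⟨hpos, h⟩
    refine ⟨lt_length_of_getD_pos hpos, Or.inr (not_le.1 ?_)⟩
    rw [le_getD_iff hT.1 hpos]
    omega

/-- The cells with a given entry form an interval, so the weight is a geometric sum. The shape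
matches the difference of two counts of simple submodules. -/
theorem IsTable.pathWeight_mul_add {T : List ℕ} (hT : IsTable T) {i : ℕ}
    (hi : i ∈ admissibleCells T) {Q : ℕ} (hQ : 1 ≤ Q) :
    pathWeight Q T i * (Q - 1) + Q ^ T.countP (T.getD i 0 + 1 ≤ ·) =
      Q ^ T.countP (T.getD i 0 ≤ ·) := by
  obtain ⟨hpos, -⟩ := hT.mem_admissibleCells.1 hi
  have h : (Finset.range T.length).filter (fun j => T.getD j 0 = T.getD i 0) =
      Finset.Ico (T.countP (T.getD i 0 + 1 ≤ ·)) (T.countP (T.getD i 0 ≤ ·)) := by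
    ext j
    rw [Finset.mem_filter, Finset.mem_range, Finset.mem_Ico, ← not_lt,
      ← le_getD_iff hT.1 (by omega), ← le_getD_iff hT.1 hpos]
    constructor
    · rintro ⟨-, h⟩; omega
    · rintro ⟨h1, h2⟩; exact ⟨lt_length_of_getD_pos (hpos.trans h2), by omega⟩
  have hle : T.countP (T.getD i 0 + 1 ≤ ·) ≤ T.countP (T.getD i 0 ≤ ·) :=
    List.countP_mono_left fun x _ => by simp; omega
  rw [pathWeight, h]
  obtain ⟨q, rfl⟩ := Nat.exists_eq_add_of_le hQ
  rw [Nat.add_sub_cancel_left]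
  clear h
  generalize T.countP (T.getD i 0 + 1 ≤ ·) = m at *
  generalize T.countP (T.getD i 0 ≤ ·) = n at *
  induction n, hle using Nat.le_induction with
  | base => simp
  | succ n hn ih =>
    rw [Finset.sum_Ico_succ_top hn]
    have ih' : (∑ j ∈ Finset.Ico m n, (1 + q) ^ j) * q + (1 + q) ^ m = (1 + q) ^ n := ih
    rw [add_mul, add_right_comm, ih', pow_succ]
    ring

/-- Since `f 0 = 0`, deleting a cell contributes as if its entry had become `0`. -/
theorem sum_map_lower_add {T : List ℕ} {i : ℕ} (hi : i < T.length)
    {f : ℕ → ℕ} (hf : f 0 = 0) :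
    ((lower T i).map f).sum + f (T.getD i 0) = (T.map f).sum + f (T.getD i 0 - 1) := by
  have hT : T = T.take i ++ T.getD i 0 :: T.drop (i + 1) := by
    rw [List.getD_eq_getElem _ _ hi, List.cons_getElem_drop_succ, List.take_append_drop]
  rw [lower]
  split_ifs with h
  · obtain ⟨h1, h2⟩ := h
    rw [h2, show (1 : ℕ) - 1 = 0 from rfl, hf]
    conv_rhs => rw [hT]
    rw [List.dropLast_eq_take, ← h1, List.drop_eq_nil_of_le h1.ge, h2]
    simp
  · rw [List.map_set, List.sum_set, if_pos (by simpa using hi)]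
    have h2 := congrArg (fun L => (L.map f).sum) hT
    simp only [List.map_append, List.sum_append, List.map_cons, List.sum_cons, List.map_take,
      List.map_drop] at h2
    omega

theorem getD_lower {T : List ℕ} {i : ℕ} (hi : i ∈ admissibleCells T) (j : ℕ) :
    (lower T i).getD j 0 = if j = i then T.getD i 0 - 1 else T.getD j 0 := by
  have hi' : i < T.length := (Finset.mem_range.1 (Finset.mem_filter.1 hi).1)
  rw [SkewFactor.lower]
  split_ifs with h hj hj
  · subst hj
    rw [List.getD_eq_default _ _ (by rw [List.length_dropLast]; omega), h.2]
  · rw [List.getD_eq_getElem?_getD, List.getElem?_dropLast, List.getD_eq_getElem?_getD]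
    split_ifs with hlt
    · rfl
    · rw [List.getElem?_eq_none (by omega)]
  · subst hj
    rw [List.getD_eq_getElem?_getD, List.getElem?_set_self hi']
    rfl
  · rw [List.getD_eq_getElem?_getD, List.getElem?_set_ne (Ne.symm hj),
      List.getD_eq_getElem?_getD]

theorem pairwise_ge_iff_getD {T : List ℕ} :
    T.Pairwise (· ≥ ·) ↔ ∀ i j, i ≤ j → T.getD j 0 ≤ T.getD i 0 := by
  rw [List.pairwise_iff_getElem]
  constructor
  · intro h i j hij
    by_cases hj : j < T.length
    · rw [List.getD_eq_getElem _ _ hj, List.getD_eq_getElem _ _ (hij.trans_lt hj)]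
      rcases hij.eq_or_lt with rfl | hlt
      · exact le_rfl
      · exact h i j _ hj hlt
    · rw [List.getD_eq_default _ _ (not_lt.1 hj)]
      exact Nat.zero_le _
  · intro h i j hi hj hij
    have := h i j hij.le
    rwa [List.getD_eq_getElem _ _ hj, List.getD_eq_getElem _ _ hi] at this

theorem IsTable.lower {T : List ℕ} (hT : IsTable T) {i : ℕ} (hi : i ∈ admissibleCells T) :
    IsTable (lower T i) := by
  obtain ⟨hpos, hcount⟩ := hT.mem_admissibleCells.1 hi
  constructor
  · rw [pairwise_ge_iff_getD]
    intro a b hab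
    rw [getD_lower hi, getD_lower hi]
    have h1 := pairwise_ge_iff_getD.1 hT.1 a b hab
    have h2 := le_getD_iff hT.1 hpos b
    split_ifs with hb ha ha
    · exact le_rfl
    · subst hb; omega
    · subst ha
      have : ¬ b < List.countP (T.getD a 0 ≤ ·) T := by omega
      have := h2.not.2 this
      omega
    · exact h1
  · intro a ha
    rw [SkewFactor.lower] at ha
    split_ifs at ha with h
    · exact hT.2 a (List.mem_of_mem_dropLast ha)
    · rcases List.mem_or_eq_of_mem_set ha with h1 | rfl
      · exact hT.2 a h1
      · have hi' := Finset.mem_filter.1 hi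
        rw [Finset.mem_range] at hi'
        rcases hi'.2 with h1 | h1
        · have : T.getD i 0 ≠ 1 := fun h2 => h ⟨h1, h2⟩
          omega
        · by_cases h3 : i + 1 < T.length
          · have := hT.getD_pos h3
            omega
          · have : T.getD i 0 ≠ 1 := fun h2 => h ⟨by omega, h2⟩
            omega

theorem sum_map_min_succ (T : List ℕ) (a : ℕ) :
    (T.map (min · (a + 1))).sum = (T.map (min · a)).sum + T.countP (a + 1 ≤ ·) := by
  induction T with
  | nil => rfl
  | cons b T ih =>
    rw [List.map_cons, List.sum_cons, ih, List.map_cons, List.sum_cons, List.countP_cons]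
    by_cases h : a + 1 ≤ b
    · simp [h]; omega
    · simp [h]; omega

theorem sum_lower {T : List ℕ} (hT : IsTable T) {i : ℕ} (hi : i ∈ admissibleCells T) :
    (lower T i).sum + 1 = T.sum := by
  have hpos := (hT.mem_admissibleCells.1 hi).1
  have h := sum_map_lower_add (lt_length_of_getD_pos hpos) (f := id) rfl
  simp only [List.map_id, id] at h
  omega

/-- The truncated sums are, up to the factor `δ`, the kernel dimensions; this is the drop to be
compared with that of a quotient by a simple submodule. -/
theorem sum_map_min_lower {T : List ℕ} (hT : IsTable T) {i : ℕ} (hi : i ∈ admissibleCells T)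
    (j : ℕ) : ((lower T i).map (min · j)).sum + (if T.getD i 0 ≤ j then 1 else 0) =
      (T.map (min · j)).sum := by
  have hpos := (hT.mem_admissibleCells.1 hi).1
  have h := sum_map_lower_add (lt_length_of_getD_pos hpos) (f := (min · j)) (by simp)
  split_ifs with h1 <;> omega

theorem IsTable.exists_mem_admissibleCells {T : List ℕ} (hT : IsTable T) {a : ℕ}
    (h : T.countP (a + 2 ≤ ·) < T.countP (a + 1 ≤ ·)) :
    ∃ i ∈ admissibleCells T, T.getD i 0 = a + 1 := by
  have h1 := (le_getD_iff hT.1 (v := a + 1) (by omega) (T.countP (a + 1 ≤ ·) - 1)).2 (by omega)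
  have h2 := (le_getD_iff hT.1 (v := a + 2) (by omega) (T.countP (a + 1 ≤ ·) - 1)).not.2 (by omega)
  have h3 : T.getD (T.countP (a + 1 ≤ ·) - 1) 0 = a + 1 := by omega
  refine ⟨_, hT.mem_admissibleCells.2 ⟨by omega, ?_⟩, h3⟩
  rw [h3]
  omega

/-! ## Sums of weights -/

/-- The sum of the weights of all the sequences of paths from `T` to the empty table. -/
def weightSum (Q : ℕ) (T : List ℕ) : ℕ := ∑ Γ ∈ pathSeqs T, seqWeight Q T Γ

theorem weightSum_nil (Q : ℕ) : weightSum Q [] = 1 := by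
  simp [weightSum, pathSeqs, pathSeqsOfLength, seqWeight]

theorem weightSum_eq (Q : ℕ) {T : List ℕ} (hT : IsTable T) (h : T.sum ≠ 0) :
    weightSum Q T = ∑ i ∈ admissibleCells T, pathWeight Q T i * weightSum Q (lower T i) := by
  obtain ⟨n, hn⟩ := Nat.exists_eq_succ_of_ne_zero h
  rw [weightSum, pathSeqs, hn, pathSeqsOfLength, Finset.sum_biUnion]
  · refine Finset.sum_congr rfl fun i hi => ?_
    rw [Finset.sum_image (by simp), weightSum, pathSeqs, Finset.mul_sum,
      show (lower T i).sum = n by have := sum_lower hT hi; omega]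
    exact Finset.sum_congr rfl fun Γ _ => by rw [seqWeight]
  · intro i _ j _ hij
    rw [Function.onFun, Finset.disjoint_left]
    rintro Γ h1 h2
    obtain ⟨_, _, rfl⟩ := Finset.mem_image.1 h1
    obtain ⟨_, _, h3⟩ := Finset.mem_image.1 h2
    exact hij (List.cons.inj h3).1.symm

/-- Classify words by their first letter. After multiplication by `∏ τ l !` this is `(∑ τ l) · n! =
∑ (τ l · n!)`, where `n + 1 = ∑ τ l`. The `if` discards the truncated `0 - 1`. -/
theorem multinomial_recursion {ι : Type*} [Fintype ι] [DecidableEq ι] {τ : ι → ℕ}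
    (h : ∑ l, τ l ≠ 0) : Nat.multinomial Finset.univ τ =
      ∑ l, if τ l = 0 then 0 else Nat.multinomial Finset.univ (Function.update τ l (τ l - 1)) := by
  obtain ⟨n, hn⟩ := Nat.exists_eq_succ_of_ne_zero h
  have hpos : 0 < ∏ l, (τ l).factorial := Finset.prod_pos fun l _ => Nat.factorial_pos _
  refine Nat.eq_of_mul_eq_mul_left hpos ?_
  rw [Nat.multinomial_spec, hn, Nat.factorial_succ, ← Nat.succ_eq_add_one, ← hn, Finset.sum_mul,
    Finset.mul_sum]
  refine Finset.sum_congr rfl fun l _ => ?_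
  split_ifs with h0
  · simp [h0]
  have h1 := Nat.multinomial_spec Finset.univ (Function.update τ l (τ l - 1))
  have h2 : ∑ i, Function.update τ l (τ l - 1) i = n := by
    have h3 := Finset.sum_update_of_mem (Finset.mem_univ l) τ (τ l - 1)
    have h4 := Finset.add_sum_erase Finset.univ τ (Finset.mem_univ l)
    rw [Finset.sdiff_singleton_eq_erase] at h3
    omega
  have h5 : ∏ i, (τ i).factorial = τ l * ∏ i, (Function.update τ l (τ l - 1) i).factorial := by
    rw [← Finset.mul_prod_erase _ _ (Finset.mem_univ l),
      ← Finset.mul_prod_erase Finset.univ (fun i => (Function.update τ l (τ l - 1) i).factorial)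
        (Finset.mem_univ l), Function.update_self, ← mul_assoc, Nat.mul_factorial_pred h0]
    congr 1
    refine Finset.prod_congr rfl fun i hi => ?_
    rw [Function.update_of_ne (Finset.ne_of_mem_erase hi)]
  rw [h5, mul_assoc, h1, h2]

/-- The number of factorizations predicted by the tables `T`. -/
def predicted {ι : Type*} [Fintype ι] [DecidableEq ι] (Q : ι → ℕ) (T : ι → List ℕ) : ℕ :=
  Nat.multinomial Finset.univ (fun l => (T l).sum) * ∏ l, weightSum (Q l) (T l)

/-- The multinomial counts interleavings of the path sequences: choose the class that moves first,
then the first path of its sequence. -/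
theorem predicted_eq {ι : Type*} [Fintype ι] [DecidableEq ι] (Q : ι → ℕ) {T : ι → List ℕ}
    (hT : ∀ l, IsTable (T l)) (h : ∑ l, (T l).sum ≠ 0) :
    predicted Q T = ∑ l, ∑ i ∈ admissibleCells (T l), pathWeight (Q l) (T l) i *
      predicted Q (Function.update T l (lower (T l) i)) := by
  rw [predicted, multinomial_recursion h, Finset.sum_mul]
  refine Finset.sum_congr rfl fun l _ => ?_
  split_ifs with h0
  · have : T l = [] := by
      by_contra hne
      obtain ⟨a, ha⟩ := List.exists_mem_of_ne_nil _ hne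
      have := (hT l).2 a ha
      have := List.le_sum_of_mem ha
      omega
    simp [this, admissibleCells]
  rw [← Finset.mul_prod_erase _ _ (Finset.mem_univ l), weightSum_eq _ (hT l) h0, Finset.sum_mul,
    Finset.mul_sum]
  refine Finset.sum_congr rfl fun i hi => ?_
  rw [predicted, ← Finset.mul_prod_erase Finset.univ (fun l' => weightSum (Q l') _)
    (Finset.mem_univ l), Function.update_self]
  have h1 : (fun l' => (Function.update T l (lower (T l) i) l').sum) =
      Function.update (fun l => (T l).sum) l ((T l).sum - 1) := by
    have := sum_lower (hT l) hi
    ext l'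
    by_cases hl : l' = l
    · subst hl; simp; omega
    · simp [hl]
  have h2 : ∏ l' ∈ Finset.univ.erase l, weightSum (Q l')
      (Function.update T l (lower (T l) i) l') = ∏ l' ∈ Finset.univ.erase l,
        weightSum (Q l') (T l') :=
    Finset.prod_congr rfl fun l' hl' => by rw [Function.update_of_ne (Finset.ne_of_mem_erase hl')]
  rw [h1, h2]
  ring

end Tables

/-! ## Arithmetic of skew polynomials -/

section Coefficients

variable {k : Type*} [Field k]

theorem coeff_smul (a : k) (Q : SkewPolynomial k) (n : ℕ) : (a • Q).coeff n = a * Q.coeff n := rfl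

theorem coeff_sum {ι : Type*} (s : Finset ι) (f : ι → SkewPolynomial k) (n : ℕ) :
    (∑ i ∈ s, f i).coeff n = ∑ i ∈ s, (f i).coeff n :=
  map_sum (AddMonoidHom.mk' (fun Q : SkewPolynomial k => Q.coeff n) fun p q =>
    SkewPolynomial.coeff_add p q n) f s

/-- `P` is monic of degree `d`. -/
def IsMonicOfDegree (P : SkewPolynomial k) (d : ℕ) : Prop :=
  P.coeff d = 1 ∧ ∀ n, d < n → P.coeff n = 0

theorem exists_leading {P : SkewPolynomial k} (h : P ≠ 0) :
    ∃ d, P.coeff d ≠ 0 ∧ ∀ n, d < n → P.coeff n = 0 := by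
  have hne : P.support.Nonempty := Finset.nonempty_iff_ne_empty.2 (by simpa using h)
  refine ⟨P.support.max' hne, SkewPolynomial.mem_support_iff.1 (Finset.max'_mem _ _), ?_⟩
  intro n hn
  by_contra h0
  exact absurd (Finset.le_max' _ n (SkewPolynomial.mem_support_iff.2 h0)) (not_le.2 hn)

theorem IsMonicOfDegree.ne_zero {P : SkewPolynomial k} {d : ℕ} (h : IsMonicOfDegree P d) :
    P ≠ 0 := by
  rintro rfl
  simpa using h.1

theorem IsMonic.ne_zero {P : SkewPolynomial k} (h : IsMonic P) : P ≠ 0 :=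
  h.elim fun _ hd => IsMonicOfDegree.ne_zero hd

end Coefficients

section Arithmetic

variable {k : Type*} [Field k] [MulSemiringAction (Multiplicative ℕ) k]

theorem coeff_monomial_mul (i : ℕ) (a : k) (Q : SkewPolynomial k) (n : ℕ) :
    (SkewPolynomial.monomial i a * Q).coeff n =
      if i ≤ n then a * (sigma k ^ i) (Q.coeff (n - i)) else 0 := by
  induction Q using SkewPolynomial.induction with
  | h0 => simp
  | ha m b Q hm hb hQ =>
    clear hm hb
    rw [mul_add, SkewPolynomial.coeff_add, hQ, SkewPolynomial.monomial_mul_monomial,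
      SkewPolynomial.coeff_monomial, SkewPolynomial.coeff_add, SkewPolynomial.coeff_monomial,
      RingHom.coe_pow]
    by_cases h : i ≤ n
    · rw [if_pos h, if_pos h, iterate_map_add, mul_add]
      congr 1
      by_cases h2 : i + m = n
      · rw [if_pos h2, if_pos (by omega)]; rfl
      · rw [if_neg h2, if_neg (by omega), iterate_map_zero, mul_zero]
    · rw [if_neg h, if_neg h, if_neg (by omega), add_zero]

theorem coeff_mul (P Q : SkewPolynomial k) (n : ℕ) :
    (P * Q).coeff n = ∑ i ∈ P.support,
      if i ≤ n then P.coeff i * (sigma k ^ i) (Q.coeff (n - i)) else 0 := by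
  conv_lhs => rw [← SkewPolynomial.sum_monomial P, SkewPolynomial.sum_def, Finset.sum_mul]
  rw [coeff_sum]
  exact Finset.sum_congr rfl fun i _ => coeff_monomial_mul _ _ _ _

theorem coeff_mul_eq_zero {P Q : SkewPolynomial k} {d e : ℕ} (hP : ∀ n, d < n → P.coeff n = 0)
    (hQ : ∀ n, e < n → Q.coeff n = 0) {n : ℕ} (hn : d + e < n) : (P * Q).coeff n = 0 := by
  rw [coeff_mul]
  refine Finset.sum_eq_zero fun i hi => ?_
  have : i ≤ d := by
    by_contra h
    exact SkewPolynomial.mem_support_iff.1 hi (hP i (by omega))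
  rw [hQ (n - i) (by omega), map_zero, mul_zero, ite_self]

theorem coeff_mul_add {P Q : SkewPolynomial k} {d e : ℕ} (hP : ∀ n, d < n → P.coeff n = 0)
    (hQ : ∀ n, e < n → Q.coeff n = 0) :
    (P * Q).coeff (d + e) = P.coeff d * (sigma k ^ d) (Q.coeff e) := by
  rw [coeff_mul, Finset.sum_eq_single d]
  · rw [if_pos (by omega), Nat.add_sub_cancel_left]
  · intro i hi hid
    have : i < d := by
      by_contra h
      exact SkewPolynomial.mem_support_iff.1 hi (hP i (by omega))
    rw [hQ _ (by omega), map_zero, mul_zero, ite_self]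
  · intro hd
    rw [SkewPolynomial.notMem_support_iff.1 hd]
    simp

/-- Leading coefficients multiply to `a · σ ^ d (b)`, which is nonzero because `σ` is injective. -/
instance : IsDomain (SkewPolynomial k) := by
  have : NoZeroDivisors (SkewPolynomial k) := ⟨by
    intro P Q h
    by_contra! hne
    obtain ⟨d, hd, hd'⟩ := exists_leading hne.1
    obtain ⟨e, he, he'⟩ := exists_leading hne.2
    have := coeff_mul_add hd' he'
    rw [h, SkewPolynomial.coeff_zero, eq_comm, mul_eq_zero, map_eq_zero] at this
    tauto⟩
  exact NoZeroDivisors.to_isDomain _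

theorem isMonicOfDegree_one : IsMonicOfDegree (1 : SkewPolynomial k) 0 :=
  ⟨by simp, fun n hn => by rw [SkewPolynomial.coeff_one, if_neg hn.ne]⟩

theorem IsMonicOfDegree.mul {P Q : SkewPolynomial k} {d e : ℕ} (hP : IsMonicOfDegree P d)
    (hQ : IsMonicOfDegree Q e) : IsMonicOfDegree (P * Q) (d + e) :=
  ⟨by rw [coeff_mul_add hP.2 hQ.2, hP.1, hQ.1]; simp, fun _ hn => coeff_mul_eq_zero hP.2 hQ.2 hn⟩

/-- The left factor of a monic skew polynomial is monic if the right one is. -/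
theorem IsMonicOfDegree.of_mul {P Q : SkewPolynomial k} {n e : ℕ}
    (h : IsMonicOfDegree (P * Q) n) (hQ : IsMonicOfDegree Q e) :
    ∃ d, IsMonicOfDegree P d ∧ n = d + e := by
  obtain ⟨d, hd, hd'⟩ := exists_leading (left_ne_zero_of_mul h.ne_zero)
  have h1 := coeff_mul_add hd' hQ.2
  rw [hQ.1, map_one, mul_one] at h1
  have h2 : n = d + e := by
    rcases lt_trichotomy n (d + e) with hlt | heq | hgt
    · rw [h.2 _ hlt] at h1; exact absurd h1.symm hd
    · exact heq
    · have := coeff_mul_eq_zero hd' hQ.2 hgt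
      rw [h.1] at this
      exact absurd this one_ne_zero
  exact ⟨d, ⟨by rw [← h1, ← h2, h.1], hd'⟩, h2⟩

theorem IsMonicOfDegree.eq_one {P : SkewPolynomial k} (h : IsMonicOfDegree P 0) : P = 1 := by
  ext n
  rcases Nat.eq_zero_or_pos n with rfl | hn
  · rw [h.1, SkewPolynomial.coeff_one_zero]
  · rw [h.2 n hn, SkewPolynomial.coeff_one, if_neg hn.ne]

theorem isUnit_of_mul_eq_one {P Q : SkewPolynomial k} (h : P * Q = 1) : IsUnit P := by
  have hQ : Q ≠ 0 := by rintro rfl; simp at h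
  have h2 : Q * P = 1 := by
    refine mul_right_cancel₀ hQ ?_
    rw [mul_assoc, h, mul_one, one_mul]
  exact ⟨⟨P, Q, h, h2⟩, rfl⟩

theorem isUnit_of_mul_eq_one' {P Q : SkewPolynomial k} (h : P * Q = 1) : IsUnit Q := by
  have hP : P ≠ 0 := by rintro rfl; simp at h
  have h2 : Q * P = 1 := by
    refine mul_left_cancel₀ hP ?_
    rw [← mul_assoc, h, mul_one, one_mul]
  exact ⟨⟨Q, P, h2, h⟩, rfl⟩

theorem IsMonicOfDegree.eq_one_of_isUnit {P : SkewPolynomial k} {d : ℕ} (h : IsMonicOfDegree P d)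
    (hu : IsUnit P) : P = 1 := by
  obtain ⟨Q, hQ⟩ := hu.exists_left_inv
  have := hQ ▸ isMonicOfDegree_one (k := k)
  obtain ⟨e, he, h0⟩ := this.of_mul h
  obtain rfl : d = 0 := by omega
  exact h.eq_one

/-- Division by a monic skew polynomial. -/
theorem exists_eq_mul_add {P : SkewPolynomial k} {d : ℕ} (hP : IsMonicOfDegree P d)
    (A : SkewPolynomial k) :
    ∃ Q B : SkewPolynomial k, A = Q * P + B ∧ ∀ n, d ≤ n → B.coeff n = 0 := by
  suffices h : ∀ m (A : SkewPolynomial k), (∀ n, m ≤ n → A.coeff n = 0) →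
      ∃ Q B : SkewPolynomial k, A = Q * P + B ∧ ∀ n, d ≤ n → B.coeff n = 0 by
    by_cases hA : A = 0
    · exact ⟨0, 0, by simp [hA], by simp⟩
    · obtain ⟨e, -, he⟩ := exists_leading hA
      exact h (e + 1) A fun n hn => he n hn
  intro m
  induction m with
  | zero => exact fun A hA => ⟨0, A, by simp, fun n _ => hA n (Nat.zero_le _)⟩
  | succ m ih =>
    intro A hA
    by_cases hm : m < d
    · exact ⟨0, A, by simp, fun n hn => hA n (by omega)⟩
    obtain ⟨Q, B, h1, h2⟩ := ih (A - SkewPolynomial.monomial (m - d) (A.coeff m) * P) (by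
      intro n hn
      rw [SkewPolynomial.coeff_sub, coeff_monomial_mul, if_pos (by omega)]
      rcases hn.eq_or_lt with rfl | hlt
      · rw [show m - (m - d) = d by omega, hP.1, map_one, mul_one, sub_self]
      · rw [hA n hlt, hP.2 _ (by omega), map_zero, mul_zero, sub_zero])
    exact ⟨SkewPolynomial.monomial (m - d) (A.coeff m) + Q, B, by
      rw [add_mul, add_assoc, ← h1]; abel, h2⟩

/-- A nonzero left ideal is generated by a monic skew polynomial. -/
theorem exists_span_eq (I : Ideal (SkewPolynomial k)) (hI : I ≠ ⊥) :
    ∃ P, IsMonic P ∧ I = Ideal.span {P} := by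
  classical
  -- A monic element of least degree generates: a nonzero remainder, made monic, would have smaller
  -- degree.
  have hex : ∃ d, ∃ P ∈ I, IsMonicOfDegree P d := by
    obtain ⟨A, hA, hA0⟩ := Submodule.exists_mem_ne_zero_of_ne_bot hI
    obtain ⟨d, hd, hd'⟩ := exists_leading hA0
    refine ⟨d, SkewPolynomial.C (A.coeff d)⁻¹ * A, I.mul_mem_left _ hA, ?_, fun n hn => ?_⟩
    · rw [C_mul_eq_smul, coeff_smul, inv_mul_cancel₀ hd]
    · rw [C_mul_eq_smul, coeff_smul, hd' n hn, mul_zero]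
  obtain ⟨P, hPI, hP⟩ := Nat.find_spec hex
  refine ⟨P, ⟨_, hP⟩, le_antisymm (fun A hA => ?_) (by
    rw [Ideal.span_le, Set.singleton_subset_iff]; exact hPI)⟩
  obtain ⟨Q, B, hAB, hB⟩ := exists_eq_mul_add hP A
  have hBI : B ∈ I := by
    have := I.sub_mem hA (I.mul_mem_left Q hPI)
    rwa [hAB, add_sub_cancel_left] at this
  by_cases hB0 : B = 0
  · rw [hAB, hB0, add_zero]
    exact Ideal.mul_mem_left _ _ (Ideal.subset_span rfl)
  exfalso
  obtain ⟨d, hd, hd'⟩ := exists_leading hB0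
  have hlt : d < Nat.find hex := by
    by_contra h
    exact hd (hB d (not_lt.1 h))
  refine Nat.find_min hex hlt ⟨SkewPolynomial.C (B.coeff d)⁻¹ * B, I.mul_mem_left _ hBI, ?_,
    fun n hn => ?_⟩
  · rw [C_mul_eq_smul, coeff_smul, inv_mul_cancel₀ hd]
  · rw [C_mul_eq_smul, coeff_smul, hd' n hn, mul_zero]

theorem mem_span_singleton {P A : SkewPolynomial k} :
    A ∈ (Ideal.span {P} : Ideal (SkewPolynomial k)) ↔ ∃ Q, Q * P = A := by
  rw [Ideal.mem_span_singleton']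

theorem IsMonic.span_inj {P P' : SkewPolynomial k} (hP : IsMonic P) (hP' : IsMonic P')
    (h : (Ideal.span {P} : Ideal (SkewPolynomial k)) = Ideal.span {P'}) : P = P' := by
  obtain ⟨d, hd⟩ := hP
  obtain ⟨d', hd'⟩ := hP'
  obtain ⟨Q, rfl⟩ := mem_span_singleton.1 (h ▸ Ideal.subset_span rfl : P ∈ Ideal.span {P'})
  obtain ⟨Q', hQ'⟩ := mem_span_singleton.1 (h ▸ Ideal.subset_span rfl :
    P' ∈ (Ideal.span {Q * P'} : Ideal (SkewPolynomial k)))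
  obtain ⟨e, he, -⟩ := IsMonicOfDegree.of_mul hd hd'
  have : Q' * Q = 1 := by
    refine mul_right_cancel₀ (IsMonicOfDegree.ne_zero hd') ?_
    rw [mul_assoc, hQ', one_mul]
  rw [he.eq_one_of_isUnit (isUnit_of_mul_eq_one' this), one_mul]

theorem finite_phiModule [Finite k] {P : SkewPolynomial k} (hP : IsMonic P) :
    Finite (PhiModule P) := by
  obtain ⟨d, hd⟩ := hP
  refine Finite.of_surjective (fun c : Fin d → k =>
    (Submodule.mkQ (Ideal.span {P}) (∑ i : Fin d, SkewPolynomial.monomial (i : ℕ) (c i)) :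
      PhiModule P)) fun m => ?_
  obtain ⟨A, rfl⟩ := Submodule.mkQ_surjective _ m
  obtain ⟨Q, B, h1, h2⟩ := exists_eq_mul_add hd A
  refine ⟨fun i => B.coeff i, ?_⟩
  have h3 : ∑ i : Fin d, SkewPolynomial.monomial (i : ℕ) (B.coeff i) = B := by
    ext n
    rw [coeff_sum]
    simp_rw [SkewPolynomial.coeff_monomial]
    by_cases hn : n < d
    · rw [Finset.sum_eq_single ⟨n, hn⟩]
      · simp
      · intro i _ hi
        rw [if_neg fun h => hi (Fin.ext h)]
      · simp
    · rw [h2 n (not_lt.1 hn)]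
      exact Finset.sum_eq_zero fun i _ => if_neg (by omega)
  simp only
  rw [h3, eq_comm, ← sub_eq_zero, ← map_sub, h1, add_sub_cancel_right, Submodule.mkQ_apply,
    Submodule.Quotient.mk_eq_zero]
  exact mem_span_singleton.2 ⟨Q, rfl⟩

end Arithmetic

/-! ## Factorizations and simple submodules -/

section Factor

variable {k : Type*} [Field k] [MulSemiringAction (Multiplicative ℕ) k]

/-- The submodule of `D_P` generated by `Q`. -/
def subOf (P Q : SkewPolynomial k) : Submodule (SkewPolynomial k) (PhiModule P) :=
  Submodule.map (Submodule.mkQ (Ideal.span {P})) (Ideal.span {Q})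

theorem span_mul_le (P Q : SkewPolynomial k) :
    (Ideal.span {P * Q} : Ideal (SkewPolynomial k)) ≤ Ideal.span {Q} := by
  rw [Ideal.span_le, Set.singleton_subset_iff]
  exact mem_span_singleton.2 ⟨P, rfl⟩

theorem comap_subOf {P P₁ Q : SkewPolynomial k} (h : P₁ * Q = P) :
    (subOf P Q).comap (Submodule.mkQ (Ideal.span {P})) = Ideal.span {Q} := by
  rw [subOf, Submodule.comap_map_mkQ, sup_eq_right, ← h]
  exact span_mul_le _ _

/-- The preimage of `S` is a left ideal containing `P`, hence principal with a monic generator that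
divides `P` on the right. -/
theorem exists_factor {P : SkewPolynomial k} (hP : IsMonic P)
    (S : Submodule (SkewPolynomial k) (PhiModule P)) :
    ∃ P₁ Q, IsMonic P₁ ∧ IsMonic Q ∧ P₁ * Q = P ∧ S = subOf P Q := by
  have hPI : P ∈ S.comap (Submodule.mkQ (Ideal.span {P})) := by
    rw [Submodule.mem_comap, Submodule.mkQ_apply,
      (Submodule.Quotient.mk_eq_zero _).2 (Ideal.mem_span_singleton_self P)]
    exact S.zero_mem
  obtain ⟨d, hd⟩ := hP
  obtain ⟨Q, hQ, hI⟩ := exists_span_eq (S.comap (Submodule.mkQ (Ideal.span {P}))) (by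
    intro h0
    rw [h0] at hPI
    exact IsMonicOfDegree.ne_zero hd ((Submodule.mem_bot _).1 hPI))
  rw [hI] at hPI
  obtain ⟨P₁, rfl⟩ := mem_span_singleton.1 hPI
  obtain ⟨e, he⟩ := hQ
  obtain ⟨d', hd', -⟩ := IsMonicOfDegree.of_mul hd he
  refine ⟨P₁, Q, ⟨d', hd'⟩, ⟨e, he⟩, rfl, ?_⟩
  rw [subOf, ← hI, Submodule.map_comap_eq_of_surjective (Submodule.mkQ_surjective _)]

theorem subOf_inj {P P₁ P₂ Q₁ Q₂ : SkewPolynomial k} (h₁ : P₁ * Q₁ = P) (h₂ : P₂ * Q₂ = P)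
    (hQ₁ : IsMonic Q₁) (hQ₂ : IsMonic Q₂) (h : subOf P Q₁ = subOf P Q₂) : Q₁ = Q₂ :=
  hQ₁.span_inj hQ₂ (by rw [← comap_subOf h₁, ← comap_subOf h₂, h])

theorem subOf_le_subOf_iff {P P₁ P₂ Q₁ Q₂ : SkewPolynomial k} (h₁ : P₁ * Q₁ = P)
    (h₂ : P₂ * Q₂ = P) : subOf P Q₁ ≤ subOf P Q₂ ↔ ∃ A, A * Q₂ = Q₁ := by
  rw [← mem_span_singleton, ← Ideal.span_singleton_le_iff_mem, ← comap_subOf h₁,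
    ← comap_subOf h₂]
  refine ⟨fun h => Submodule.comap_mono h, fun h => ?_⟩
  have := Submodule.map_mono (f := Submodule.mkQ (Ideal.span {P})) h
  rwa [Submodule.map_comap_eq_of_surjective (Submodule.mkQ_surjective _),
    Submodule.map_comap_eq_of_surjective (Submodule.mkQ_surjective _)] at this

theorem subOf_self (P : SkewPolynomial k) : subOf P P = ⊥ := by
  rw [subOf, Submodule.mkQ_map_self]

/-- The submodules below `subOf P Q` are the `subOf P (C * Q)` with `P₁ = B * C`. The two extreme
ones correspond to `B` or `C` being a unit. -/
theorem isSimpleModule_subOf_iff {P P₁ Q : SkewPolynomial k} (hP : IsMonic P) (hQ : IsMonic Q)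
    (h : P₁ * Q = P) : IsSimpleModule (SkewPolynomial k) (subOf P Q) ↔ Irreducible P₁ := by
  have hbot : subOf P Q = ⊥ ↔ IsUnit P₁ := by
    rw [← le_bot_iff, ← subOf_self P, subOf_le_subOf_iff h (one_mul P)]
    constructor
    · rintro ⟨A, hA⟩
      refine isUnit_of_mul_eq_one' (P := A) (mul_right_cancel₀ hQ.ne_zero ?_)
      rw [mul_assoc, h, hA, one_mul]
    · intro hu
      obtain ⟨A, hA⟩ := hu.exists_left_inv
      exact ⟨A, by rw [← h, ← mul_assoc, hA, one_mul]⟩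
  rw [isSimpleModule_iff_isAtom]
  constructor
  · rintro ⟨h1, h2⟩
    refine ⟨hbot.not.1 h1, fun B C hBC => ?_⟩
    subst hBC
    have hBCQ : B * (C * Q) = P := by rw [← mul_assoc, h]
    have hle : subOf P (C * Q) ≤ subOf P Q := (subOf_le_subOf_iff hBCQ h).2 ⟨C, rfl⟩
    rcases hle.eq_or_lt with heq | hlt
    · right
      obtain ⟨A, hA⟩ := (subOf_le_subOf_iff h hBCQ).1 heq.ge
      refine isUnit_of_mul_eq_one' (P := A) (mul_right_cancel₀ hQ.ne_zero ?_)
      rw [mul_assoc, hA, one_mul]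
    · left
      have h3 := h2 _ hlt
      rw [← le_bot_iff, ← subOf_self P, subOf_le_subOf_iff hBCQ (one_mul P)] at h3
      obtain ⟨A, hA⟩ := h3
      have h0 : C * Q ≠ 0 := by
        intro h0
        rw [h0, mul_zero] at hBCQ
        exact hP.ne_zero hBCQ.symm
      refine isUnit_of_mul_eq_one' (P := A) (mul_right_cancel₀ h0 ?_)
      rw [mul_assoc, hBCQ, hA, one_mul]
  · intro hirr
    refine ⟨hbot.not.2 hirr.not_isUnit, fun W hW => ?_⟩
    obtain ⟨B, A, hB, hA, hBA, rfl⟩ := exists_factor hP W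
    obtain ⟨C, rfl⟩ := (subOf_le_subOf_iff hBA h).1 hW.le
    have hBC : B * C = P₁ := mul_right_cancel₀ hQ.ne_zero (by rw [mul_assoc, hBA, h])
    rcases hirr.isUnit_or_isUnit hBC.symm with hu | hu
    · obtain ⟨d, hd⟩ := hB
      rw [IsMonicOfDegree.eq_one_of_isUnit hd hu, one_mul] at hBA
      rw [hBA, subOf_self]
    · exfalso
      obtain ⟨C', hC'⟩ := hu.exists_left_inv
      refine hW.not_ge ((subOf_le_subOf_iff h hBA).2 ⟨C', ?_⟩)
      rw [← mul_assoc, hC', one_mul]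

/-- The quotient of `D_{P₁ Q}` by the submodule generated by `Q` is `D_Q`. -/
def quotientSubOfEquiv {P P₁ Q : SkewPolynomial k} (h : P₁ * Q = P) :
    (PhiModule P ⧸ subOf P Q) ≃ₗ[SkewPolynomial k] PhiModule Q :=
  Submodule.quotientQuotientEquivQuotient (Ideal.span {P}) (Ideal.span {Q})
    (h ▸ span_mul_le P₁ Q)

theorem isMonic_prod {L : List (SkewPolynomial k)} (h : ∀ Q ∈ L, IsMonic Q) : IsMonic L.prod := by
  induction L with
  | nil => exact ⟨0, isMonicOfDegree_one⟩
  | cons Q L ih =>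
    obtain ⟨d, hd⟩ := h Q List.mem_cons_self
    obtain ⟨e, he⟩ := ih fun Q hQ => h Q (List.mem_cons_of_mem _ hQ)
    rw [List.prod_cons]
    exact ⟨_, IsMonicOfDegree.mul hd he⟩

theorem factorizations_one : factorizations (1 : SkewPolynomial k) = {[]} := by
  ext L
  rw [Set.mem_singleton_iff]
  constructor
  · rintro ⟨h1, h2⟩
    cases L with
    | nil => rfl
    | cons Q L =>
      rw [List.prod_cons] at h2
      exact absurd (isUnit_of_mul_eq_one h2) (h1 Q List.mem_cons_self).2.not_isUnit
  · rintro rfl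
    exact ⟨by simp, rfl⟩

/-- The first factor of a factorization of `P` corresponds to a simple submodule of `D_P`. -/
theorem factorizations_eq_iUnion {P : SkewPolynomial k} (hP : IsMonic P) (hP1 : P ≠ 1)
    {f g : Submodule (SkewPolynomial k) (PhiModule P) → SkewPolynomial k}
    (hfm : ∀ S, IsMonic (f S)) (hgm : ∀ S, IsMonic (g S)) (hfg : ∀ S, f S * g S = P)
    (hS : ∀ S, S = subOf P (g S)) :
    factorizations P = ⋃ S ∈ {S : Submodule (SkewPolynomial k) (PhiModule P) |
      IsSimpleModule (SkewPolynomial k) S}, (List.cons (f S)) '' factorizations (g S) := by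
  ext L
  simp only [Set.mem_iUnion, Set.mem_image, exists_prop, Set.mem_ofPred_eq]
  constructor
  · rintro ⟨h1, h2⟩
    cases L with
    | nil => exact absurd h2.symm hP1
    | cons Q L =>
      rw [List.prod_cons] at h2
      have hm := isMonic_prod fun Q hQ => (h1 Q (List.mem_cons_of_mem _ hQ)).1
      have hg : g (subOf P L.prod) = L.prod := subOf_inj (hfg _) h2 (hgm _) hm (hS _).symm
      have hf : f (subOf P L.prod) = Q := by
        refine mul_right_cancel₀ hm.ne_zero ?_
        have h3 := hfg (subOf P L.prod)
        rw [hg] at h3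
        rw [h3, h2]
      refine ⟨subOf P L.prod, (isSimpleModule_subOf_iff hP hm h2).2 (h1 Q List.mem_cons_self).2,
        L, ⟨fun Q hQ => h1 Q (List.mem_cons_of_mem _ hQ), hg.symm⟩, by rw [hf]⟩
  · rintro ⟨S, hSs, L, ⟨h1, h2⟩, rfl⟩
    refine ⟨?_, by rw [List.prod_cons, h2, hfg]⟩
    intro Q hQ
    rcases List.mem_cons.1 hQ with rfl | hQ
    · rw [hS S] at hSs
      exact ⟨hfm S, (isSimpleModule_subOf_iff hP (hgm S) (hfg S)).1 hSs⟩
    · exact h1 Q hQ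

theorem encard_biUnion_finset {α ι : Type*} (s : Finset ι) (f : ι → Set α)
    (h : (s : Set ι).PairwiseDisjoint f) :
    (⋃ i ∈ s, f i).encard = ∑ i ∈ s, (f i).encard := by
  classical
  induction s using Finset.induction_on with
  | empty => simp
  | insert a s ha ih =>
    rw [Finset.set_biUnion_insert, Set.encard_union_eq, Finset.sum_insert ha,
      ih (h.subset (by simp))]
    rw [Set.disjoint_iUnion₂_right]
    intro i hi
    exact h (by simp) (by simp [hi]) (by rintro rfl; exact ha hi)

/-- The union over simple submodules is disjoint because the product of the tail is `g S`, which
determines `S`. -/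
theorem encard_factorizations_eq_sum {P : SkewPolynomial k} (hP : IsMonic P) (hP1 : P ≠ 1)
    {f g : Submodule (SkewPolynomial k) (PhiModule P) → SkewPolynomial k}
    (hfm : ∀ S, IsMonic (f S)) (hgm : ∀ S, IsMonic (g S)) (hfg : ∀ S, f S * g S = P)
    (hS : ∀ S, S = subOf P (g S))
    (s : Finset (Submodule (SkewPolynomial k) (PhiModule P)))
    (hs : ∀ S, S ∈ s ↔ IsSimpleModule (SkewPolynomial k) S) :
    (factorizations P).encard = ∑ S ∈ s, (factorizations (g S)).encard := by
  have h1 : {S : Submodule (SkewPolynomial k) (PhiModule P) |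
      IsSimpleModule (SkewPolynomial k) S} = s := Set.ext fun S => (hs S).symm
  rw [factorizations_eq_iUnion hP hP1 hfm hgm hfg hS, h1]
  refine (encard_biUnion_finset s _ ?_).trans
    (Finset.sum_congr rfl fun S _ => (List.cons_injective).encard_image _)
  intro S _ S' _ hne
  rw [Function.onFun, Set.disjoint_left]
  rintro _ ⟨L, hL, rfl⟩ ⟨L', hL', h⟩
  obtain ⟨-, rfl⟩ := List.cons.inj h
  refine hne ?_
  rw [hS S, hS S', ← hL.2, ← hL'.2]

end Factor

/-! ## The invariants of a module -/

section Killing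

variable {k : Type*} [Field k] [MulSemiringAction (Multiplicative ℕ) k]

theorem isCoprime_of_ne {M N : (fixedField k)[X]} (hM : M.Monic) (hM' : Irreducible M)
    (hN : N.Monic) (hN' : Irreducible N) (h : M ≠ N) : IsCoprime M N :=
  hM'.coprime_iff_not_dvd.2 fun hd =>
    h (eq_of_monic_of_associated hM hN (hM'.associated_of_dvd hN' hd))

variable {D : Type*} [AddCommGroup D] [Module (SkewPolynomial k) D]
variable {E : Type*} [AddCommGroup E] [Module (SkewPolynomial k) E]

theorem XInjective.congr (e : D ≃ₗ[SkewPolynomial k] E) (h : XInjective k D) :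
    XInjective k E := by
  intro x y hxy
  obtain ⟨x, rfl⟩ := e.surjective x
  obtain ⟨y, rfl⟩ := e.surjective y
  simp only [← map_smul] at hxy
  rw [h (e.injective hxy)]

theorem layer_anti (N : (fixedField k)[X]) {a b : ℕ} (h : a ≤ b) : layer D N b ≤ layer D N a := by
  refine inf_le_inf_left _ ?_
  rintro _ ⟨d, rfl⟩
  obtain ⟨c, rfl⟩ := Nat.exists_eq_add_of_le h
  exact ⟨zetaEnd D (N ^ c) d, by
    rw [zetaEnd_apply, zetaEnd_apply, zetaEnd_apply, smul_smul, ← map_mul, ← pow_add]⟩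

theorem layer_zero (N : (fixedField k)[X]) : layer D N 0 = LinearMap.ker (zetaEnd D N) := by
  rw [layer, inf_eq_left]
  intro d _
  exact ⟨d, by simp⟩

/-- A Bézout relation makes `M` invertible on what `N` kills; hence a quotient by a simple module of
one class leaves the other tables unchanged. -/
theorem inf_range_eq_of_isCoprime {S : Submodule (SkewPolynomial k) D} {M N : (fixedField k)[X]}
    (hS : S ≤ LinearMap.ker (zetaEnd D N)) (h : IsCoprime N M) :
    S ⊓ LinearMap.range (zetaEnd D M) = S := by
  rw [inf_eq_left]
  intro s hs
  obtain ⟨u, v, huv⟩ := h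
  refine ⟨zeta k v • s, ?_⟩
  have h1 : zeta k (u * N + v * M) • s = s := by rw [huv, map_one, one_smul]
  rw [map_add, add_smul, map_mul, mul_smul, show zeta k N • s = 0 from hS hs, smul_zero,
    zero_add, mul_comm, map_mul, mul_smul] at h1
  exact h1

/-- A simple module is killed by an irreducible polynomial. -/
theorem exists_irreducible_smul_eq_zero [Finite D] [IsSimpleModule (SkewPolynomial k) D] :
    ∃ M : (fixedField k)[X], M.Monic ∧ Irreducible M ∧ ∀ d : D, zeta k M • d = 0 := by
  have hf : ∃ f : (fixedField k)[X], f ≠ 0 ∧ ∀ d : D, zeta k f • d = 0 := by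
    -- Infinitely many polynomials act through finitely many self-maps of `D`, so two of them agree.
    obtain ⟨f, g, hne, h⟩ := Finite.exists_ne_map_eq_of_infinite
      fun (f : (fixedField k)[X]) (d : D) => zeta k f • d
    refine ⟨f - g, sub_ne_zero.2 hne, fun d => ?_⟩
    rw [map_sub, sub_smul, sub_eq_zero]
    exact congrFun h d
  obtain ⟨f, hf0, hf⟩ := hf
  induction f using UniqueFactorizationMonoid.induction_on_prime with
  | h₁ => exact absurd rfl hf0
  | h₂ u hu =>
    have : Nontrivial D := IsSimpleModule.nontrivial (SkewPolynomial k) D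
    obtain ⟨d, hd⟩ := exists_ne (0 : D)
    obtain ⟨v, hv⟩ := hu.exists_left_inv
    refine absurd ?_ hd
    rw [← one_smul (SkewPolynomial k) d, ← map_one (zeta k), ← hv, map_mul, mul_smul, hf,
      smul_zero]
  | h₃ f p hf0' hp ih =>
    classical
    -- By Schur the cofactor `f` either acts invertibly, and then the prime `p` kills `D`, or kills
    -- `D` itself.
    rcases LinearMap.bijective_or_eq_zero (zetaEnd D f) with hb | h0
    · refine ⟨normalize p, monic_normalize hp.ne_zero,
        (associated_normalize p).irreducible hp.irreducible, fun d => ?_⟩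
      obtain ⟨d, rfl⟩ := hb.2 d
      obtain ⟨v, hv⟩ := (associated_normalize p).dvd
      rw [zetaEnd_apply, smul_smul, ← map_mul, hv, mul_right_comm, mul_comm, map_mul, mul_smul,
        hf, smul_zero]
    · exact ih hf0' fun d => LinearMap.congr_fun h0 d

end Killing

/-! ### Kernel dimensions and quotients by simple submodules -/

section Invariants

variable {k : Type*} [Field k] [MulSemiringAction (Multiplicative ℕ) k]
variable {D : Type*} [AddCommGroup D] [Module (SkewPolynomial k) D] [Module k D]
  [IsScalarTower k (SkewPolynomial k) D]
variable {E : Type*} [AddCommGroup E] [Module (SkewPolynomial k) E] [Module k E]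
  [IsScalarTower k (SkewPolynomial k) E]
variable {ι : Type*}

variable (D) in
/-- The elementary divisors of `D` over `k[X ^ r]` are described by the tables `T l`. -/
structure HasTables (N : ι → (fixedField k)[X]) (T : ι → List ℕ) : Prop where
  finrank_ker : ∀ l j, Module.finrank k (LinearMap.ker (zetaEnd D (N l ^ j))) =
    (N l).natDegree * ((T l).map (min · j)).sum
  ker_eq_bot : ∀ M : (fixedField k)[X], M.Monic → Irreducible M → (∀ l, M ≠ N l) →
    LinearMap.ker (zetaEnd D M) = ⊥

theorem finrank_ker_congr (e : D ≃ₗ[SkewPolynomial k] E) (f : (fixedField k)[X]) :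
    Module.finrank k (LinearMap.ker (zetaEnd D f)) =
      Module.finrank k (LinearMap.ker (zetaEnd E f)) := by
  have h : (LinearMap.ker (zetaEnd D f)).map (e : D →ₗ[SkewPolynomial k] E) =
      LinearMap.ker (zetaEnd E f) := by
    ext x
    obtain ⟨d, rfl⟩ := e.surjective x
    rw [LinearMap.mem_ker, zetaEnd_apply, ← map_smul, map_eq_zero_iff e e.injective]
    constructor
    · rintro ⟨d', hd', h⟩
      rw [← e.injective h]
      exact hd'
    · exact fun h => ⟨d, h, rfl⟩
  rw [← h]
  exact (((e.submoduleMap (LinearMap.ker (zetaEnd D f))).restrictScalars k)).finrank_eq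

theorem HasTables.congr (e : D ≃ₗ[SkewPolynomial k] E) {N : ι → (fixedField k)[X]}
    {T : ι → List ℕ} (h : HasTables D N T) : HasTables E N T where
  finrank_ker l j := by rw [← finrank_ker_congr e, h.finrank_ker]
  ker_eq_bot M h1 h2 h3 := by
    rw [LinearMap.ker_eq_bot']
    intro x hx
    obtain ⟨d, rfl⟩ := e.surjective x
    rw [zetaEnd_apply, ← map_smul, map_eq_zero_iff e e.injective] at hx
    rw [LinearMap.ker_eq_bot'.1 (h.ker_eq_bot M h1 h2 h3) d hx, map_zero]

variable [Finite D]

theorem finrank_layer_eq {N : ι → (fixedField k)[X]} {T : ι → List ℕ} (h : HasTables D N T)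
    (l : ι) (a : ℕ) : Module.finrank k (layer D (N l) a) =
      (N l).natDegree * (T l).countP (a + 1 ≤ ·) := by
  have h1 := finrank_layer (D := D) (N l) a
  rw [h.finrank_ker, h.finrank_ker, sum_map_min_succ, mul_add] at h1
  omega

/-- The layers decrease from `ker N` to `0`. At the last layer `a` that contains `S` the dimension
drops strictly, so `a + 1` is an entry of the table. -/
theorem HasTables.exists_cell {N : ι → (fixedField k)[X]} {T : ι → List ℕ}
    (h : HasTables D N T) (hT : ∀ l, IsTable (T l)) (S : Submodule (SkewPolynomial k) D)
    [IsSimpleModule (SkewPolynomial k) S] :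
    ∃ l, ∃ i ∈ admissibleCells (T l), S ≤ layer D (N l) ((T l).getD i 0 - 1) ∧
      ¬ S ≤ layer D (N l) ((T l).getD i 0) := by
  classical
  have hS0 : S ≠ ⊥ := (isSimpleModule_iff_isAtom.1 ‹_›).1
  obtain ⟨M, hM, hM', hMS⟩ := exists_irreducible_smul_eq_zero (k := k) (D := S)
  have hle : S ≤ LinearMap.ker (zetaEnd D M) := fun s hs => congrArg Subtype.val (hMS ⟨s, hs⟩)
  have hex : ∃ l, M = N l := by
    by_contra! hne
    rw [h.ker_eq_bot M hM hM' hne, le_bot_iff] at hle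
    exact hS0 hle
  obtain ⟨l, rfl⟩ := hex
  have hbound : ∃ a, ¬ S ≤ layer D (N l) a := by
    refine ⟨(T l).sum, fun hle => hS0 ?_⟩
    have h1 : (T l).countP ((T l).sum + 1 ≤ ·) = 0 := by
      rw [List.countP_eq_zero]
      intro b hb
      have := List.le_sum_of_mem hb
      simp; omega
    have h2 := finrank_layer_eq h l (T l).sum
    rw [h1, mul_zero] at h2
    have h3 : (layer D (N l) (T l).sum).restrictScalars k = ⊥ :=
      Submodule.finrank_eq_zero.1 h2
    rw [Submodule.restrictScalars_eq_bot_iff] at h3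
    exact le_bot_iff.1 (h3 ▸ hle)
  obtain ⟨a, ha⟩ : ∃ a, Nat.find hbound = a + 1 := by
    refine Nat.exists_eq_succ_of_ne_zero fun h0 => ?_
    have := Nat.find_spec hbound
    rw [h0, layer_zero] at this
    exact this hle
  have h1 : S ≤ layer D (N l) a := not_not.1 (Nat.find_min hbound (by omega))
  have h2 : ¬ S ≤ layer D (N l) (a + 1) := ha ▸ Nat.find_spec hbound
  have h3 : (layer D (N l) (a + 1)).restrictScalars k < (layer D (N l) a).restrictScalars k := by
    refine lt_of_le_not_ge (layer_anti (N l) (Nat.le_succ a)) fun hge => h2 (h1.trans hge)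
  have h4 := Submodule.finrank_lt_finrank_of_lt h3
  have h5 : (N l).natDegree * (T l).countP (a + 1 + 1 ≤ ·) <
      (N l).natDegree * (T l).countP (a + 1 ≤ ·) := by
    rw [← finrank_layer_eq h, ← finrank_layer_eq h]
    exact h4
  obtain ⟨i, hi, hia⟩ := (hT l).exists_mem_admissibleCells (lt_of_mul_lt_mul_left' h5)
  refine ⟨l, i, hi, ?_⟩
  rw [hia]
  exact ⟨h1, h2⟩

variable [Finite k]

/-- By simplicity, `S` meets the image of `N l ^ j` in `S` when `j` is below the entry and in `0`
otherwise. So the kernel of `N l ^ j` loses dimension `δ` exactly from the entry onwards, as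
lowering the cell prescribes. -/
theorem HasTables.quotient [DecidableEq ι] {N : ι → (fixedField k)[X]} {T : ι → List ℕ}
    (h : HasTables D N T) (hT : ∀ l, IsTable (T l)) (hmonic : ∀ l, (N l).Monic)
    (hN : ∀ l, Irreducible (N l)) (hinj : Function.Injective N) (hD : XInjective k D)
    (S : Submodule (SkewPolynomial k) D) [IsSimpleModule (SkewPolynomial k) S] {l : ι} {i : ℕ}
    (hi : i ∈ admissibleCells (T l)) (h1 : S ≤ layer D (N l) ((T l).getD i 0 - 1))
    (h2 : ¬ S ≤ layer D (N l) ((T l).getD i 0)) :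
    HasTables (D ⧸ S) N (Function.update T l (lower (T l) i)) := by
  have hSk : S ≤ LinearMap.ker (zetaEnd D (N l)) := h1.trans inf_le_left
  have hS : Module.finrank k S = (N l).natDegree :=
    finrank_of_isSimpleModule (hD.submodule S) (hmonic l) (hN l)
      fun s => Subtype.ext (hSk s.2)
  have hzero : Module.finrank k (⊥ : Submodule (SkewPolynomial k) D) = 0 :=
    Module.finrank_eq_zero_of_subsingleton _ _
  constructor
  · intro l' j
    have key := finrank_ker_quotient S (N l' ^ j)
    rw [h.finrank_ker, hS] at key
    by_cases hl : l' = l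
    · subst hl
      rw [Function.update_self]
      have h3 := sum_map_min_lower (hT l') hi j
      by_cases hj : (T l').getD i 0 ≤ j
      · have hbot : S ⊓ LinearMap.range (zetaEnd D (N l' ^ j)) = ⊥ := by
          refine ((isSimpleModule_iff_isAtom.1 ‹_›).le_iff.1 inf_le_left).resolve_right fun he => h2 ?_
          exact (le_inf hSk (inf_eq_left.1 he)).trans (layer_anti (D := D) (N l') hj)
        rw [hbot, hzero] at key
        rw [if_pos hj] at h3
        rw [← h3, mul_add] at key
        omega
      · have hinf : S ⊓ LinearMap.range (zetaEnd D (N l' ^ j)) = S := by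
          rw [inf_eq_left]
          exact (h1.trans (layer_anti (D := D) (N l') (by omega))).trans inf_le_right
        rw [hinf, hS] at key
        rw [if_neg hj, add_zero] at h3
        rw [h3]
        omega
    · rw [Function.update_of_ne hl]
      rw [inf_range_eq_of_isCoprime hSk (isCoprime_of_ne (hmonic l) (hN l) (hmonic l') (hN l')
        fun he => hl (hinj he).symm).pow_right, hS] at key
      omega
  · intro M hM hM' hne
    have key := finrank_ker_quotient S M
    rw [h.ker_eq_bot M hM hM' hne, hzero, zero_add] at key
    have hle : Module.finrank k (S ⊓ LinearMap.range (zetaEnd D M) :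
        Submodule (SkewPolynomial k) D) ≤ Module.finrank k S :=
      Submodule.finrank_mono (s := (S ⊓ LinearMap.range (zetaEnd D M)).restrictScalars k)
        (t := S.restrictScalars k) fun _ hs => (Submodule.mem_inf.1 hs).1
    have h0 : Module.finrank k ((LinearMap.ker (zetaEnd (D ⧸ S) M)).restrictScalars k) = 0 := by
      change Module.finrank k (LinearMap.ker (zetaEnd (D ⧸ S) M)) = 0
      omega
    have : Finite (D ⧸ S) := Finite.of_surjective _ (Submodule.mkQ_surjective S)
    have := Submodule.finrank_eq_zero.1 h0
    rwa [Submodule.restrictScalars_eq_bot_iff] at this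

/-- Subtract the counts for two consecutive layers and cancel `Q - 1 > 0` against the geometric sum.
-/
theorem HasTables.natCard_simple {N : ι → (fixedField k)[X]} {T : ι → List ℕ}
    (h : HasTables D N T) (hT : ∀ l, IsTable (T l)) (hmonic : ∀ l, (N l).Monic)
    (hN : ∀ l, Irreducible (N l)) (hD : XInjective k D) {l : ι} {i : ℕ}
    (hi : i ∈ admissibleCells (T l)) :
    Nat.card {S : Submodule (SkewPolynomial k) D // IsSimpleModule (SkewPolynomial k) S ∧
      S ≤ layer D (N l) ((T l).getD i 0 - 1) ∧ ¬ S ≤ layer D (N l) ((T l).getD i 0)} =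
      pathWeight (Nat.card (fixedField k) ^ (N l).natDegree) (T l) i := by
  classical
  have : Finite (Submodule (SkewPolynomial k) D) :=
    Finite.of_injective (fun W => (W : Set D)) SetLike.coe_injective
  have := Fintype.ofFinite (Submodule (SkewPolynomial k) D)
  set Q := Nat.card (fixedField k) ^ (N l).natDegree with hQ
  have hpos := ((hT l).mem_admissibleCells.1 hi).1
  obtain ⟨a, ha⟩ : ∃ a, (T l).getD i 0 = a + 1 := Nat.exists_eq_succ_of_ne_zero (by omega)
  have hQ2 : 2 ≤ Q := by
    have h1 : 1 < Nat.card (fixedField k) := Finite.one_lt_card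
    exact Nat.one_lt_pow (hN l).natDegree_pos.ne' h1
  have hw := (hT l).pathWeight_mul_add hi (Q := Q) (by omega)
  have hc : ∀ a, Nat.card {W : Submodule (SkewPolynomial k) D //
      IsSimpleModule (SkewPolynomial k) W ∧ W ≤ layer D (N l) a} * (Q - 1) + 1 =
        Q ^ (T l).countP (a + 1 ≤ ·) := fun a => by
    rw [natCard_simple_mul_add_one hD (hmonic l) (hN l) (layer D (N l) a)
      fun u hu => (Submodule.mem_inf.1 hu).1,
      finrank_layer_eq h, pow_mul]
  have h1 := hc a
  have h2 := hc (a + 1)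
  rw [ha] at hw ⊢
  rw [Nat.add_sub_cancel]
  have hsplit : Nat.card {W : Submodule (SkewPolynomial k) D //
      IsSimpleModule (SkewPolynomial k) W ∧ W ≤ layer D (N l) a} =
      Nat.card {S : Submodule (SkewPolynomial k) D // IsSimpleModule (SkewPolynomial k) S ∧
        S ≤ layer D (N l) a ∧ ¬ S ≤ layer D (N l) (a + 1)} +
      Nat.card {W : Submodule (SkewPolynomial k) D //
        IsSimpleModule (SkewPolynomial k) W ∧ W ≤ layer D (N l) (a + 1)} := by
    simp only [Nat.card_eq_fintype_card, Fintype.card_subtype]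
    rw [← Finset.card_union_of_disjoint]
    · congr 1
      ext W
      have := layer_anti (D := D) (N l) (Nat.le_succ a)
      simp only [Finset.mem_filter_univ, Finset.mem_union]
      constructor
      · rintro ⟨h1, h2⟩
        by_cases h3 : W ≤ layer D (N l) (a + 1)
        · exact Or.inr ⟨h1, h3⟩
        · exact Or.inl ⟨h1, h2, h3⟩
      · rintro (⟨h1, h2, -⟩ | ⟨h1, h2⟩)
        · exact ⟨h1, h2⟩
        · exact ⟨h1, h2.trans this⟩
    · rw [Finset.disjoint_filter]
      rintro W - ⟨-, -, h3⟩ ⟨-, h4⟩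
      exact h3 h4
  rw [hsplit, add_mul] at h1
  refine Nat.eq_of_mul_eq_mul_right (show 0 < Q - 1 by omega) ?_
  omega

end Invariants

/-! ## The number of factorizations -/

section Main

variable {k : Type*} [Field k] [MulSemiringAction (Multiplicative ℕ) k] {ι : Type*}

theorem HasTables.subsingleton {D : Type*} [AddCommGroup D] [Module (SkewPolynomial k) D]
    [Module k D] [IsScalarTower k (SkewPolynomial k) D] [Finite D]
    {N : ι → (fixedField k)[X]} {T : ι → List ℕ} (h : HasTables D N T)
    (hT : ∀ l, IsTable (T l)) (h0 : ∀ l, T l = []) : Subsingleton D := by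
  by_contra hne
  have : Finite (Submodule (SkewPolynomial k) D) :=
    Finite.of_injective (fun W => (W : Set D)) SetLike.coe_injective
  obtain ⟨S, hS, -⟩ := (IsAtomic.eq_bot_or_exists_atom_le
    (⊤ : Submodule (SkewPolynomial k) D)).resolve_left fun h =>
      hne ((Submodule.subsingleton_iff (SkewPolynomial k)).1 (subsingleton_iff_bot_eq_top.1 h.symm))
  have := isSimpleModule_iff_isAtom.2 hS
  obtain ⟨l, i, hi, -⟩ := h.exists_cell hT S
  rw [h0 l] at hi
  simp [admissibleCells] at hi

variable [Finite k] [Fintype ι] [DecidableEq ι]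

/-- Induction on the total of the entries. Simple submodules attached to the same cell have
quotients with the same tables, so grouping by cell turns the sum over first factors into the
recursion of `predicted_eq`. -/
theorem encard_factorizations {N : ι → (fixedField k)[X]} (hmonic : ∀ l, (N l).Monic)
    (hN : ∀ l, Irreducible (N l)) (hinj : Function.Injective N) {T : ι → List ℕ}
    (hT : ∀ l, IsTable (T l)) {P : SkewPolynomial k} (hP : IsMonic P)
    (hD : XInjective k (PhiModule P)) (h : HasTables (PhiModule P) N T) :
    (factorizations P).encard =
      (predicted (fun l => Nat.card (fixedField k) ^ (N l).natDegree) T : ℕ) := by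
  classical
  obtain ⟨n, hn⟩ : ∃ n, ∑ l, (T l).sum = n := ⟨_, rfl⟩
  induction n generalizing T P with
  | zero =>
    have := finite_phiModule hP
    have h0 : ∀ l, T l = [] := by
      intro l
      by_contra hne
      obtain ⟨a, ha⟩ := List.exists_mem_of_ne_nil _ hne
      have h1 := (hT l).2 a ha
      have h2 := List.le_sum_of_mem ha
      have h3 := Finset.sum_eq_zero_iff.1 hn l (Finset.mem_univ l)
      omega
    have hsub := h.subsingleton hT h0
    have h1 : (Ideal.span {P} : Ideal (SkewPolynomial k)) = Ideal.span {1} := by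
      rw [Ideal.span_singleton_one]
      exact Submodule.Quotient.subsingleton_iff.1 hsub
    rw [hP.span_inj ⟨0, isMonicOfDegree_one⟩ h1, factorizations_one]
    simp [predicted, h0, weightSum_nil, Nat.multinomial]
  | succ n ih =>
    have := finite_phiModule hP
    have hfin : Finite (Submodule (SkewPolynomial k) (PhiModule P)) :=
      Finite.of_injective (fun W => (W : Set (PhiModule P))) SetLike.coe_injective
    have := Fintype.ofFinite (Submodule (SkewPolynomial k) (PhiModule P))
    have hP1 : P ≠ 1 := by
      rintro rfl
      have hsub : Subsingleton (PhiModule (1 : SkewPolynomial k)) := by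
        refine Submodule.Quotient.subsingleton_iff.2 ?_
        rw [Ideal.span_singleton_one]
      refine absurd hn ?_
      rw [Finset.sum_eq_zero]
      · omega
      intro l _
      by_contra hl
      have h1 := h.finrank_ker l 1
      rw [Module.finrank_eq_zero_of_subsingleton, eq_comm, mul_eq_zero] at h1
      rcases h1 with h1 | h1
      · exact (hN l).natDegree_pos.ne' h1
      · rw [sum_map_min_succ] at h1
        obtain ⟨a, ha, ha0⟩ : ∃ a ∈ T l, a ≠ 0 := by
          by_contra! h2
          exact hl (List.sum_eq_zero h2)
        have : 0 < (T l).countP (0 + 1 ≤ ·) := List.countP_pos_iff.2 ⟨a, ha, by simp; omega⟩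
        omega
    choose f g hfm hgm hfg hS using
      fun S : Submodule (SkewPolynomial k) (PhiModule P) => exists_factor hP S
    rw [encard_factorizations_eq_sum hP hP1 hfm hgm hfg hS
      (Finset.univ.filter fun S => IsSimpleModule (SkewPolynomial k) S) (by simp)]
    let F : (Σ _ : ι, ℕ) → ℕ := fun c =>
      predicted (fun l => Nat.card (fixedField k) ^ (N l).natDegree)
        (Function.update T c.1 (lower (T c.1) c.2))
    let At : Submodule (SkewPolynomial k) (PhiModule P) → (Σ _ : ι, ℕ) → Prop := fun S c =>
      c.2 ∈ admissibleCells (T c.1) ∧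
        S ≤ layer (PhiModule P) (N c.1) ((T c.1).getD c.2 0 - 1) ∧
        ¬ S ≤ layer (PhiModule P) (N c.1) ((T c.1).getD c.2 0)
    have hex : ∀ S : Submodule (SkewPolynomial k) (PhiModule P), ∃ c,
        IsSimpleModule (SkewPolynomial k) S → At S c := by
      intro S
      by_cases hSs : IsSimpleModule (SkewPolynomial k) S
      · obtain ⟨l, i, h1, h2⟩ := h.exists_cell hT S
        exact ⟨⟨l, i⟩, fun _ => ⟨h1, h2⟩⟩
      · have hne : Nonempty ι := by
          by_contra hne
          have := not_nonempty_iff.1 hne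
          simp at hn
        -- An arbitrary cell for submodules that are not simple, so that the choice function is
        -- total.
        exact ⟨⟨hne.some, 0⟩, fun h => absurd h hSs⟩
    choose cell hcell using hex
    have huniq : ∀ S : Submodule (SkewPolynomial k) (PhiModule P), IsSimpleModule (SkewPolynomial k) S → ∀ c, At S c → cell S = c := by
      intro S hSs c hc
      have hc' := hcell S hSs
      generalize cell S = c' at hc'
      obtain ⟨l, i⟩ := c
      obtain ⟨l', i'⟩ := c'
      obtain ⟨h1, h2, h3⟩ := hc
      obtain ⟨h1', h2', h3'⟩ := hc'
      simp only at h1 h2 h3 h1' h2' h3'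
      have hl : l' = l := by
        by_contra hl
        have hk : S ≤ LinearMap.ker (zetaEnd _ (N l)) := h2.trans inf_le_left
        have hk' : S ≤ LinearMap.ker (zetaEnd _ (N l')) := h2'.trans inf_le_left
        obtain ⟨u, v, huv⟩ := isCoprime_of_ne (hmonic l') (hN l') (hmonic l) (hN l)
          fun he => hl (hinj he)
        refine (isSimpleModule_iff_isAtom.1 hSs).1 ((Submodule.eq_bot_iff _).2 fun s hs => ?_)
        rw [← one_smul (SkewPolynomial k) s, ← map_one (zeta k), ← huv, map_add, add_smul,
          map_mul, map_mul, mul_smul, mul_smul, show zeta k (N l) • s = 0 from hk hs,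
          show zeta k (N l') • s = 0 from hk' hs, smul_zero, smul_zero, add_zero]
      subst hl
      have hpos := ((hT l').mem_admissibleCells.1 h1)
      have hpos' := ((hT l').mem_admissibleCells.1 h1')
      have hv : (T l').getD i 0 = (T l').getD i' 0 := by
        rcases lt_trichotomy ((T l').getD i 0) ((T l').getD i' 0) with hlt | heq | hgt
        · exact absurd (h2'.trans (layer_anti (N l') (by omega))) h3
        · exact heq
        · exact absurd (h2.trans (layer_anti (N l') (by omega))) h3'
      have : i' = i := by
        have h4 := hpos.2
        have h5 := hpos'.2
        rw [hv] at h4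
        omega
      rw [this]
    have hterm : ∀ S ∈ Finset.univ.filter fun S : Submodule (SkewPolynomial k) (PhiModule P) =>
        IsSimpleModule (SkewPolynomial k) S,
        (factorizations (g S)).encard = ((F (cell S) : ℕ) : ℕ∞) := by
      intro S hSs
      rw [Finset.mem_filter_univ] at hSs
      obtain ⟨h1, h2, h3⟩ := hcell S hSs
      generalize cell S = c at h1 h2 h3
      obtain ⟨l, i⟩ := c
      simp only at h1 h2 h3
      have e : (PhiModule P ⧸ S) ≃ₗ[SkewPolynomial k] PhiModule (g S) :=
        (Submodule.quotEquivOfEq _ _ (hS S)).trans (quotientSubOfEquiv (hfg S))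
      have hq := h.quotient hT hmonic hN hinj hD S h1 h2 h3
      refine ih (fun l' => ?_) (hgm S) ((hD.quotient S).congr e) (hq.congr e) ?_
      · by_cases hl : l' = l
        · subst hl
          rw [Function.update_self]
          exact (hT l').lower h1
        · rw [Function.update_of_ne hl]
          exact hT l'
      · have h4 := Finset.add_sum_erase Finset.univ (fun l => (T l).sum) (Finset.mem_univ l)
        have h5 := Finset.add_sum_erase Finset.univ
          (fun l' => (Function.update T l (lower (T l) i) l').sum) (Finset.mem_univ l)
        have h6 : ∑ l' ∈ Finset.univ.erase l, (Function.update T l (lower (T l) i) l').sum =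
            ∑ l' ∈ Finset.univ.erase l, (T l').sum := Finset.sum_congr rfl fun l' hl' => by
          rw [Function.update_of_ne (Finset.ne_of_mem_erase hl')]
        have h7 := sum_lower (hT l) h1
        rw [h6, Function.update_self] at h5
        change ∑ l', (Function.update T l (lower (T l) i) l').sum = n
        omega
    rw [Finset.sum_congr rfl hterm, ← Nat.cast_sum, Nat.cast_inj,
      predicted_eq _ hT (by omega), ← Finset.sum_sigma Finset.univ
        (fun l => admissibleCells (T l)) (fun c => pathWeight
        (Nat.card (fixedField k) ^ (N c.1).natDegree) (T c.1) c.2 * F c),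
      ← Finset.sum_fiberwise_of_maps_to (g := cell)
        (t := Finset.univ.sigma fun l => admissibleCells (T l)) (fun S hSs => by
          rw [Finset.mem_filter_univ] at hSs
          rw [Finset.mem_sigma]
          exact ⟨Finset.mem_univ _, (hcell S hSs).1⟩)]
    refine Finset.sum_congr rfl fun c hc => ?_
    obtain ⟨l, i⟩ := c
    have hi := (Finset.mem_sigma.1 hc).2
    rw [Finset.sum_congr rfl fun S hSs => by rw [(Finset.mem_filter.1 hSs).2], Finset.sum_const,
      smul_eq_mul]
    congr 1
    rw [← h.natCard_simple hT hmonic hN hD hi, Nat.card_eq_fintype_card, Fintype.card_subtype,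
      Finset.filter_filter]
    congr 1
    ext S
    simp only [Finset.mem_filter_univ]
    constructor
    · rintro ⟨h1, h2⟩
      have := hcell S h1
      rw [h2] at this
      exact ⟨h1, this.2⟩
    · rintro ⟨h1, h2⟩
      exact ⟨h1, huniq S h1 ⟨l, i⟩ ⟨hi, h2⟩⟩

end Main

/-! ## Jordan blocks -/

section Jordan

/-- Linear maps that intertwine two endomorphisms intertwine their polynomials. -/
theorem map_aeval_apply_of_map_apply {F V W : Type*} [Field F] [AddCommGroup V] [Module F V]
    [AddCommGroup W] [Module F W] {φ : V →ₗ[F] W} {T : Module.End F V} {T' : Module.End F W}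
    (h : ∀ v, φ (T v) = T' (φ v)) (f : F[X]) (v : V) :
    φ (aeval T f v) = aeval T' f (φ v) := by
  induction f using Polynomial.induction_on' with
  | add p q hp hq => simp [hp, hq]
  | monomial n a =>
    rw [aeval_monomial, aeval_monomial, Module.End.mul_apply, Module.End.mul_apply,
      Module.algebraMap_end_apply, Module.algebraMap_end_apply, map_smul]
    congr 1
    induction n with
    | zero => simp
    | succ n ih => rw [pow_succ', pow_succ', Module.End.mul_apply, Module.End.mul_apply, h, ih]

/-- If `N` is separable and `N(x) = 0`, then `N(x + s)` is associated to `s` for `s` nilpotent. -/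
theorem exists_isUnit_aeval_add {F C : Type*} [Field F] [CommRing C] [Algebra F C] {N : F[X]}
    (hN : N.Separable) {x s : C} (hx : aeval x N = 0) (hs : IsNilpotent s) :
    ∃ u : C, IsUnit u ∧ aeval (x + s) N = s * u := by
  -- Taylor: `N(x + s) = N(x) + N'(x) s + c s²`. Separability makes `N'(x)` a unit, and adding the
  -- nilpotent `c s` keeps it one.
  obtain ⟨c, hc⟩ := binomExpansion (N.map (algebraMap F C)) x s
  rw [derivative_map, eval_map_algebraMap, eval_map_algebraMap, eval_map_algebraMap, hx,
    zero_add] at hc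
  refine ⟨aeval x (derivative N) + c * s, ?_, by rw [hc]; ring⟩
  obtain ⟨a, b, hab⟩ := hN
  have h1 := congrArg (aeval x) hab
  rw [map_add, map_mul, map_mul, hx, mul_zero, zero_add, map_one] at h1
  exact IsNilpotent.isUnit_add_left_of_commute ((Commute.all c s).isNilpotent_mul_left hs)
    (IsUnit.of_mul_eq_one_right _ h1) (Commute.all _ _)

theorem exists_isUnit_aeval_add_of_commute {F C : Type*} [Field F] [Ring C] [Algebra F C]
    {N : F[X]} (hN : N.Separable) {x s : C} (hx : aeval x N = 0) (hs : IsNilpotent s)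
    (h : Commute x s) : ∃ u : C, IsUnit u ∧ Commute s u ∧ aeval (x + s) N = s * u := by
  -- The commutative case is applied in the subalgebra generated by `x` and `s`.
  have := Algebra.isMulCommutative_adjoin F (s := {x, s}) (by
    rintro a (rfl | rfl) b (rfl | rfl)
    · rfl
    · exact h
    · exact h.symm
    · rfl)
  let _ : CommRing (Algebra.adjoin F {x, s}) :=
    { (inferInstance : Ring (Algebra.adjoin F {x, s})) with
      mul_comm := IsMulCommutative.is_comm.comm }
  let x' : Algebra.adjoin F {x, s} := ⟨x, Algebra.subset_adjoin (by simp)⟩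
  let s' : Algebra.adjoin F {x, s} := ⟨s, Algebra.subset_adjoin (by simp)⟩
  have hx' : aeval x' N = 0 := Subtype.ext (by
    have := aeval_algHom_apply (Algebra.adjoin F {x, s}).val x' N
    exact this.symm.trans hx)
  have hs' : IsNilpotent s' := by
    obtain ⟨n, hn⟩ := hs
    exact ⟨n, Subtype.ext hn⟩
  obtain ⟨u, hu, hus⟩ := exists_isUnit_aeval_add hN hx' hs'
  refine ⟨u, hu.map (Algebra.adjoin F {x, s}).val, congrArg Subtype.val (mul_comm s' u), ?_⟩
  have h2 := aeval_algHom_apply (Algebra.adjoin F {x, s}).val (x' + s') N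
  rw [hus] at h2
  exact h2

variable {F : Type*} [Field F] {δ : ℕ} (A : Matrix (Fin δ) (Fin δ) F) (a : ℕ)

/-- The block diagonal part of a Jordan block. -/
def diagPart : Module.End F (Fin a × Fin δ → F) where
  toFun v p := (A.mulVec fun q => v (p.1, q)) p.2
  map_add' v w := by
    ext p
    exact congrFun (A.mulVec_add (fun q => v (p.1, q)) (fun q => w (p.1, q))) p.2
  map_smul' c v := by
    ext p
    exact congrFun (A.mulVec_smul c (fun q => v (p.1, q))) p.2

variable (F δ) in
/-- The nilpotent part of a Jordan block, to the power `j`. -/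
def shift (j : ℕ) : Module.End F (Fin a × Fin δ → F) where
  toFun v p := if h : (p.1 : ℕ) + j < a then v (⟨p.1 + j, h⟩, p.2) else 0
  map_add' v w := by
    ext p
    by_cases h : (p.1 : ℕ) + j < a <;> simp [h]
  map_smul' c v := by
    ext p
    by_cases h : (p.1 : ℕ) + j < a <;> simp [h]

theorem shift_apply (j : ℕ) (v : Fin a × Fin δ → F) (p : Fin a × Fin δ) :
    shift F δ a j v p = if h : (p.1 : ℕ) + j < a then v (⟨p.1 + j, h⟩, p.2) else 0 := rfl

theorem diagPart_apply (v : Fin a × Fin δ → F) (p : Fin a × Fin δ) :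
    diagPart A a v p = (A.mulVec fun q => v (p.1, q)) p.2 := rfl

theorem shift_pow (j : ℕ) : shift F δ a 1 ^ j = shift F δ a j := by
  induction j with
  | zero => ext v p; simp [shift_apply]
  | succ j ih =>
    refine LinearMap.ext fun v => funext fun p => ?_
    rw [pow_succ', Module.End.mul_apply, ih, shift_apply, shift_apply]
    by_cases h : (p.1 : ℕ) + (j + 1) < a
    · rw [dif_pos (by omega), dif_pos h, shift_apply, dif_pos (by simp; omega)]
      congr 3
      simp; omega
    · rw [dif_neg h]
      by_cases h1 : (p.1 : ℕ) + 1 < a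
      · rw [dif_pos h1, shift_apply, dif_neg (by simp; omega)]
      · rw [dif_neg h1]

theorem commute_diagPart_shift : Commute (diagPart A a) (shift F δ a 1) := by
  refine LinearMap.ext fun v => funext fun p => ?_
  rw [Module.End.mul_apply, Module.End.mul_apply, shift_apply, diagPart_apply]
  by_cases h : (p.1 : ℕ) + 1 < a
  · rw [dif_pos h, diagPart_apply]
    congr 2
    ext q
    rw [shift_apply, dif_pos h]
  · rw [dif_neg h]
    have : (fun q => shift F δ a 1 v (p.1, q)) = 0 := by
      ext q
      rw [shift_apply, dif_neg h]
      rfl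
    rw [this, Matrix.mulVec_zero]
    rfl

theorem toLin'_jordanBlock :
    Matrix.toLin' (jordanBlock A a) = diagPart A a + shift F δ a 1 := by
  refine LinearMap.ext fun v => funext fun p => ?_
  obtain ⟨p, q⟩ := p
  rw [Matrix.toLin'_apply, LinearMap.add_apply, Pi.add_apply, diagPart_apply, shift_apply,
    Matrix.mulVec, dotProduct, Fintype.sum_prod_type]
  have hterm : ∀ p' : Fin a, (∑ q', jordanBlock A a (p, q) (p', q') * v (p', q')) =
      (if p' = p then (A.mulVec fun q' => v (p, q')) q else 0) +
        (if (p : ℕ) + 1 = p' then v (p', q) else 0) := by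
    intro p'
    by_cases h1 : p' = p
    · subst h1
      simp [jordanBlock, Matrix.mulVec, dotProduct]
    · by_cases h2 : (p : ℕ) + 1 = p'
      · simp [jordanBlock, h1, Ne.symm h1, h2, Matrix.one_apply]
      · simp [jordanBlock, h1, Ne.symm h1, h2]
  rw [Finset.sum_congr rfl fun p' _ => hterm p', Finset.sum_add_distrib,
    Finset.sum_ite_eq' Finset.univ p, if_pos (Finset.mem_univ _)]
  congr 1
  by_cases h : (p : ℕ) + 1 < a
  · rw [dif_pos h, Finset.sum_eq_single ⟨p + 1, h⟩]
    · simp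
    · intro p' _ hp'
      rw [if_neg fun he => hp' (Fin.ext he.symm)]
    · simp
  · rw [dif_neg h]
    exact Finset.sum_eq_zero fun p' _ => if_neg fun he => h (by omega)

theorem aeval_diagPart_charpoly : aeval (diagPart A a) A.charpoly = 0 := by
  refine LinearMap.ext fun v => funext fun p => ?_
  let φ : (Fin a × Fin δ → F) →ₗ[F] (Fin δ → F) := LinearMap.funLeft F F fun q => (p.1, q)
  have h := map_aeval_apply_of_map_apply (φ := φ) (T := diagPart A a) (T' := Matrix.toLin' A)
    (fun v => rfl) A.charpoly v
  have h2 : aeval (Matrix.toLin' A) A.charpoly = 0 := by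
    have := aeval_algHom_apply (Matrix.toLinAlgEquiv' (R := F) (n := Fin δ)) A A.charpoly
    rw [Matrix.aeval_self_charpoly, map_zero] at this
    exact this
  rw [h2] at h
  exact congrFun h p.2

/-- The kernel consists of the vectors supported on the first `min a j` slots. -/
theorem finrank_ker_shift (j : ℕ) :
    Module.finrank F (LinearMap.ker (shift F δ a j)) = δ * min a j := by
  let e : LinearMap.ker (shift F δ a j) ≃ₗ[F] (Fin (min a j) × Fin δ → F) :=
    { toFun v p := v.1 (⟨p.1, by omega⟩, p.2)
      map_add' v w := rfl
      map_smul' c v := rfl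
      invFun w := ⟨fun p => if h : (p.1 : ℕ) < min a j then w (⟨p.1, h⟩, p.2) else 0, by
        refine funext fun p => ?_
        rw [shift_apply]
        by_cases h1 : (p.1 : ℕ) + j < a
        · rw [dif_pos h1, dif_neg (by simp)]
          rfl
        · rw [dif_neg h1]
          rfl⟩
      left_inv v := by
        refine Subtype.ext (funext fun p => ?_)
        simp only
        split_ifs with h
        · rfl
        · have h1 := congrFun (LinearMap.mem_ker.1 v.2) (⟨p.1 - j, by omega⟩, p.2)
          rw [shift_apply, dif_pos (by simp; omega)] at h1
          refine h1.symm.trans ?_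
          have : p = (⟨p.1 - j + j, by omega⟩, p.2) := Prod.ext (Fin.ext (by simp; omega)) rfl
          conv_rhs => rw [this]
      right_inv w := by
        refine funext fun p => ?_
        exact dif_pos p.1.2 }
  rw [e.finrank_eq, Module.finrank_fintype_fun_eq_card, Fintype.card_prod, Fintype.card_fin,
    Fintype.card_fin, mul_comm]

/-- The block diagonal part is a root of `N` by Cayley–Hamilton, and the shift is a commuting
nilpotent. So powers of `N` at the block have the kernels of powers of the shift. -/
theorem exists_aeval_jordanBlock {N : F[X]} (hA : A.charpoly = N) (hN : N.Separable) :
    ∃ u : Module.End F (Fin a × Fin δ → F), IsUnit u ∧ Commute (shift F δ a 1) u ∧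
      aeval (Matrix.toLin' (jordanBlock A a)) N = shift F δ a 1 * u := by
  rw [toLin'_jordanBlock]
  refine exists_isUnit_aeval_add_of_commute hN (hA ▸ aeval_diagPart_charpoly A a) ⟨a, ?_⟩
    (commute_diagPart_shift A a)
  rw [shift_pow]
  refine LinearMap.ext fun v => funext fun p => ?_
  rw [shift_apply, dif_neg (by omega)]
  rfl

theorem aeval_jordanBlock_pow_eq_zero {N : F[X]} (hA : A.charpoly = N) (hN : N.Separable) :
    aeval (Matrix.toLin' (jordanBlock A a)) (N ^ a) = 0 := by
  obtain ⟨u, hu, hc, h⟩ := exists_aeval_jordanBlock A a hA hN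
  rw [map_pow, h, hc.mul_pow, shift_pow]
  refine LinearMap.ext fun v => funext fun p => ?_
  rw [Module.End.mul_apply, shift_apply, dif_neg (by omega)]
  rfl

theorem finrank_ker_aeval_jordanBlock {N : F[X]} (hA : A.charpoly = N) (hN : N.Separable)
    (j : ℕ) : Module.finrank F (LinearMap.ker (aeval (Matrix.toLin' (jordanBlock A a)) (N ^ j))) =
      δ * min a j := by
  obtain ⟨u, hu, hc, h⟩ := exists_aeval_jordanBlock A a hA hN
  have hk : LinearMap.ker (aeval (Matrix.toLin' (jordanBlock A a)) (N ^ j)) =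
      LinearMap.ker (shift F δ a j) := by
    rw [map_pow, h, hc.mul_pow, shift_pow, ← shift_pow, (hc.pow_pow j j).eq]
    obtain ⟨w, hw⟩ := (hu.pow j).exists_left_inv
    ext v
    rw [LinearMap.mem_ker, LinearMap.mem_ker, Module.End.mul_apply]
    refine ⟨fun h0 => ?_, fun h0 => by rw [h0, map_zero]⟩
    have := congrArg w h0
    rwa [map_zero, ← Module.End.mul_apply, hw, Module.End.one_apply] at this
  rw [hk, finrank_ker_shift]

theorem ker_aeval_eq_bot_of_isCoprime {V : Type*} [AddCommGroup V] [Module F V]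
    {T : Module.End F V} {f g : F[X]} (hg : aeval T g = 0) (h : IsCoprime f g) :
    LinearMap.ker (aeval T f) = ⊥ := by
  obtain ⟨u, v, huv⟩ := h
  rw [LinearMap.ker_eq_bot']
  intro m hm
  have := congrArg (fun p => aeval T p m) huv
  simpa [hg, hm] using this.symm

end Jordan

/-! ## The invariants of a module of a given type -/

section BlockDiagonal

variable {F V : Type*} [Field F] [AddCommGroup V] [Module F V] {ι : Type*} {κ : ι → Type*}

/-- The coordinates in one block. -/
def blockCoord (b : Module.Basis (Σ i, κ i) F V) (i : ι) : V →ₗ[F] (κ i → F) where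
  toFun v x := b.repr v ⟨i, x⟩
  map_add' v w := by ext x; simp
  map_smul' c v := by ext x; simp

theorem blockCoord_apply (b : Module.Basis (Σ i, κ i) F V) (i : ι) (v : V) (x : κ i) :
    blockCoord b i v x = b.repr v ⟨i, x⟩ := rfl

theorem eq_zero_of_blockCoord_eq_zero {b : Module.Basis (Σ i, κ i) F V} {v : V}
    (h : ∀ i, blockCoord b i v = 0) : v = 0 := by
  rw [← b.repr.map_eq_zero_iff]
  ext ⟨i, x⟩
  exact congrFun (h i) x

variable [Fintype ι] [DecidableEq ι] [∀ i, Fintype (κ i)] [∀ i, DecidableEq (κ i)]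

theorem blockCoord_map {b : Module.Basis (Σ i, κ i) F V} {T : Module.End F V}
    {J : ∀ i, Matrix (κ i) (κ i) F} (h : LinearMap.toMatrix b b T = Matrix.blockDiagonal' J)
    (i : ι) (v : V) : blockCoord b i (T v) = Matrix.toLin' (J i) (blockCoord b i v) := by
  ext x
  have h1 := congrFun (LinearMap.toMatrix_mulVec_repr b b T v) ⟨i, x⟩
  rw [blockCoord_apply, ← h1, h, Matrix.mulVec, dotProduct, Fintype.sum_sigma,
    Finset.sum_eq_single i, Matrix.toLin'_apply, Matrix.mulVec, dotProduct]
  · refine Finset.sum_congr rfl fun y _ => ?_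
    rw [Matrix.blockDiagonal'_apply_eq, blockCoord_apply]
  · intro j _ hj
    refine Finset.sum_eq_zero fun y _ => ?_
    rw [Matrix.blockDiagonal'_apply_ne _ _ _ hj.symm, zero_mul]
  · simp

theorem finrank_ker_aeval_of_blockDiagonal' {b : Module.Basis (Σ i, κ i) F V}
    {T : Module.End F V} {J : ∀ i, Matrix (κ i) (κ i) F}
    (h : LinearMap.toMatrix b b T = Matrix.blockDiagonal' J) (f : F[X]) :
    Module.finrank F (LinearMap.ker (aeval T f)) =
      ∑ i, Module.finrank F (LinearMap.ker (aeval (Matrix.toLin' (J i)) f)) := by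
  have hmap : ∀ i v, blockCoord b i (aeval T f v) =
      aeval (Matrix.toLin' (J i)) f (blockCoord b i v) := fun i v =>
    map_aeval_apply_of_map_apply (blockCoord_map h i) f v
  let e : LinearMap.ker (aeval T f) →ₗ[F] ∀ i, LinearMap.ker (aeval (Matrix.toLin' (J i)) f) :=
    { toFun v i := ⟨blockCoord b i v, by
        rw [LinearMap.mem_ker, ← hmap, LinearMap.mem_ker.1 v.2, map_zero]⟩
      map_add' v w := by ext i : 2; exact map_add _ _ _
      map_smul' c v := by ext i : 2; exact map_smul _ _ _ }
  rw [← Module.finrank_pi_fintype]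
  refine (LinearEquiv.ofBijective e ⟨?_, ?_⟩).finrank_eq
  · refine (injective_iff_map_eq_zero e).2 fun v hv => Subtype.ext ?_
    exact eq_zero_of_blockCoord_eq_zero (b := b) fun i => congrArg Subtype.val (congrFun hv i)
  · intro w
    let v : V := b.equivFun.symm fun p => (w p.1 : κ p.1 → F) p.2
    have hv : ∀ i, blockCoord b i v = w i := by
      intro i
      ext x
      rw [blockCoord_apply, ← Module.Basis.equivFun_apply, LinearEquiv.apply_symm_apply]
    refine ⟨⟨v, ?_⟩, ?_⟩
    · rw [LinearMap.mem_ker]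
      refine eq_zero_of_blockCoord_eq_zero (b := b) fun i => ?_
      rw [hmap, hv]
      exact (w i).2
    · ext i : 2
      exact hv i

end BlockDiagonal

section HasType

variable {k : Type*} [Field k] [MulSemiringAction (Multiplicative ℕ) k]

theorem jordanBlock_map {K L : Type*} [Field K] [Field L] (f : K →+* L) {δ : ℕ}
    (A : Matrix (Fin δ) (Fin δ) K) (a : ℕ) :
    (jordanBlock A a).map f = jordanBlock (A.map f) a := by
  ext x y
  rw [Matrix.map_apply, jordanBlock, jordanBlock]
  split_ifs
  · rfl
  · rw [Matrix.one_apply, Matrix.one_apply]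
    split_ifs <;> simp
  · simp

theorem phi_iterate (P : SkewPolynomial k) (n : ℕ) (m : PhiModule P) :
    (phi P)^[n] m = (SkewPolynomial.X : SkewPolynomial k) ^ n • m := by
  induction n with
  | zero => simp
  | succ n ih => rw [Function.iterate_succ_apply', ih, pow_succ', mul_smul]; rfl

theorem phiPow_eq (P : SkewPolynomial k) : phiPow P = rhoEnd (PhiModule P) (X : k[X]) := by
  refine LinearMap.ext fun m => ?_
  exact (phi_iterate P (sigmaOrder k) m).trans (by rw [rhoEnd_apply, rho_X])

theorem finrank_ker_zetaEnd {D : Type*} [AddCommGroup D] [Module (SkewPolynomial k) D]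
    [Module k D] [IsScalarTower k (SkewPolynomial k) D] (f : (fixedField k)[X]) :
    Module.finrank k (LinearMap.ker (zetaEnd D f)) =
      Module.finrank k (LinearMap.ker (aeval (rhoEnd D (X : k[X]))
        (f.map (fixedField k).subtype))) := by
  rw [aeval_rhoEnd_X]
  rfl

variable [Finite k]

/-- Kernel dimensions add over blocks. A block of size `a` and class `N l` contributes `δ · min a j`
to the kernel of `N l ^ j`; any other class is coprime to the power killing the block and
contributes nothing. -/
theorem hasTables_of_hasType {P : SkewPolynomial k} {t : JordanType (fixedField k)}
    (h : HasType P t) : HasTables (PhiModule P) t.N t.T := by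
  obtain ⟨A, hA, b, hb⟩ := h
  rw [phiPow_eq, Matrix.blockDiagonal'_map _ _ (map_zero _)] at hb
  have hb' : LinearMap.toMatrix b b (rhoEnd (PhiModule P) (X : k[X])) =
      Matrix.blockDiagonal' fun i => jordanBlock ((A i).map (fixedField k).subtype)
        (t.size i) := by
    rw [hb]
    congr 1
    ext i : 1
    exact jordanBlock_map _ _ _
  have hchar : ∀ i, ((A i).map (fixedField k).subtype).charpoly =
      (t.N i.1).map (fixedField k).subtype := fun i => by
    rw [← hA i, Matrix.charpoly_map]
  have hsep : ∀ l, ((t.N l).map (fixedField k).subtype).Separable := fun l =>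
    separable_map_of_irreducible (t.irreducible l)
  have hcop : ∀ (M : (fixedField k)[X]) (i : t.Block), IsCoprime M (t.N i.1) → ∀ j,
      LinearMap.ker (aeval (Matrix.toLin' (jordanBlock ((A i).map (fixedField k).subtype)
        (t.size i))) ((M ^ j).map (fixedField k).subtype)) = ⊥ := by
    intro M i hM j
    refine ker_aeval_eq_bot_of_isCoprime
      (aeval_jordanBlock_pow_eq_zero _ (t.size i) (hchar i) (hsep i.1)) ?_
    rw [← Polynomial.map_pow]
    exact (hM.pow (m := j) (n := t.size i)).map (mapRingHom (fixedField k).subtype)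
  constructor
  · intro l j
    rw [finrank_ker_zetaEnd, finrank_ker_aeval_of_blockDiagonal' hb', Fintype.sum_sigma,
      Finset.sum_eq_single l]
    · have hsum : ((t.T l).map (min · j)).sum =
          ∑ c : Fin (t.T l).length, min ((t.T l).get c) j := by
        conv_lhs => rw [← List.ofFn_get (l := t.T l), List.map_ofFn, List.sum_ofFn]
        rfl
      rw [hsum, Finset.mul_sum]
      refine Finset.sum_congr rfl fun c _ => ?_
      rw [Polynomial.map_pow]
      exact finrank_ker_aeval_jordanBlock _ _ (hchar ⟨l, c⟩) (hsep l) j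
    · intro l' _ hl
      refine Finset.sum_eq_zero fun c _ => ?_
      rw [hcop _ _ (isCoprime_of_ne (t.monic l) (t.irreducible l) (t.monic l') (t.irreducible l')
        fun he => hl (t.injective he).symm), finrank_bot]
    · simp
  · intro M hM hM' hne
    have h0 : Module.finrank k ((LinearMap.ker (zetaEnd (PhiModule P) M)).restrictScalars k) = 0 := by
      change Module.finrank k (LinearMap.ker (zetaEnd (PhiModule P) M)) = 0
      rw [finrank_ker_zetaEnd, finrank_ker_aeval_of_blockDiagonal' hb']
      refine Finset.sum_eq_zero fun i _ => ?_
      have := hcop M i (isCoprime_of_ne hM hM' (t.monic i.1) (t.irreducible i.1) (hne i.1)) 1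
      rw [pow_one] at this
      rw [this, finrank_bot]
    have := Module.Finite.of_basis b
    have := Submodule.finrank_eq_zero.1 h0
    rwa [Submodule.restrictScalars_eq_bot_iff] at this

end HasType

/-! ## Twisted norms and forms over the fixed field -/

section TwistedNorm

variable {k : Type*} [Field k] [MulSemiringAction (Multiplicative ℕ) k]

/-- The product of the conjugates of `v` by the powers of `σ`. -/
def twistedNorm (v : k[X]) : k[X] :=
  ∏ i ∈ Finset.range (sigmaOrder k), v.map (sigma k ^ i)

theorem map_sigma_pow_succ (v : k[X]) (i : ℕ) :
    v.map (sigma k ^ (i + 1)) = (v.map (sigma k ^ i)).map (sigma k) := by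
  rw [Polynomial.map_map, pow_succ']
  rfl

theorem map_sigma_pow_eq {f : k[X]} (h : f.map (sigma k) = f) (i : ℕ) :
    f.map (sigma k ^ i) = f := by
  induction i with
  | zero => rw [pow_zero]; exact Polynomial.map_id
  | succ i ih => rw [map_sigma_pow_succ, ih, h]

theorem twistedNorm_map_sigma [Finite k] (v : k[X]) :
    (twistedNorm v).map (sigma k) = twistedNorm v := by
  obtain ⟨n, hn⟩ := Nat.exists_eq_succ_of_ne_zero (sigmaOrder_pos (k := k)).ne'
  have h1 : v.map (sigma k ^ (n + 1)) = v := by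
    rw [← Nat.succ_eq_add_one, ← hn, sigmaOrder, pow_orderOf_eq_one]
    exact Polynomial.map_id
  rw [twistedNorm, Polynomial.map_prod, hn, Finset.prod_range_succ]
  simp only [← map_sigma_pow_succ]
  rw [Finset.prod_range_succ', h1, pow_zero]
  congr 1
  exact Polynomial.map_id.symm

theorem X_pow_mul_rho (n : ℕ) (f : k[X]) :
    (SkewPolynomial.X : SkewPolynomial k) ^ n * rho k f =
      rho k (f.map (sigma k ^ n)) * SkewPolynomial.X ^ n := by
  induction n with
  | zero =>
    rw [pow_zero, pow_zero, one_mul, mul_one]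
    congr 1
    exact Polynomial.map_id.symm
  | succ n ih =>
    rw [pow_succ' SkewPolynomial.X, mul_assoc, ih, ← mul_assoc, X_mul_rho, mul_assoc,
      map_sigma_pow_succ]

theorem rho_mul_X_pow (v : k[X]) (n : ℕ) :
    (rho k v * SkewPolynomial.X) ^ n =
      rho k (∏ i ∈ Finset.range n, v.map (sigma k ^ i)) * SkewPolynomial.X ^ n := by
  induction n with
  | zero => simp
  | succ n ih =>
    rw [pow_succ, ih, Finset.prod_range_succ, map_mul, pow_succ SkewPolynomial.X, mul_assoc,
      mul_assoc, ← mul_assoc (_ ^ n), X_pow_mul_rho, mul_assoc]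

/-- Why norms appear: `v X` acts with `r`-th power the identity as soon as the norm of `v`, times
`Y`, is `1` modulo the annihilator. -/
theorem rho_mul_X_pow_sigmaOrder (v : k[X]) :
    (rho k v * SkewPolynomial.X) ^ sigmaOrder k = rho k (twistedNorm v * X) := by
  rw [rho_mul_X_pow, map_mul, rho_X, twistedNorm]

theorem dvd_twistedNorm_sub {f v w : k[X]} (hf : f.map (sigma k) = f) (h : f ∣ v - w) :
    f ∣ twistedNorm v - twistedNorm w := by
  rw [← Ideal.mem_span_singleton, ← Ideal.Quotient.eq, twistedNorm, twistedNorm, map_prod,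
    map_prod]
  refine Finset.prod_congr rfl fun i _ => ?_
  rw [Ideal.Quotient.eq, Ideal.mem_span_singleton, ← Polynomial.map_sub]
  have := Polynomial.map_dvd (sigma k ^ i) h
  rwa [map_sigma_pow_eq hf] at this

theorem sq_dvd_prod_one_sub {R ι : Type*} [CommRing R] (e : R) (x : ι → R) (s : Finset ι) :
    e * e ∣ ∏ i ∈ s, (1 - e * x i) - (1 - e * ∑ i ∈ s, x i) := by
  classical
  induction s using Finset.induction_on with
  | empty => simp
  | insert i s hi ih =>
    obtain ⟨c, hc⟩ := ih
    rw [Finset.prod_insert hi, Finset.sum_insert hi]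
    refine ⟨(1 - e * x i) * c + x i * ∑ i ∈ s, x i, ?_⟩
    linear_combination (1 - e * x i) * hc

/-- The inverse of `Y` is, modulo `m`, the twisted norm of a polynomial. -/
def IsNormModulo (m : (fixedField k)[X]) : Prop :=
  ∃ v : k[X], m.map (fixedField k).subtype ∣ twistedNorm v * X - 1

theorem IsNormModulo.of_dvd {m n : (fixedField k)[X]} (h : IsNormModulo n) (hmn : m ∣ n) :
    IsNormModulo m := by
  obtain ⟨v, hv⟩ := h
  exact ⟨v, (Polynomial.map_dvd _ hmn).trans hv⟩

/-- Chinese remainders: the norm respects congruences modulo `σ`-invariant polynomials, so one glues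
`v` and `w`. -/
theorem IsNormModulo.mul {m n : (fixedField k)[X]} (hm : IsNormModulo m) (hn : IsNormModulo n)
    (h : IsCoprime m n) : IsNormModulo (m * n) := by
  obtain ⟨v, hv⟩ := hm
  obtain ⟨w, hw⟩ := hn
  obtain ⟨a, b, hab⟩ := h
  have hab' := congrArg (Polynomial.map (fixedField k).subtype) hab
  rw [Polynomial.map_add, Polynomial.map_mul, Polynomial.map_mul, Polynomial.map_one] at hab'
  have hcop : IsCoprime (m.map (fixedField k).subtype) (n.map (fixedField k).subtype) :=
    ⟨_, _, hab'⟩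
  set u := v * (b.map (fixedField k).subtype * n.map (fixedField k).subtype) +
    w * (a.map (fixedField k).subtype * m.map (fixedField k).subtype) with hu
  refine ⟨u, ?_⟩
  rw [Polynomial.map_mul]
  refine hcop.mul_dvd ?_ ?_
  · have := dvd_twistedNorm_sub (v := u) (w := v) (map_sigma_map_subtype m)
      ⟨(w - v) * a.map (fixedField k).subtype, by rw [hu]; linear_combination v * hab'⟩
    have := (this.mul_right X).add hv
    rwa [show (twistedNorm u - twistedNorm v) * X + (twistedNorm v * X - 1) =
      twistedNorm u * X - 1 by ring] at this
  · have := dvd_twistedNorm_sub (v := u) (w := w) (map_sigma_map_subtype n)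
      ⟨(v - w) * b.map (fixedField k).subtype, by rw [hu]; linear_combination w * hab'⟩
    have := (this.mul_right X).add hw
    rwa [show (twistedNorm u - twistedNorm w) * X + (twistedNorm w * X - 1) =
      twistedNorm u * X - 1 by ring] at this

theorem twistedNorm_mul (v w : k[X]) : twistedNorm (v * w) = twistedNorm v * twistedNorm w := by
  rw [twistedNorm, twistedNorm, twistedNorm, ← Finset.prod_mul_distrib]
  exact Finset.prod_congr rfl fun i _ => Polynomial.map_mul _

variable [Finite k]

/-- A Newton step. If the norm of `v` times `Y` is `1 + f c`, then `c` is `σ`-invariant. With `α` of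
trace `1`, the factor `1 - f α c` has norm `1 - f c` modulo `f²`, which cancels the error. -/
theorem IsNormModulo.mul_self {m : (fixedField k)[X]} (hm0 : m ≠ 0) (h : IsNormModulo m) :
    IsNormModulo (m * m) := by
  obtain ⟨v, c, hc⟩ := h
  obtain ⟨α, hα⟩ := exists_trace_eq_one (k := k)
  set f := m.map (fixedField k).subtype with hf
  have hf0 : f ≠ 0 := Polynomial.map_ne_zero hm0
  have hcσ : c.map (sigma k) = c := by
    have h1 := congrArg (Polynomial.map (sigma k)) hc
    rw [Polynomial.map_sub, Polynomial.map_mul, Polynomial.map_mul, twistedNorm_map_sigma, map_X,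
      Polynomial.map_one, hc, hf, map_sigma_map_subtype, ← hf] at h1
    exact (mul_left_cancel₀ hf0 h1).symm
  have hnorm : f * f ∣ twistedNorm (1 - f * (C α * c)) - (1 - f * c) := by
    have h1 := sq_dvd_prod_one_sub f (fun i => C ((sigma k ^ i) α) * c)
      (Finset.range (sigmaOrder k))
    rw [← Finset.sum_mul, ← map_sum, hα, map_one, one_mul] at h1
    convert h1 using 2
    refine Finset.prod_congr rfl fun i _ => ?_
    rw [Polynomial.map_sub, Polynomial.map_one, Polynomial.map_mul, Polynomial.map_mul,
      map_sigma_pow_eq hcσ, map_sigma_pow_eq (map_sigma_map_subtype m), map_C]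
  refine ⟨v * (1 - f * (C α * c)), ?_⟩
  obtain ⟨d, hd⟩ := hnorm
  rw [Polynomial.map_mul, twistedNorm_mul]
  refine ⟨twistedNorm v * X * d - c * c, ?_⟩
  linear_combination (1 - f * c) * hc + twistedNorm v * X * hd

theorem IsNormModulo.pow {m : (fixedField k)[X]} (hm0 : m ≠ 0) (h : IsNormModulo m) (j : ℕ) :
    IsNormModulo (m ^ j) := by
  have h2 : ∀ n, IsNormModulo (m ^ 2 ^ n) := by
    intro n
    induction n with
    | zero => simpa using h
    | succ n ih =>
      rw [pow_succ, pow_mul, sq]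
      exact ih.mul_self (pow_ne_zero _ hm0)
  exact (h2 j).of_dvd (pow_dvd_pow _ Nat.lt_two_pow_self.le)

theorem isNormModulo_of_irreducible {m : (fixedField k)[X]} (hm0 : m ≠ 0)
    (h : ∀ p, Irreducible p → p ∣ m → IsNormModulo p) : IsNormModulo m := by
  induction m using UniqueFactorizationMonoid.induction_on_coprime with
  | h0 => exact absurd rfl hm0
  | h1 hu => exact ⟨0, (hu.map (mapRingHom (fixedField k).subtype)).dvd⟩
  | @hpr p i hp =>
    rcases Nat.eq_zero_or_pos i with rfl | hi
    · rw [pow_zero]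
      exact ⟨0, by rw [Polynomial.map_one]; exact one_dvd _⟩
    · exact (h p hp.irreducible (dvd_pow_self p hi.ne')).pow hp.ne_zero i
  | hcp hrel hx hy =>
    refine (hx (left_ne_zero_of_mul hm0) fun p hp hd => h p hp (hd.mul_right _)).mul
      (hy (right_ne_zero_of_mul hm0) fun p hp hd => h p hp (hd.mul_left _)) hrel.isCoprime

end TwistedNorm

section Form

variable {k : Type*} [Field k] [MulSemiringAction (Multiplicative ℕ) k]

/-- Write `s = X g s` with `g ∈ k[X ^ r]`. Then `g^σ X` fixes `s`, hence so does its `r`-th power,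
which is the norm of `g^σ` times `X ^ r`. -/
theorem IsCyclicVector.isNormModulo {S : Type*} [AddCommGroup S] [Module (SkewPolynomial k) S]
    [Module k S] [IsScalarTower k (SkewPolynomial k) S] [Finite S] (hS : XInjective k S) {s : S}
    {m : (fixedField k)[X]} (h : IsCyclicVector s (m.map (fixedField k).subtype)) :
    IsNormModulo m := by
  obtain ⟨t, ht⟩ := hS.bijective.2 s
  obtain ⟨g, rfl⟩ := h.1 t
  have ht' : (rho k (g.map (sigma k)) * SkewPolynomial.X) • s = s := by
    rw [← X_mul_rho, mul_smul]
    exact ht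
  refine ⟨g.map (sigma k), (h.2 _).1 ?_⟩
  rw [map_sub, map_one, ← rho_mul_X_pow_sigmaOrder, sub_smul, one_smul, sub_eq_zero]
  have : ∀ n : ℕ, (rho k (g.map (sigma k)) * SkewPolynomial.X) ^ n • s = s := by
    intro n
    induction n with
    | zero => simp
    | succ n ih => rw [pow_succ, mul_smul, ht', ih]
  exact this _

variable [Finite k] {D : Type*} [AddCommGroup D] [Module (SkewPolynomial k) D] [Module k D]
  [IsScalarTower k (SkewPolynomial k) D] [Finite D]

/-- A polynomial `v` such that `v X` acts with order dividing `r`. -/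
theorem exists_twist (hD : XInjective k D) :
    ∃ v : k[X], ∀ d : D, (rho k v * SkewPolynomial.X) ^ sigmaOrder k • d = d := by
  let I : Ideal (fixedField k)[X] :=
    { carrier := {f | ∀ d : D, zeta k f • d = 0}
      add_mem' := fun {f g} hf hg d => by rw [map_add, add_smul, hf, hg, add_zero]
      zero_mem' := fun d => by rw [map_zero, zero_smul]
      smul_mem' := fun f g hg d => by rw [smul_eq_mul, map_mul, mul_smul, hg, smul_zero] }
  have hI : ∀ f, f ∈ I ↔ ∀ d : D, zeta k f • d = 0 := fun f => Iff.rfl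
  obtain ⟨m, hm⟩ := IsPrincipalIdealRing.principal I
  have hmI : ∀ f, m ∣ f ↔ ∀ d : D, zeta k f • d = 0 := fun f => by
    rw [← hI, hm, ← Ideal.mem_span_singleton]
  have hm0 : m ≠ 0 := by
    rintro rfl
    obtain ⟨f, g, hne, h⟩ := Finite.exists_ne_map_eq_of_infinite
      fun (f : (fixedField k)[X]) (d : D) => zeta k f • d
    refine hne (sub_eq_zero.1 (zero_dvd_iff.1 ((hmI (f - g)).2 fun d => ?_)))
    rw [map_sub, sub_smul, sub_eq_zero]
    exact congrFun h d
  classical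
  obtain ⟨v, hv⟩ := isNormModulo_of_irreducible hm0 fun p hp hpm => by
    wlog hpmonic : p.Monic generalizing p
    · have hass : Associated p (normalize p) := (normalize_associated p).symm
      exact (this (normalize p) (hass.irreducible hp) (hass.symm.dvd.trans hpm)
        (Polynomial.monic_normalize hp.ne_zero)).of_dvd hass.dvd
    -- Otherwise the cofactor `m / p` would already kill `D`. A simple submodule of this kernel then
    -- solves the norm equation modulo `p`.
    have hker : LinearMap.ker (zetaEnd D p) ≠ ⊥ := by
      intro hbot
      obtain ⟨c, rfl⟩ := hpm
      have hc : p * c ∣ c := (hmI c).2 fun d => by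
        refine LinearMap.ker_eq_bot'.1 hbot _ ?_
        rw [zetaEnd_apply, ← mul_smul, ← map_mul]
        exact (hmI (p * c)).1 dvd_rfl d
      have hc0 := right_ne_zero_of_mul hm0
      obtain ⟨d, hd⟩ := hc
      exact hp.not_isUnit (IsUnit.of_mul_eq_one d (mul_left_cancel₀ hc0
        (by linear_combination -hd)))
    obtain ⟨S, hS, hle⟩ := (eq_bot_or_exists_atom_le (LinearMap.ker (zetaEnd D p))).resolve_left hker
    have := isSimpleModule_iff_isAtom.2 hS
    obtain ⟨s, hs⟩ := exists_isCyclicVector_of_isSimpleModule (hD.submodule S) hpmonic hp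
      fun s => Subtype.ext (hle s.2)
    exact hs.isNormModulo (hD.submodule S)
  refine ⟨v, fun d => ?_⟩
  obtain ⟨c, hc⟩ := hv
  rw [rho_mul_X_pow_sigmaOrder, sub_eq_iff_eq_add.1 hc, map_add, map_one, add_smul, one_smul,
    mul_comm, map_mul, mul_smul, ← zeta_apply, (hmI m).1 dvd_rfl, smul_zero, zero_add]

end Form

/-! ## Jordan bases over a field -/

section JordanBasis

variable {F : Type*} [Field F]

theorem exists_charpoly_eq {N : F[X]} (hN : N.Monic) :
    ∃ A : Matrix (Fin N.natDegree) (Fin N.natDegree) F, A.charpoly = N :=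
  ⟨_, (charpoly_leftMulMatrix (AdjoinRoot.powerBasis' hN)).trans (by
    rw [AdjoinRoot.powerBasis'_gen, AdjoinRoot.minpoly_root hN.ne_zero,
      hN.leadingCoeff, inv_one, C_1, mul_one])⟩

/-- The module defined by a Jordan block is cyclic. -/
theorem nonempty_quotient_equiv_jordanBlock {N : F[X]} (hmonic : N.Monic) (hN : Irreducible N)
    (hsep : N.Separable) (A : Matrix (Fin N.natDegree) (Fin N.natDegree) F) (hA : A.charpoly = N)
    {a : ℕ} (ha : a ≠ 0) :
    Nonempty ((F[X] ⧸ Ideal.span {N ^ a}) ≃ₗ[F[X]]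
      Module.AEval' (Matrix.toLin' (jordanBlock A a))) := by
  set T := Matrix.toLin' (jordanBlock A a) with hT
  obtain ⟨b, rfl⟩ := Nat.exists_eq_succ_of_ne_zero ha
  have hkill : aeval T (N ^ (b + 1)) = 0 := aeval_jordanBlock_pow_eq_zero A _ hA hsep
  -- The kernel of `N ^ b` has dimension `δ b < δ (b + 1)`. A vector outside it has annihilator
  -- exactly `N ^ (b + 1)` and generates, by comparing dimensions.
  obtain ⟨x, hx⟩ : ∃ x, aeval T (N ^ b) x ≠ 0 := by
    by_contra! h
    have h1 := finrank_ker_aeval_jordanBlock A (b + 1) hA hsep b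
    have h2 := finrank_ker_aeval_jordanBlock A (b + 1) hA hsep (b + 1)
    rw [← hT, LinearMap.ker_eq_top.2 (LinearMap.ext h)] at h1
    rw [← hT, LinearMap.ker_eq_top.2 hkill, h1, min_eq_right (Nat.le_succ b), min_self] at h2
    have := Nat.eq_of_mul_eq_mul_left hN.natDegree_pos h2
    omega
  have hsmul : ∀ (f : F[X]) (y : Fin (b + 1) × Fin N.natDegree → F),
      f • Module.AEval'.of T y = Module.AEval'.of T (aeval T f y) := fun f y =>
    (Module.AEval.of_aeval_smul T f y).symm
  let φ : F[X] →ₗ[F[X]] Module.AEval' T :=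
    LinearMap.toSpanSingleton F[X] (Module.AEval' T) (Module.AEval'.of T x)
  have hφ : ∀ f, φ f = Module.AEval'.of T (aeval T f x) := fun f => hsmul f x
  have hker : LinearMap.ker φ = Ideal.span {N ^ (b + 1)} := by
    obtain ⟨g, hg⟩ := IsPrincipalIdealRing.principal (LinearMap.ker φ)
    have hmem : ∀ f, g ∣ f ↔ aeval T f x = 0 := fun f => by
      rw [← Ideal.mem_span_singleton, ← (Module.AEval'.of T).map_eq_zero_iff, ← hφ,
        ← LinearMap.mem_ker, hg]
    obtain ⟨i, hi, hass⟩ := (dvd_prime_pow hN.prime (b + 1)).1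
      ((hmem (N ^ (b + 1))).2 (by rw [hkill, LinearMap.zero_apply]))
    obtain rfl : i = b + 1 := by
      by_contra hne
      exact hx ((hmem _).1 (hass.dvd.trans (pow_dvd_pow N (by omega))))
    rw [hg]
    exact Ideal.span_singleton_eq_span_singleton.2 hass
  let e : (F[X] ⧸ Ideal.span {N ^ (b + 1)}) →ₗ[F[X]] Module.AEval' T :=
    Submodule.liftQ _ φ hker.ge
  have hinj : Function.Injective e := by
    rw [← LinearMap.ker_eq_bot, Submodule.ker_liftQ_eq_bot _ _ _ hker.le]
  have hfin : Module.Finite F (F[X] ⧸ Ideal.span {N ^ (b + 1)}) :=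
    (hmonic.pow (b + 1)).finite_quotient
  have hfin' : Module.Finite F (Module.AEval' T) :=
    Module.Finite.equiv (Module.AEval'.of T)
  have hrank : Module.finrank F (F[X] ⧸ Ideal.span {N ^ (b + 1)}) =
      Module.finrank F (Module.AEval' T) := by
    rw [finrank_quotient_span_eq_natDegree, ← (Module.AEval'.of T).finrank_eq, Module.finrank_pi,
      natDegree_pow, Fintype.card_prod, Fintype.card_fin, Fintype.card_fin]
  exact ⟨LinearEquiv.ofBijective e ⟨hinj,
    (LinearMap.injective_iff_surjective_of_finrank_eq_finrank hrank
      (f := e.restrictScalars F)).1 hinj⟩⟩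

/-- A finite family of natural numbers, sorted in decreasing order. -/
theorem exists_sorted_list {α : Type*} [Finite α] (f : α → ℕ) :
    ∃ (T : List ℕ) (e : Fin T.length ≃ α), T.Pairwise (· ≥ ·) ∧ ∀ c, T.get c = f (e c) := by
  obtain ⟨n, ⟨e⟩⟩ := Finite.exists_equiv_fin α
  -- Sorting increasingly in the dual order gives a decreasing list.
  let g : Fin n → ℕᵒᵈ := fun i => OrderDual.toDual (f (e.symm i))
  let s : Fin n ≃ α := (Tuple.sort g).trans e.symm
  refine ⟨List.ofFn (f ∘ s), (finCongr List.length_ofFn).trans s, ?_, fun c => ?_⟩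
  · rw [List.pairwise_ofFn]
    exact fun i j hij => Tuple.monotone_sort g hij.le
  · rw [List.get_ofFn]
    rfl

/-- A family of pairs (monic irreducible polynomial, exponent) is given by a Jordan type. -/
theorem exists_jordanType {ι : Type*} [Finite ι] (N : ι → F[X]) (e : ι → ℕ)
    (hmonic : ∀ i, (N i).Monic) (hN : ∀ i, Irreducible (N i)) (he : ∀ i, e i ≠ 0) :
    ∃ (t : JordanType F) (g : t.Block ≃ ι), ∀ b, t.N b.1 = N (g b) ∧ t.size b = e (g b) := by
  obtain ⟨s, ⟨c⟩⟩ := Finite.exists_equiv_fin (Set.range N)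
  have hfib : ∀ l : Fin s, ∃ (T : List ℕ) (h : Fin T.length ≃
      {i // c (Set.rangeFactorization N i) = l}), T.Pairwise (· ≥ ·) ∧
      ∀ j, T.get j = e (h j) := fun l =>
    exists_sorted_list fun i : {i // c (Set.rangeFactorization N i) = l} => e i
  choose T h hT hTe using hfib
  let t : JordanType F :=
    { s := s
      N := fun l => c.symm l
      T := T
      monic := fun l => by
        obtain ⟨i, hi⟩ := (c.symm l).2
        rw [← hi]
        exact hmonic i
      irreducible := fun l => by
        obtain ⟨i, hi⟩ := (c.symm l).2
        rw [← hi]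
        exact hN i
      injective := Subtype.val_injective.comp c.symm.injective
      isTable := fun l => ⟨hT l, fun a ha => by
        obtain ⟨j, rfl⟩ := List.get_of_mem ha
        rw [hTe]
        exact Nat.one_le_iff_ne_zero.2 (he _)⟩
      ne_nil := fun l hl => by
        obtain ⟨i, hi⟩ := (c.symm l).2
        have j := (h l).symm ⟨i, by
          rw [← Equiv.eq_symm_apply]
          exact Subtype.ext hi⟩
        rw [hl] at j
        exact j.elim0 }
  refine ⟨t, (Equiv.sigmaCongrRight h).trans (Equiv.sigmaFiberEquiv _), fun b => ⟨?_, hTe _ _⟩⟩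
  have := (h b.1 b.2).2
  rw [← Equiv.eq_symm_apply] at this
  exact (congrArg Subtype.val this).symm

theorem toMatrix_eq_blockDiagonal' {V : Type*} [AddCommGroup V] [Module F V] {ι : Type*}
    [Fintype ι] [DecidableEq ι] {κ : ι → Type*} [∀ i, Fintype (κ i)] [∀ i, DecidableEq (κ i)]
    {b : Module.Basis (Σ i, κ i) F V} {T : Module.End F V} {J : ∀ i, Matrix (κ i) (κ i) F}
    (h : ∀ i v, blockCoord b i (T v) = Matrix.toLin' (J i) (blockCoord b i v)) :
    LinearMap.toMatrix b b T = Matrix.blockDiagonal' J := by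
  ext ⟨i, x⟩ ⟨j, y⟩
  rw [LinearMap.toMatrix_apply, ← blockCoord_apply, h]
  by_cases hij : i = j
  · subst hij
    have : blockCoord b i (b ⟨i, y⟩) = Pi.single y 1 := by
      ext z
      rw [blockCoord_apply, b.repr_self, Finsupp.single_apply, Pi.single_apply]
      simp [eq_comm]
    rw [this, Matrix.blockDiagonal'_apply_eq, Matrix.toLin'_apply, Matrix.mulVec_single_one,
      Matrix.col_apply]
  · have : blockCoord b i (b ⟨j, y⟩) = 0 := by
      ext z
      rw [blockCoord_apply, b.repr_self, Finsupp.single_apply, if_neg]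
      · rfl
      · rintro ⟨⟩
        exact hij rfl
    rw [this, map_zero, Matrix.blockDiagonal'_apply_ne _ _ _ hij]
    rfl

end JordanBasis

/-! ## Existence of the type -/

section StructureTheorem

variable {F : Type*} [Field F]

/-- Factors that are zero may be left out of a product. -/
theorem nonempty_pi_equiv_subtype {R ι : Type*} [Semiring R] {M : ι → Type*}
    [∀ i, AddCommMonoid (M i)] [∀ i, Module R (M i)] {p : ι → Prop}
    (h : ∀ i, ¬ p i → Subsingleton (M i)) :
    Nonempty ((∀ i, M i) ≃ₗ[R] ∀ i : {i // p i}, M i) := by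
  classical
  let f : (∀ i, M i) →ₗ[R] ∀ i : {i // p i}, M i := LinearMap.pi fun i => LinearMap.proj i.1
  refine ⟨LinearEquiv.ofBijective f ⟨fun x y hxy => ?_, fun y => ?_⟩⟩
  · ext i
    by_cases hi : p i
    · exact congrFun hxy ⟨i, hi⟩
    · exact (h i hi).elim _ _
  · refine ⟨fun i => if hi : p i then y ⟨i, hi⟩ else 0, ?_⟩
    ext ⟨i, hi⟩
    exact dif_pos hi

/-- The structure theorem, as a product indexed by the blocks of a type. -/
theorem exists_jordanType_quotient_equiv {V : Type*} [AddCommGroup V] [Module F V]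
    [Module.Finite F V] (T : Module.End F V) :
    ∃ t : JordanType F, Nonempty (Module.AEval' T ≃ₗ[F[X]]
      ∀ i : t.Block, F[X] ⧸ Ideal.span {t.N i.1 ^ t.size i}) := by
  classical
  obtain ⟨ι, _, p, hp, e, ⟨E⟩⟩ := Module.equiv_directSum_of_isTorsion
    (Module.AEval.isTorsion_of_finiteDimensional F V T)
  -- The structure theorem allows exponents `0`; these trivial factors are dropped, since table
  -- entries are positive.
  obtain ⟨t, g, hg⟩ := exists_jordanType (ι := {i // e i ≠ 0}) (fun i => normalize (p i))
    (fun i => e i) (fun i => Polynomial.monic_normalize (hp i).ne_zero)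
    (fun i => (normalize_associated (p i)).symm.irreducible (hp i)) fun i => i.2
  obtain ⟨E'⟩ := nonempty_pi_equiv_subtype (R := F[X]) (p := fun i => e i ≠ 0)
    (M := fun i => F[X] ⧸ Ideal.span {p i ^ e i}) fun i hi => by
      rw [not_not.1 hi, pow_zero, Ideal.Quotient.subsingleton_iff, Ideal.span_singleton_one]
  refine ⟨t, ⟨E.trans ((DirectSum.linearEquivFunOnFintype F[X] ι _).trans (E'.trans
    ((LinearEquiv.piCongrLeft F[X] (fun i : {i // e i ≠ 0} =>
      F[X] ⧸ Ideal.span {p i ^ e i}) g).symm.trans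
      (LinearEquiv.piCongrRight fun i => Submodule.quotEquivOfEq _ _ ?_))))⟩⟩
  rw [(hg i).1, (hg i).2]
  exact Ideal.span_singleton_eq_span_singleton.2 ((normalize_associated _).symm.pow_pow)

/-- Over a perfect field, endomorphisms have Jordan bases. -/
theorem exists_jordanBasis [PerfectField F] {V : Type*} [AddCommGroup V] [Module F V]
    [Module.Finite F V] (T : Module.End F V) :
    ∃ (t : JordanType F) (A : ∀ i : t.Block, Matrix (Fin (t.delta i.1)) (Fin (t.delta i.1)) F),
      (∀ i, (A i).charpoly = t.N i.1) ∧
      ∃ b : Module.Basis (Σ i : t.Block, Fin (t.size i) × Fin (t.delta i.1)) F V,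
        LinearMap.toMatrix b b T =
          Matrix.blockDiagonal' fun i => jordanBlock (A i) (t.size i) := by
  obtain ⟨t, ⟨E⟩⟩ := exists_jordanType_quotient_equiv T
  choose A hA using fun i : t.Block => exists_charpoly_eq (t.monic i.1)
  have hsize : ∀ i, t.size i ≠ 0 := fun i =>
    (Nat.one_le_iff_ne_zero.1 ((t.isTable i.1).2 _ (List.get_mem _ _)))
  have hblock := fun i : t.Block => nonempty_quotient_equiv_jordanBlock (t.monic i.1)
    (t.irreducible i.1) (PerfectField.separable_of_irreducible (t.irreducible i.1)) (A i) (hA i)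
    (hsize i)
  let E₁ : Module.AEval' T ≃ₗ[F[X]]
      ∀ i : t.Block, Module.AEval' (Matrix.toLin' (jordanBlock (A i) (t.size i))) :=
    E.trans (LinearEquiv.piCongrRight fun i => (hblock i).some)
  let E₂ : V ≃ₗ[F] ((Σ i : t.Block, Fin (t.size i) × Fin (t.delta i.1)) → F) :=
    (Module.AEval'.of T).trans ((E₁.restrictScalars F).trans
      ((LinearEquiv.piCongrRight fun i =>
        (Module.AEval'.of (Matrix.toLin' (jordanBlock (A i) (t.size i)))).symm).trans
        (LinearEquiv.piCurry F fun _ _ => F).symm))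
  refine ⟨t, A, hA, Module.Basis.ofEquivFun E₂, toMatrix_eq_blockDiagonal' fun i v => ?_⟩
  have hcoord : ∀ v, blockCoord (Module.Basis.ofEquivFun E₂) i v =
      (Module.AEval'.of (Matrix.toLin' (jordanBlock (A i) (t.size i)))).symm
        (E₁ (Module.AEval'.of T v) i) := fun v => by
    ext x
    rw [blockCoord_apply, Module.Basis.ofEquivFun_repr_apply]
    rfl
  rw [hcoord, hcoord, ← Module.AEval'.X_smul_of, map_smul, Pi.smul_apply,
    Module.AEval'.of_symm_X_smul]
  rfl

end StructureTheorem

/-! ### Descent of the Jordan basis to the fixed field -/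

section Existence

variable {k : Type*} [Field k] [MulSemiringAction (Multiplicative ℕ) k] [Finite k]

/-- A `k`-linear map that preserves a form over the fixed field has a Jordan basis. -/
theorem exists_jordanBasis_of_commute {D : Type*} [AddCommGroup D] [Module k D]
    [Module.Finite k D] {ψ : D →ₛₗ[sigma k] D} (hψ : ∀ d, ψ^[sigmaOrder k] d = d)
    (T : Module.End k D) (hT : ∀ d, ψ (T d) = T (ψ d)) :
    ∃ (t : JordanType (fixedField k))
      (A : ∀ i : t.Block, Matrix (Fin (t.delta i.1)) (Fin (t.delta i.1)) (fixedField k)),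
      (∀ i, (A i).charpoly = t.N i.1) ∧
      ∃ b : Module.Basis (Σ i : t.Block, Fin (t.size i) × Fin (t.delta i.1)) k D,
        LinearMap.toMatrix b b T =
          (Matrix.blockDiagonal' fun i => jordanBlock (A i) (t.size i)).map
            (fixedField k).subtype := by
  have : Finite D := Module.finite_of_finite k
  -- A Jordan basis of the restriction of `T` to the fixed vectors is also a `k`-basis of `D`, with
  -- the same matrix.
  let T₀ : Module.End (fixedField k) (fixedVectors ψ) :=
    { toFun d := ⟨T d, by rw [mem_fixedVectors, hT, (mem_fixedVectors ψ).1 d.2]⟩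
      map_add' c d := Subtype.ext (map_add T _ _)
      map_smul' a d := Subtype.ext (map_smul T (a : k) (d : D)) }
  obtain ⟨t, A, hA, b₀, hb₀⟩ := exists_jordanBasis T₀
  let v : (Σ i : t.Block, Fin (t.size i) × Fin (t.delta i.1)) → D := fun i => (b₀ i : D)
  have hli : LinearIndependent k v := linearIndependent_fixedVectors b₀.linearIndependent
  have hspan : ⊤ ≤ Submodule.span k (Set.range v) := by
    rw [← span_fixedVectors hψ, Submodule.span_le]
    intro d hd
    have hsum : _ = d := congrArg Subtype.val (b₀.sum_repr ⟨d, hd⟩)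
    rw [← hsum, Submodule.coe_sum]
    exact Submodule.sum_mem _ fun i _ => Submodule.smul_mem _
      ((b₀.repr ⟨d, hd⟩ i : fixedField k) : k) (Submodule.subset_span ⟨i, rfl⟩)
  refine ⟨t, A, hA, Module.Basis.mk hli hspan, ?_⟩
  rw [← LinearEquiv.eq_symm_apply, LinearMap.toMatrix_symm]
  refine (Module.Basis.mk hli hspan).ext fun i => ?_
  rw [Matrix.toLin_self, Module.Basis.mk_apply]
  have h0 : T₀ = Matrix.toLin b₀ b₀
      (Matrix.blockDiagonal' fun i => jordanBlock (A i) (t.size i)) := by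
    rw [← hb₀, Matrix.toLin_toMatrix]
  have h1 : T₀ (b₀ i) = ∑ j, (Matrix.blockDiagonal' fun i => jordanBlock (A i) (t.size i)) j i •
      b₀ j := by
    rw [h0, Matrix.toLin_self]
  refine (congrArg Subtype.val h1).trans ?_
  rw [Submodule.coe_sum]
  refine Finset.sum_congr rfl fun j _ => ?_
  rw [Module.Basis.mk_apply]
  rfl

/-- The semilinear map `v X` defines the form; `X ^ r` commutes with `X` and with `k[X ^ r]`, hence
preserves it. -/
theorem exists_hasType {P : SkewPolynomial k} (hP : IsMonic P) (hX : XInjective k (PhiModule P)) :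
    ∃ t, HasType P t := by
  have hfin := finite_phiModule hP
  obtain ⟨v, hv⟩ := exists_twist hX
  let ψ : PhiModule P →ₛₗ[sigma k] PhiModule P :=
    { toFun d := (rho k v * SkewPolynomial.X) • d
      map_add' c d := smul_add _ _ _
      map_smul' a d := by rw [mul_smul, X_smul_smul, rho_smul_smul, mul_smul] }
  have hψ : ∀ d, ψ^[sigmaOrder k] d = d := fun d => by
    change (fun d : PhiModule P => (rho k v * SkewPolynomial.X) • d)^[sigmaOrder k] d = d
    rw [smul_iterate]
    exact hv d
  obtain ⟨t, A, hA, b, hb⟩ := exists_jordanBasis_of_commute hψ (rhoEnd (PhiModule P) (X : k[X]))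
    fun d => by
      change (rho k v * SkewPolynomial.X) • rho k X • d =
        rho k X • (rho k v * SkewPolynomial.X) • d
      rw [← mul_smul, ← mul_smul, mul_assoc, X_mul_rho, map_X, ← mul_assoc, ← mul_assoc,
        ← map_mul, ← map_mul, mul_comm]
  exact ⟨t, A, hA, b, by rw [phiPow_eq, hb]⟩

end Existence

end SkewFactor

end

theorem mainTheorem10 {k : Type*} [Field k] [Finite k] [MulSemiringAction (Multiplicative ℕ) k]
    (P : SkewPolynomial k) (hmonic : SkewFactor.IsMonic P) (hetale : SkewFactor.IsEtale P) :
    (∃ t : SkewFactor.JordanType (SkewFactor.fixedField k), SkewFactor.HasType P t) ∧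
    ∀ t : SkewFactor.JordanType (SkewFactor.fixedField k), SkewFactor.HasType P t →
      (SkewFactor.factorizations P).encard =
        ((Nat.multinomial Finset.univ t.tau *
          ∑ Γ ∈ Fintype.piFinset (fun l : Fin t.s => SkewFactor.pathSeqs (t.T l)),
            ∏ l : Fin t.s,
              SkewFactor.seqWeight (Nat.card (SkewFactor.fixedField k) ^ t.delta l)
                (t.T l) (Γ l) : ℕ) : ℕ∞) := by
  have hX : SkewFactor.XInjective k (SkewFactor.PhiModule P) := hetale
  refine ⟨SkewFactor.exists_hasType hmonic hX, fun t ht => ?_⟩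
  rw [SkewFactor.encard_factorizations t.monic t.irreducible t.injective t.isTable hmonic hX
    (SkewFactor.hasTables_of_hasType ht), SkewFactor.predicted]
  simp only [SkewFactor.weightSum]
  -- Expanding the product over `l` of the weight sums gives the sum over tuples of path sequences.
  rw [Finset.prod_univ_sum]
  rfl
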